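/- **Theorem (Kernel equations of the Volterra–Fredholm transformation).** Let $n\ge 1$, $z_0\in(0,1)$ and $\tilde z_0=\frac{z_0}{1-z_0}$. Let $\check\lambda_1,\dots,\check\lambda_n\in C^2[0,1]$ with $\check\lambda_1(x)>\dots>\check\lambda_n(x)>0$ for all $x\in[0,1]$, and define the folded diffusion coefficients on $[0,1]$ $$\lambda^l_i(z)=\frac{\check\lambda_i(z_0-z_0z)}{z_0^2},\qquad \lambda^r_i(z)=\frac{\check\lambda_i(z_0+(1-z_0)z)}{(1-z_0)^2},$$ $\Lambda_l=\operatorname{diag}(\lambda^l_1,\dots,\lambda^l_n)$, $\Lambda_r=\operatorname{diag}(\lambda^r_1,\dots,\lambda^r_n)$. Assume that $z_0$ is such that $\lambda_i^r(z)<\lambda_j^l(z)$ for all $i,j$ and all $z\in[0,1]$. Let $\widetilde A_0^{l},\widetilde A_1^{l},\bar A_0^{lr},\bar A_1^{lr}:[0,1]\to\mathbb R^{n\times n}$ be piecewise continuous, with $\widetilde A_0^{l},\widetilde A_1^{l}$ strictly lower triangular, and let the entries $\bar A^{lr}_{1,ij}$ with $i\le j$ be continuous with piecewise continuous derivative and satisfy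 $\bar A_{1,ij}^{lr}(0)=0$. Then there are strictly lower triangular, piecewise continuous matrix functions $\check A_0^{r},\check A_1^{r}:[0,1]\to\mathbb R^{n\times n}$ and kernels $P(z,\zeta)\in\mathbb R^{n\times n}$ on the square $0\le z,\zeta\le1$ and $Q(z,\zeta)\in\mathbb R^{n\times n}$ on the triangle $0\le\zeta\le z\le1$ that solve \begin{align*} &\Lambda_r(z)P_{zz}(z,\zeta)-(P(z,\zeta)\Lambda_l(\zeta))_{\zeta\zeta}=0,\\ &P_\zeta(z,1)\Lambda_l(1)+P(z,1)\Lambda_l'(1)=0,\qquad P(0,\zeta)=0,\qquad P_z(0,\zeta)=0,\\ &\Lambda_r(z)Q_{zz}(z,\zeta)-(Q(z,\zeta)\Lambda_r(\zeta))_{\zeta\zeta}=0,\\ &Q_\zeta(z,z)\Lambda_r(z)+Q(z,z)\Lambda_r'(z)+\Lambda_r(z)\tfrac{d}{dz}Q(z,z)+\Lambda_r(z)Q_z(z,z)=0,\\ &\Lambda_r(z)Q(z,z)-Q(z,z)\Lambda_r(z)=0,\qquad Q(0,0)=0, \end{align*} with the coupling conditions \begin{align*} P(z,0)\Lambda_l(0)-\tfrac1{\tilde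 z_0}Q(z,0)\Lambda_r(0)&=\bar A_1^{lr}(z)-\int_0^zQ(z,\zeta)\bar A_1^{lr}(\zeta)\,d\zeta-\int_0^1P(z,\zeta)\widetilde A_1^l(\zeta)\,d\zeta+\tfrac1{\tilde z_0}\check A_1^r(z),\\ Q_\zeta(z,0)\Lambda_r(0)+Q(z,0)\Lambda_r'(0)+P_\zeta(z,0)\Lambda_l(0)+P(z,0)\Lambda_l'(0)&=-\bar A_0^{lr}(z)+\int_0^zQ(z,\zeta)\bar A_0^{lr}(\zeta)\,d\zeta+\int_0^1P(z,\zeta)\widetilde A_0^l(\zeta)\,d\zeta+\check A_0^r(z). \end{align*} Here $P$ and $Q$ are continuous on their closed domains, and finitely many graphs $\zeta=\gamma(z)$ of $C^1$ functions on $[0,1]$ cut the interior of the domain of each entry into finitely many disjoint open pieces on each of which the entry is $C^1$ with uniformly continuous first derivatives (so the kernels are in particular piecewise continuous). The differential equations hold in the sense of distributions in the interior of the domains. The conditions without derivatives hold on the whole closed boundary part concerned; each condition with derivatives holds at all but finitely many points of the boundary part concerned, with the derivatives existing there as one-sided derivatives from within the domain. -/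

import Mathlib

open Set Filter Topology MeasureTheory
open scoped ContDiff

noncomputable section

namespace Folding

/-! ### Piecewise regular functions -/

/-- `f` is piecewise continuous on `[0,1]`: continuous off a finite set, with finite one-sided
limits everywhere. -/
def PiecewiseContinuous (f : ℝ → ℝ) : Prop :=
  (∃ S : Finset ℝ, ContinuousOn f (Icc 0 1 \ (S : Set ℝ))) ∧
  (∀ x ∈ Ico (0 : ℝ) 1, ∃ l : ℝ, Tendsto f (𝓝[>] x) (𝓝 l)) ∧
  (∀ x ∈ Ioc (0 : ℝ) 1, ∃ l : ℝ, Tendsto f (𝓝[<] x) (𝓝 l))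

/-- `f` is continuous on `[0,1]` and its derivative, which exists off a finite set, is piecewise
continuous. -/
def PiecewiseC1 (f : ℝ → ℝ) : Prop :=
  ContinuousOn f (Icc 0 1) ∧
  ∃ g : ℝ → ℝ, PiecewiseContinuous g ∧
    ∃ S : Finset ℝ, ∀ x ∈ Ioo (0 : ℝ) 1 \ (S : Set ℝ), HasDerivAt f (g x) x

/-- `f` is continuous on the planar region `Ω` and has piecewise continuous first derivatives:
finitely many graphs `ζ = γ k z` of `C¹` functions cut the interior of `Ω` into finitely many
disjoint open pieces, and on each piece `f` is `C¹` with uniformly continuous derivative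
(that is, the derivative extends continuously to the closure of the piece). -/
def PiecewiseC1On (Ω : Set (ℝ × ℝ)) (f : ℝ × ℝ → ℝ) : Prop :=
  ContinuousOn f Ω ∧
  ∃ (N m : ℕ) (γ : Fin N → ℝ → ℝ) (U : Fin m → Set (ℝ × ℝ)),
    (∀ k, ContDiffOn ℝ 1 (γ k) (Icc 0 1)) ∧
    (∀ k, IsOpen (U k)) ∧
    (∀ k l, k ≠ l → Disjoint (U k) (U l)) ∧
    (∀ k, U k ⊆ interior Ω) ∧
    interior Ω ⊆ (⋃ k, U k) ∪ (⋃ k, {p : ℝ × ℝ | p.2 = γ k p.1}) ∧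
    ∀ k, ContDiffOn ℝ 1 f (U k) ∧ UniformContinuousOn (fderiv ℝ f) (U k)

/-! ### Domains and coefficients -/

/-- The square `0 ≤ z ≤ 1`, `0 ≤ ζ ≤ 1`, with points `(z, ζ)`. -/
def square : Set (ℝ × ℝ) := Icc 0 1 ×ˢ Icc 0 1

/-- The triangle `0 ≤ ζ ≤ z ≤ 1`, with points `(z, ζ)`. -/
def triangle : Set (ℝ × ℝ) := {p | 0 ≤ p.2 ∧ p.2 ≤ p.1 ∧ p.1 ≤ 1}

/-- Folded diffusion coefficients of the left part, for the folding point `z₀`. -/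
def lamL {n : ℕ} (lam : Fin n → ℝ → ℝ) (z₀ : ℝ) (i : Fin n) (z : ℝ) : ℝ :=
  lam i (z₀ - z₀ * z) / z₀ ^ 2

/-- Folded diffusion coefficients of the right part, for the folding point `z₀`. -/
def lamR {n : ℕ} (lam : Fin n → ℝ → ℝ) (z₀ : ℝ) (i : Fin n) (z : ℝ) : ℝ :=
  lam i (z₀ + (1 - z₀) * z) / (1 - z₀) ^ 2

/-- The constant of the folding conditions. -/
def foldRatio (z₀ : ℝ) : ℝ := z₀ / (1 - z₀)

/-- The diagonal matrix with the given coefficients. -/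
def diagMat {n : ℕ} (lam : Fin n → ℝ → ℝ) (z : ℝ) : Matrix (Fin n) (Fin n) ℝ :=
  Matrix.diagonal fun i => lam i z

/-- Its derivative on `[0,1]` (one-sided at the end points). -/
def diagMatDeriv {n : ℕ} (lam : Fin n → ℝ → ℝ) (z : ℝ) : Matrix (Fin n) (Fin n) ℝ :=
  Matrix.diagonal fun i => derivWithin (lam i) (Icc 0 1) z

/-- Strictly lower triangular matrices. -/
def StrictlyLower {n : ℕ} (M : Matrix (Fin n) (Fin n) ℝ) : Prop :=
  ∀ i j, i ≤ j → M i j = 0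

/-! ### Derivatives and integrals of matrix functions -/

/-- `D` is the derivative of `M (·, ζ)` at `z`, relative to the set `s` of values of `z`. -/
def HasPartialZ {n : ℕ} (M : ℝ → ℝ → Matrix (Fin n) (Fin n) ℝ) (D : Matrix (Fin n) (Fin n) ℝ)
    (s : Set ℝ) (z ζ : ℝ) : Prop :=
  ∀ i j, HasDerivWithinAt (fun t => M t ζ i j) (D i j) s z

/-- `D` is the derivative of `M (z, ·)` at `ζ`, relative to the set `s` of values of `ζ`. -/
def HasPartialZeta {n : ℕ} (M : ℝ → ℝ → Matrix (Fin n) (Fin n) ℝ) (D : Matrix (Fin n) (Fin n) ℝ)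
    (s : Set ℝ) (z ζ : ℝ) : Prop :=
  ∀ i j, HasDerivWithinAt (fun t => M z t i j) (D i j) s ζ

/-- Entrywise integral of a matrix function over `[a, b]`. -/
def matIntegral {n : ℕ} (a b : ℝ) (M : ℝ → Matrix (Fin n) (Fin n) ℝ) :
    Matrix (Fin n) (Fin n) ℝ :=
  Matrix.of fun i j => ∫ ζ in a..b, M ζ i j

/-- `f` solves `a(z) f_zz - (b(ζ) f)_ζζ = 0` in the interior of `Ω` in the sense of
distributions. -/
def WeakKernelPDE (Ω : Set (ℝ × ℝ)) (a b : ℝ → ℝ) (f : ℝ → ℝ → ℝ) : Prop :=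
  ∀ φ : ℝ × ℝ → ℝ, ContDiff ℝ ∞ φ → HasCompactSupport φ → tsupport φ ⊆ interior Ω →
    ∫ p in Ω, f p.1 p.2 *
      (iteratedDeriv 2 (fun t => a t * φ (t, p.2)) p.1
        - b p.2 * iteratedDeriv 2 (fun s => φ (p.1, s)) p.2) = 0

/-! ### The boundary value problem -/

/-- `P` (on the square) and `Q` (on the triangle) solve the kernel equations of the
Volterra-Fredholm transformation with diffusion coefficients `ll`, `lr`, folding constant `c`,
data `A0l`, `A1l` (the left coupling matrices), `A0lr`, `A1lr` (the couplings from left to right)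
and remaining coupling matrices `A0r`, `A1r`. The differential equations hold in the sense of
distributions. Boundary conditions without derivatives hold everywhere; those with
derivatives, which are only piecewise continuous, hold at all but finitely many points, where the
one-sided derivatives are required to exist. -/
structure IsDecouplingKernel {n : ℕ} (ll lr : Fin n → ℝ → ℝ) (c : ℝ)
    (A0l A1l A0lr A1lr A0r A1r : ℝ → Matrix (Fin n) (Fin n) ℝ)
    (P Q : ℝ → ℝ → Matrix (Fin n) (Fin n) ℝ) : Prop where
  /-- `Λ_r(z) P_zz - (P Λ_l(ζ))_ζζ = 0` on the square. -/
  pde_P : ∀ i j, WeakKernelPDE square (lr i) (ll j) (fun z ζ => P z ζ i j)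
  /-- `P_ζ(z,1) Λ_l(1) + P(z,1) Λ_l'(1) = 0`. -/
  P_one : ∃ S : Finset ℝ, ∀ z ∈ Ioo (0 : ℝ) 1 \ (S : Set ℝ),
    ∃ Pζ, HasPartialZeta P Pζ (Icc 0 1) z 1 ∧
      Pζ * diagMat ll 1 + P z 1 * diagMatDeriv ll 1 = 0
  /-- `P(0,ζ) = 0`. -/
  P_zero : ∀ ζ ∈ Icc (0 : ℝ) 1, P 0 ζ = 0
  /-- `P_z(0,ζ) = 0`. -/
  Pz_zero : ∃ S : Finset ℝ, ∀ ζ ∈ Ioo (0 : ℝ) 1 \ (S : Set ℝ),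
    HasPartialZ P 0 (Icc 0 1) 0 ζ
  /-- `Λ_r(z) Q_zz - (Q Λ_r(ζ))_ζζ = 0` on the triangle. -/
  pde_Q : ∀ i j, WeakKernelPDE triangle (lr i) (lr j) (fun z ζ => Q z ζ i j)
  /-- `Q_ζ(z,z) Λ_r(z) + Q(z,z) Λ_r'(z) + Λ_r(z) (d/dz) Q(z,z) + Λ_r(z) Q_z(z,z) = 0`. -/
  Q_diag : ∃ S : Finset ℝ, ∀ z ∈ Ioo (0 : ℝ) 1 \ (S : Set ℝ),
    ∃ Qζ Qd Qz, HasPartialZeta Q Qζ (Icc 0 z) z z ∧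
      (∀ i j, HasDerivAt (fun t => Q t t i j) (Qd i j) z) ∧
      HasPartialZ Q Qz (Icc z 1) z z ∧
      Qζ * diagMat lr z + Q z z * diagMatDeriv lr z + diagMat lr z * Qd + diagMat lr z * Qz = 0
  /-- `Λ_r(z) Q(z,z) - Q(z,z) Λ_r(z) = 0`. -/
  Q_comm : ∀ z ∈ Icc (0 : ℝ) 1, diagMat lr z * Q z z - Q z z * diagMat lr z = 0
  /-- `Q(0,0) = 0`. -/
  Q_origin : Q 0 0 = 0
  /-- The coupling condition for the values at `ζ = 0`. -/
  coupling_value : ∀ z ∈ Icc (0 : ℝ) 1,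
    P z 0 * diagMat ll 0 - (1 / c) • (Q z 0 * diagMat lr 0)
      = A1lr z - matIntegral 0 z (fun ζ => Q z ζ * A1lr ζ)
        - matIntegral 0 1 (fun ζ => P z ζ * A1l ζ) + (1 / c) • A1r z
  /-- The coupling condition for the derivatives at `ζ = 0`. -/
  coupling_deriv : ∃ S : Finset ℝ, ∀ z ∈ Ioo (0 : ℝ) 1 \ (S : Set ℝ),
    ∃ Qζ Pζ, HasPartialZeta Q Qζ (Icc 0 z) z 0 ∧ HasPartialZeta P Pζ (Icc 0 1) z 0 ∧
      Qζ * diagMat lr 0 + Q z 0 * diagMatDeriv lr 0 + Pζ * diagMat ll 0 + P z 0 * diagMatDeriv ll 0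
        = - A0lr z + matIntegral 0 z (fun ζ => Q z ζ * A0lr ζ)
          + matIntegral 0 1 (fun ζ => P z ζ * A0l ζ) + A0r z

end Folding

end

/-!
The rows of the kernel equations decouple. In row `i` the entries of `P` and `Q` below the diagonal
are taken to be zero; there the coupling conditions contain no boundary values and simply define
the strictly lower triangular matrices `A0r` and `A1r`. What remains for row `i` are the columns
`j ≥ i`, with two coupling conditions at `ζ = 0` for the two entries of each column
(`exists_isDecouplingKernel`, `exists_isRowKernel`).

For a fixed row, `z` is replaced by the travel time `s = ∫ dz / √λ` of the row and `ζ` by the travel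
time `y` of the column (`Coord`). With the factor in `kernelFun` the equations become wave equations
`w_ss - w_yy = q w` on `0 ≤ y ≤ L`, where `s` plays the role of time. The conditions at `z = 0` say
that the waves start at rest, the condition at `ζ = 1` is a Robin condition at `y = L`, and the
coupling conditions at `y = 0` act as sources. Each wave is written explicitly as the sum of a part
emitted at `y = 0` with profile `f`, its reflection at `y = L` with a correction `k`, and half the
integral of the source `F` over the backward cone (`wave`). All conditions are then linear causal
equations for `(f, k, F)`. They are solved by contraction in a supremum norm weighted by an
exponential in time: every term is delayed or integrated, and gains a factor `1 / K` if the weight is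
`exp (K s)` (`Feedback.abs_apply_le`, `exists_affine_fixed_point`, `exists_wave_system`). To
have equations of this kind, the first coupling condition, which concerns values, is differentiated in
time. The two conditions then determine the two profiles of a column by an invertible matrix, since
the weights of `P` and `Q` in the first condition have opposite signs (`exists_coupled_waves`).
Integration in time gives the condition itself back, as `A1lr` vanishes at `0` on and above the
diagonal (`integral_integral_waveS`, `exists_derivative_weight`).

Finite propagation speed (`Admissible.wave_zero`) yields the conditions at `z = 0`. It also lets the
kernel `Q` on the triangle be treated like one on the square: on and above the diagonal of the matrix
the coefficients of the columns do not exceed that of the row, so the wave reaches the point `ζ` not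
before `z = ζ`, `Q` vanishes for `ζ ≥ z`, and the integrals over `[0, z]` are integrals over `[0, 1]`.
The derivative condition on the line `ζ = z` is trivial except for `i = j`, where the front of the
wave moves along that line and its two one-sided derivatives cancel
(`hasDerivWithinAt_wave_front`).

For the regularity, `f` solves a delay equation and is therefore continuous up to finitely many jumps
(`exists_stepCont_of_delay`). The kernels are continuous, and their derivatives jump only across
the characteristics that start at these jumps or are their reflections (`piecewiseC1On_kernelFun`).
The differential equation holds in the sense of distributions because the wave is a sum of two
transported parts, along which one integrates by parts (`integral_wave_mul_box`,
`weakKernelPDE_kernelFun`).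
-/
noncomputable section

namespace Folding

/-! ### Affine Volterra equations -/

/-- An affine equation `x = d + A x` for a function `x` has a solution if the linear operator `A`
halves the norm `sup |x a| / W a`. The class `C` of admissible functions need not be a normed space
of its own: it suffices that it is stable under `A`, sums, differences and limits in this norm. -/
theorem exists_affine_fixed_point {α : Type*} {W : α → ℝ}
    (C : (α → ℝ) → Prop) (A : (α → ℝ) → α → ℝ) (d : α → ℝ) (hd : C d)
    (hadd : ∀ x y, C x → C y → C (x + y)) (hsub : ∀ x y, C x → C y → C (x - y))
    (hA : ∀ x, C x → C (A x)) (hlin : ∀ x y, C x → C y → A (x - y) = A x - A y)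
    (hbd : ∀ x, C x → ∃ M, 0 ≤ M ∧ ∀ a, |x a| ≤ M * W a)
    (hcontr : ∀ x M, C x → 0 ≤ M → (∀ a, |x a| ≤ M * W a) → ∀ a, |A x a| ≤ M / 2 * W a)
    (hlim : ∀ (X : ℕ → α → ℝ) (x : α → ℝ) (ε : ℕ → ℝ), (∀ n, C (X n)) →
      Tendsto ε atTop (𝓝 0) → (∀ n a, |X n a - x a| ≤ ε n * W a) → C x) :
    ∃ x, C x ∧ ∀ a, x a = d a + A x a := by
  -- the Picard iterates
  set X : ℕ → α → ℝ := fun n => (fun x => d + A x)^[n] d with hX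
  have hX0 : X 0 = d := rfl
  have hXs : ∀ n, X (n + 1) = d + A (X n) := fun n => by
    simp only [hX, Function.iterate_succ_apply']
  have hXC : ∀ n, C (X n) := by
    intro n
    induction n with
    | zero => exact hd
    | succ n ih => rw [hXs]; exact hadd _ _ hd (hA _ ih)
  obtain ⟨M, hM0, hM⟩ := hbd (X 1 - X 0) (hsub _ _ (hXC 1) (hXC 0))
  have hD : ∀ n a, |(X (n + 1) - X n) a| ≤ M / 2 ^ n * W a := by
    intro n
    induction n with
    | zero => simpa using hM
    | succ n ih =>
      intro a
      have h1 : X (n + 1 + 1) - X (n + 1) = A (X (n + 1) - X n) := by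
        rw [hlin _ _ (hXC _) (hXC _), hXs (n + 1), hXs n]
        abel
      rw [h1]
      refine (hcontr _ (M / 2 ^ n) (hsub _ _ (hXC _) (hXC _)) (by positivity) ih a).trans
        (le_of_eq ?_)
      rw [pow_succ]; field_simp
  have hdist : ∀ a n, dist (X n a) (X (n + 1) a) ≤ 2 * (M * W a) / 2 / 2 ^ n := by
    intro a n
    rw [dist_comm, Real.dist_eq]
    refine (hD n a).trans (le_of_eq ?_)
    field_simp
  have hcau : ∀ a, ∃ l, Tendsto (fun n => X n a) atTop (𝓝 l) := fun a =>
    cauchySeq_tendsto_of_complete (cauchySeq_of_le_geometric_two (hdist a))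
  choose x hx using hcau
  have hxX : ∀ n a, |X n a - x a| ≤ 2 * M / 2 ^ n * W a := by
    intro n a
    have := dist_le_of_le_geometric_two_of_tendsto (hdist a) (hx a) n
    rw [Real.dist_eq] at this
    refine this.trans (le_of_eq ?_)
    field_simp
  have hε : Tendsto (fun n : ℕ => 2 * M / (2 : ℝ) ^ n) atTop (𝓝 0) :=
    tendsto_const_nhds.div_atTop (tendsto_pow_atTop_atTop_of_one_lt (by norm_num))
  have hxC : C x := hlim X x _ hXC hε hxX
  refine ⟨x, hxC, fun a => ?_⟩
  have hAx : Tendsto (fun n => A (X n) a) atTop (𝓝 (A x a)) := by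
    rw [tendsto_iff_dist_tendsto_zero]
    have hε' : Tendsto (fun n : ℕ => 2 * M / (2 : ℝ) ^ n / 2 * W a) atTop (𝓝 0) := by
      simpa using (hε.div_const 2).mul_const (W a)
    refine squeeze_zero (fun _ => dist_nonneg) (fun n => ?_) hε'
    rw [Real.dist_eq, ← Pi.sub_apply, ← hlin _ _ (hXC n) hxC]
    exact hcontr _ _ (hsub _ _ (hXC n) hxC) (by positivity) (hxX n) a
  have h1 : Tendsto (fun n => X (n + 1) a) atTop (𝓝 (x a)) := (tendsto_add_atTop_iff_nat 1).2 (hx a)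
  have h2 : Tendsto (fun n => X (n + 1) a) atTop (𝓝 (d a + A x a)) := by
    simp only [hXs, Pi.add_apply]
    exact hAx.const_add _
  exact tendsto_nhds_unique h1 h2

/-! ### Integral operators of the wave equation -/

/-- Continuous partial derivatives make a function of two variables `C¹`. -/
theorem contDiff_one_of_partials {f f₁ f₂ : ℝ → ℝ → ℝ}
    (h₁ : ∀ s y, HasDerivAt (fun t => f t y) (f₁ s y) s)
    (h₂ : ∀ s y, HasDerivAt (fun t => f s t) (f₂ s y) y)
    (c₁ : Continuous fun p : ℝ × ℝ => f₁ p.1 p.2) (c₂ : Continuous fun p : ℝ × ℝ => f₂ p.1 p.2) :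
    ContDiff ℝ 1 fun p : ℝ × ℝ => f p.1 p.2 := by
  rw [contDiff_one_iff_hasFDerivAt]
  refine ⟨fun p => (ContinuousLinearMap.toSpanSingleton ℝ (f₁ p.1 p.2)).coprod
    (ContinuousLinearMap.toSpanSingleton ℝ (f₂ p.1 p.2)), ?_, fun p => ?_⟩
  · have e : (fun p : ℝ × ℝ => (ContinuousLinearMap.toSpanSingleton ℝ (f₁ p.1 p.2)).coprod
        (ContinuousLinearMap.toSpanSingleton ℝ (f₂ p.1 p.2))) = fun p =>
        f₁ p.1 p.2 • ContinuousLinearMap.fst ℝ ℝ ℝ + f₂ p.1 p.2 • ContinuousLinearMap.snd ℝ ℝ ℝ := by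
      ext p <;> simp
    rw [e]
    fun_prop
  · have := hasStrictFDerivAt_uncurry_coprod (𝕜 := ℝ) (u := p) (f := f)
      (f₁ := fun a b => ContinuousLinearMap.toSpanSingleton ℝ (f₁ a b))
      (f₂ := fun a b => ContinuousLinearMap.toSpanSingleton ℝ (f₂ a b))
      (Eventually.of_forall fun v => (h₁ v.1 v.2).hasFDerivAt)
      (Eventually.of_forall fun v => (h₂ v.1 v.2).hasFDerivAt)
      ?_ ?_
    · exact this.hasFDerivAt
    · have e : (↿fun a b => ContinuousLinearMap.toSpanSingleton ℝ (f₁ a b)) = fun p : ℝ × ℝ =>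
        f₁ p.1 p.2 • ContinuousLinearMap.id ℝ ℝ := by
        ext p; simp [Function.HasUncurry.uncurry]
      rw [e]
      exact (c₁.smul continuous_const).continuousAt
    · have e : (↿fun a b => ContinuousLinearMap.toSpanSingleton ℝ (f₂ a b)) = fun p : ℝ × ℝ =>
        f₂ p.1 p.2 • ContinuousLinearMap.id ℝ ℝ := by
        ext p; simp [Function.HasUncurry.uncurry]
      rw [e]
      exact (c₂.smul continuous_const).continuousAt

/-- Differentiation of `∫₀ˢ g(σ, x) dσ` under the integral sign. -/
theorem hasDerivAt_parametric_integral {g g' : ℝ → ℝ → ℝ}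
    (hg : ∀ σ x, HasDerivAt (g σ) (g' σ x) x)
    (cg : Continuous fun p : ℝ × ℝ => g p.1 p.2) (cg' : Continuous fun p : ℝ × ℝ => g' p.1 p.2)
    (s x : ℝ) :
    HasDerivAt (fun x => ∫ σ in (0 : ℝ)..s, g σ x) (∫ σ in (0 : ℝ)..s, g' σ x) x := by
  have hcomp : IsCompact (uIcc 0 s ×ˢ Icc (x - 1) (x + 1)) := isCompact_uIcc.prod isCompact_Icc
  obtain ⟨B, hB⟩ := hcomp.exists_bound_of_continuousOn cg'.continuousOn
  refine (intervalIntegral.hasDerivAt_integral_of_dominated_loc_of_deriv_le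
    (F := fun x σ => g σ x) (F' := fun x σ => g' σ x) (bound := fun _ => B)
    (s := Icc (x - 1) (x + 1)) (Icc_mem_nhds (by linarith) (by linarith)) ?_ ?_ ?_ ?_ ?_ ?_).2
  · exact Eventually.of_forall fun x => Continuous.aestronglyMeasurable (by fun_prop)
  · exact Continuous.intervalIntegrable (by fun_prop) _ _
  · exact Continuous.aestronglyMeasurable (by fun_prop)
  · exact Eventually.of_forall fun t ht y hy => hB (t, y) ⟨uIoc_subset_uIcc ht, hy⟩
  · exact intervalIntegrable_const
  · exact Eventually.of_forall fun t _ y _ => hg t y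

theorem contDiff_parametric_integral {g g' : ℝ → ℝ → ℝ}
    (hg : ∀ σ x, HasDerivAt (g σ) (g' σ x) x)
    (cg : Continuous fun p : ℝ × ℝ => g p.1 p.2) (cg' : Continuous fun p : ℝ × ℝ => g' p.1 p.2) :
    ContDiff ℝ 1 (fun p : ℝ × ℝ => ∫ σ in (0 : ℝ)..p.1, g σ p.2) := by
  refine contDiff_one_of_partials (f := fun s x => ∫ σ in (0 : ℝ)..s, g σ x) (f₁ := g)
    (f₂ := fun s x => ∫ σ in (0 : ℝ)..s, g' σ x) (fun s y => ?_)
    (fun s y => hasDerivAt_parametric_integral hg cg cg' s y) cg ?_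
  · have : Continuous fun σ => g σ y := by fun_prop
    exact intervalIntegral.integral_hasDerivAt_right (this.intervalIntegrable _ _)
      (this.stronglyMeasurableAtFilter _ _) this.continuousAt
  · exact intervalIntegral.continuous_parametric_intervalIntegral_of_continuous
      (f := fun (p : ℝ × ℝ) σ => g' σ p.2) (by fun_prop) (by fun_prop)

/-- The derivative of `s ↦ ∫₀ˢ g(σ, y + ε s) dσ`. -/
theorem hasDerivAt_parametric_integral_diag {g g' : ℝ → ℝ → ℝ}
    (hg : ∀ σ x, HasDerivAt (g σ) (g' σ x) x)
    (cg : Continuous fun p : ℝ × ℝ => g p.1 p.2) (cg' : Continuous fun p : ℝ × ℝ => g' p.1 p.2)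
    (ε s y : ℝ) :
    HasDerivAt (fun s => ∫ σ in (0 : ℝ)..s, g σ (y + ε * s))
      (g s (y + ε * s) + ε * ∫ σ in (0 : ℝ)..s, g' σ (y + ε * s)) s := by
  set G : ℝ × ℝ → ℝ := fun p => ∫ σ in (0 : ℝ)..p.1, g σ p.2 with hG
  have hGd : ∀ p, HasFDerivAt G (fderiv ℝ G p) p := fun p =>
    ((contDiff_parametric_integral hg cg cg').differentiable one_ne_zero p).hasFDerivAt
  have e1 : ∀ s x, fderiv ℝ G (s, x) (1, 0) = g s x := by
    intro s x
    have h1 : HasDerivAt (fun t : ℝ => (t, x)) (1, 0) s := (hasDerivAt_id s).prodMk (hasDerivAt_const s x)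
    have h2 := (hGd (s, x)).comp_hasDerivAt s h1
    have : Continuous fun σ => g σ x := by fun_prop
    exact h2.unique (intervalIntegral.integral_hasDerivAt_right (this.intervalIntegrable _ _)
      (this.stronglyMeasurableAtFilter _ _) this.continuousAt)
  have e2 : ∀ s x, fderiv ℝ G (s, x) (0, 1) = ∫ σ in (0 : ℝ)..s, g' σ x := by
    intro s x
    have h1 : HasDerivAt (fun t : ℝ => (s, t)) (0, 1) x := (hasDerivAt_const x s).prodMk (hasDerivAt_id x)
    have h2 := (hGd (s, x)).comp_hasDerivAt x h1
    exact h2.unique (hasDerivAt_parametric_integral hg cg cg' s x)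
  have h1 : HasDerivAt (fun t : ℝ => (t, y + ε * t)) (1, ε) s := by
    refine (hasDerivAt_id s).prodMk ?_
    simpa using ((hasDerivAt_id s).const_mul ε).const_add y
  have h2 := (hGd (s, y + ε * s)).comp_hasDerivAt s h1
  have e3 : ((1 : ℝ), ε) = (1, 0) + ε • ((0 : ℝ), (1 : ℝ)) := by simp
  rw [e3, map_add, map_smul, e1, e2, smul_eq_mul] at h2
  exact h2

/-- `½ ∫∫ F` over the backward characteristic triangle with vertex `(s, y)`. -/
def coneInt (F : ℝ × ℝ → ℝ) (s y : ℝ) : ℝ :=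
  1 / 2 * ∫ σ in (0 : ℝ)..s, ∫ η in (y - (s - σ))..(y + (s - σ)), F (σ, η)

/-- The time derivative of `coneInt F`. -/
def coneS (F : ℝ × ℝ → ℝ) (s y : ℝ) : ℝ :=
  1 / 2 * ∫ σ in (0 : ℝ)..s, (F (σ, y + (s - σ)) + F (σ, y - (s - σ)))

/-- The space derivative of `coneInt F`. -/
def coneY (F : ℝ × ℝ → ℝ) (s y : ℝ) : ℝ :=
  1 / 2 * ∫ σ in (0 : ℝ)..s, (F (σ, y + (s - σ)) - F (σ, y - (s - σ)))

/-- `∫ F(σ, ·)` over `[0, x + ε σ]`. -/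
def fibreInt (F : ℝ × ℝ → ℝ) (ε σ x : ℝ) : ℝ := ∫ η in (0 : ℝ)..(x + ε * σ), F (σ, η)

theorem continuous_fibreInt {F : ℝ × ℝ → ℝ} (hF : Continuous F) (ε : ℝ) :
    Continuous fun p : ℝ × ℝ => fibreInt F ε p.1 p.2 :=
  intervalIntegral.continuous_parametric_intervalIntegral_of_continuous
    (f := fun (p : ℝ × ℝ) η => F (p.1, η)) (by fun_prop) (by fun_prop)

theorem hasDerivAt_fibreInt {F : ℝ × ℝ → ℝ} (hF : Continuous F) (ε σ x : ℝ) :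
    HasDerivAt (fibreInt F ε σ) (F (σ, x + ε * σ)) x := by
  have hc : Continuous fun η => F (σ, η) := by fun_prop
  have h := intervalIntegral.integral_hasDerivAt_right (hc.intervalIntegrable 0 (x + ε * σ))
      (hc.stronglyMeasurableAtFilter _ _) hc.continuousAt
  exact h.comp_add_const x (ε * σ)

/-- The integral over the cone as the difference of two terms that depend, apart from the upper
limit `s`, only on `y + s` and on `y - s` respectively. In this form `F` need only be continuous for `coneInt F`
to be `C¹`, because `fibreInt F` is differentiable in its last argument. -/
theorem coneInt_eq {F : ℝ × ℝ → ℝ} (hF : Continuous F) (s y : ℝ) :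
    coneInt F s y = 1 / 2 * ((∫ σ in (0 : ℝ)..s, fibreInt F (-1) σ (y + 1 * s))
      - ∫ σ in (0 : ℝ)..s, fibreInt F 1 σ (y + -1 * s)) := by
  have hc : ∀ ε x, Continuous fun σ => fibreInt F ε σ x := fun ε x =>
    (continuous_fibreInt hF ε).comp (by fun_prop : Continuous fun σ : ℝ => (σ, x))
  rw [← intervalIntegral.integral_sub ((hc _ _).intervalIntegrable _ _)
    ((hc _ _).intervalIntegrable _ _), coneInt]
  congr 1
  refine intervalIntegral.integral_congr fun σ _ => ?_
  have hcη : Continuous fun η => F (σ, η) := by fun_prop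
  simp only [fibreInt]
  rw [intervalIntegral.integral_interval_sub_left (hcη.intervalIntegrable _ _)
    (hcη.intervalIntegrable _ _)]
  congr 1 <;> ring

theorem hasDerivAt_coneInt_left {F : ℝ × ℝ → ℝ} (hF : Continuous F) (s y : ℝ) :
    HasDerivAt (fun s => coneInt F s y) (coneS F s y) s := by
  have h := fun ε δ : ℝ => hasDerivAt_parametric_integral_diag (hasDerivAt_fibreInt hF ε)
    (continuous_fibreInt hF ε) (by fun_prop : Continuous fun p : ℝ × ℝ => F (p.1, p.2 + ε * p.1)) δ s y
  have h2 := ((h (-1) 1).sub (h 1 (-1))).const_mul (1 / 2)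
  have e : (fun s => coneInt F s y) = _ := funext fun s => coneInt_eq hF s y
  rw [e]
  refine h2.congr_deriv ?_
  have c : ∀ f : ℝ → ℝ, Continuous f → Continuous fun σ => F (σ, f σ) := fun f hf => by fun_prop
  rw [coneS, intervalIntegral.integral_add ((c _ (by fun_prop)).intervalIntegrable _ _)
    ((c _ (by fun_prop)).intervalIntegrable _ _)]
  have e1 : fibreInt F (-1) s (y + 1 * s) = fibreInt F 1 s (y + -1 * s) := by
    simp only [fibreInt]; congr 1; ring
  have e2 : ∀ σ, y + 1 * s + -1 * σ = y + (s - σ) := fun σ => by ring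
  have e3 : ∀ σ, y + -1 * s + 1 * σ = y - (s - σ) := fun σ => by ring
  simp only [e1, e2, e3]
  ring

theorem hasDerivAt_coneInt_right {F : ℝ × ℝ → ℝ} (hF : Continuous F) (s y : ℝ) :
    HasDerivAt (fun y => coneInt F s y) (coneY F s y) y := by
  have h := fun ε : ℝ => hasDerivAt_parametric_integral (hasDerivAt_fibreInt hF ε)
    (continuous_fibreInt hF ε) (by fun_prop : Continuous fun p : ℝ × ℝ => F (p.1, p.2 + ε * p.1)) s
  have h2 := (((h (-1) (y + 1 * s)).comp_add_const y (1 * s)).sub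
    ((h 1 (y + -1 * s)).comp_add_const y (-1 * s))).const_mul (1 / 2)
  have e : (fun y => coneInt F s y) = _ := funext fun y => coneInt_eq hF s y
  rw [e]
  refine h2.congr_deriv ?_
  have c : ∀ f : ℝ → ℝ, Continuous f → Continuous fun σ => F (σ, f σ) := fun f hf => by fun_prop
  rw [coneY, intervalIntegral.integral_sub ((c _ (by fun_prop)).intervalIntegrable _ _)
    ((c _ (by fun_prop)).intervalIntegrable _ _)]
  have e2 : ∀ σ, y + 1 * s + -1 * σ = y + (s - σ) := fun σ => by ring
  have e3 : ∀ σ, y + -1 * s + 1 * σ = y - (s - σ) := fun σ => by ring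
  simp only [e2, e3]

theorem continuous_coneS {F : ℝ × ℝ → ℝ} (hF : Continuous F) :
    Continuous fun p : ℝ × ℝ => coneS F p.1 p.2 :=
  continuous_const.mul <| intervalIntegral.continuous_parametric_intervalIntegral_of_continuous
    (f := fun (p : ℝ × ℝ) σ => F (σ, p.2 + (p.1 - σ)) + F (σ, p.2 - (p.1 - σ)))
    (by fun_prop) (by fun_prop)

theorem continuous_coneY {F : ℝ × ℝ → ℝ} (hF : Continuous F) :
    Continuous fun p : ℝ × ℝ => coneY F p.1 p.2 :=
  continuous_const.mul <| intervalIntegral.continuous_parametric_intervalIntegral_of_continuous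
    (f := fun (p : ℝ × ℝ) σ => F (σ, p.2 + (p.1 - σ)) - F (σ, p.2 - (p.1 - σ)))
    (by fun_prop) (by fun_prop)

theorem contDiff_coneInt {F : ℝ × ℝ → ℝ} (hF : Continuous F) :
    ContDiff ℝ 1 fun p : ℝ × ℝ => coneInt F p.1 p.2 :=
  contDiff_one_of_partials (hasDerivAt_coneInt_left hF) (hasDerivAt_coneInt_right hF)
    (continuous_coneS hF) (continuous_coneY hF)

/-! ### Waves with one reflecting end -/

/-- The primitive of `f` that vanishes at `0`. -/
def prim (f : ℝ → ℝ) (t : ℝ) : ℝ := ∫ x in (0 : ℝ)..t, f x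

/-- The wave on `[0, L]`, initially at rest, with source `F`, emitted at `y = 0` with profile
`prim f`; at `y = L` it is reflected evenly, up to the correction with profile `prim k`. -/
def wave (L : ℝ) (f k : ℝ → ℝ) (F : ℝ × ℝ → ℝ) (s y : ℝ) : ℝ :=
  prim f (s - y) + prim f (s + y - 2 * L) + prim k (s + y - L) + coneInt F s y

/-- The time derivative of `wave` where it exists. -/
def waveS (L : ℝ) (f k : ℝ → ℝ) (F : ℝ × ℝ → ℝ) (s y : ℝ) : ℝ :=
  f (s - y) + f (s + y - 2 * L) + k (s + y - L) + coneS F s y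

/-- The space derivative of `wave` where it exists. -/
def waveY (L : ℝ) (f k : ℝ → ℝ) (F : ℝ × ℝ → ℝ) (s y : ℝ) : ℝ :=
  -f (s - y) + f (s + y - 2 * L) + k (s + y - L) + coneY F s y

/-- Regularity and causality of the data of a wave. The conditions on the supports say that the
wave has not yet arrived at `y` at time `s ≤ y`. -/
structure Admissible (L : ℝ) (f k : ℝ → ℝ) (F : ℝ × ℝ → ℝ) : Prop where
  meas : Measurable f
  disc : {t | ¬ ContinuousAt f t}.Countable
  cont_k : Continuous k
  cont_F : Continuous F
  f_zero : ∀ t ≤ 0, f t = 0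
  k_zero : ∀ t ≤ L, k t = 0
  F_zero : ∀ s y, s ≤ 0 ∨ (s ≤ y ∧ s ≤ L) → F (s, y) = 0

/-- The data of a wave grow at most like `M exp (K s)`. -/
structure ExpBound (K M : ℝ) (f k : ℝ → ℝ) (F : ℝ × ℝ → ℝ) : Prop where
  bd_f : ∀ t, |f t| ≤ M * Real.exp (K * t)
  bd_k : ∀ t, |k t| ≤ M * Real.exp (K * t)
  bd_F : ∀ s y, |F (s, y)| ≤ M * Real.exp (K * s)

theorem integral_exp_const_mul {K : ℝ} (hK : K ≠ 0) (a b : ℝ) :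
    ∫ x in a..b, Real.exp (K * x) = (Real.exp (K * b) - Real.exp (K * a)) / K := by
  rw [intervalIntegral.integral_comp_mul_left (fun x => Real.exp x) hK, integral_exp, smul_eq_mul]
  field_simp

theorem abs_integral_le_exp {K M s : ℝ} {g : ℝ → ℝ} (hK : 0 < K) (hM : 0 ≤ M) (hs : 0 ≤ s)
    (hg : ∀ σ ∈ Ioc 0 s, |g σ| ≤ M * Real.exp (K * σ)) :
    |∫ σ in (0 : ℝ)..s, g σ| ≤ M / K * Real.exp (K * s) := by
  have h := intervalIntegral.norm_integral_le_of_norm_le (f := g) (μ := volume)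
    (g := fun σ => M * Real.exp (K * σ)) hs (Eventually.of_forall hg)
    (Continuous.intervalIntegrable (by fun_prop) _ _)
  rw [intervalIntegral.integral_const_mul, integral_exp_const_mul hK.ne'] at h
  refine h.trans ?_
  have : 0 ≤ M / K * Real.exp (K * 0) := by positivity
  have e : M * ((Real.exp (K * s) - Real.exp (K * 0)) / K)
    = M / K * Real.exp (K * s) - M / K * Real.exp (K * 0) := by ring
  linarith

theorem integral_eq_zero_of_nonpos {s : ℝ} {g : ℝ → ℝ} (hs : s ≤ 0) (hg : ∀ σ ≤ 0, g σ = 0) :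
    ∫ σ in (0 : ℝ)..s, g σ = 0 :=
  intervalIntegral.integral_zero_ae <| Eventually.of_forall fun σ hσ => by
    rw [uIoc_of_ge hs] at hσ; exact hg σ hσ.2

theorem intervalIntegrable_of_expBound {K M : ℝ} {f : ℝ → ℝ} (hf : Measurable f)
    (hb : ∀ t, |f t| ≤ M * Real.exp (K * t)) (a b : ℝ) : IntervalIntegrable f volume a b := by
  have : IntervalIntegrable (fun t => M * Real.exp (K * t)) volume a b :=
    Continuous.intervalIntegrable (by fun_prop) _ _
  exact this.mono_fun' hf.aestronglyMeasurable (Eventually.of_forall hb)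

section

variable {L K M s y : ℝ} {f k f' k' : ℝ → ℝ} {F F' : ℝ × ℝ → ℝ}

theorem ExpBound.nonneg (h : ExpBound K M f k F) : 0 ≤ M := by
  have := (abs_nonneg _).trans (h.bd_f 0)
  simpa using this

theorem abs_prim_le (hK : 0 < K) (hM : 0 ≤ M) (hz : ∀ t ≤ 0, f t = 0)
    (hb : ∀ t, |f t| ≤ M * Real.exp (K * t)) (t : ℝ) : |prim f t| ≤ M / K * Real.exp (K * t) := by
  rcases le_total 0 t with ht | ht
  · exact abs_integral_le_exp hK hM ht fun σ _ => hb σ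
  · rw [prim, integral_eq_zero_of_nonpos ht hz, abs_zero]; positivity

theorem abs_coneS_le (hK : 0 < K) (hF : ∀ s y, s ≤ 0 → F (s, y) = 0)
    (hb : ∀ s y, |F (s, y)| ≤ M * Real.exp (K * s)) (s y : ℝ) :
    |coneS F s y| ≤ M / K * Real.exp (K * s) := by
  have hM : 0 ≤ M := by simpa using (abs_nonneg _).trans (hb 0 0)
  rcases le_total 0 s with hs | hs
  · rw [coneS, ← intervalIntegral.integral_const_mul]
    refine abs_integral_le_exp hK hM hs fun σ _ => ?_
    have h1 := abs_add_le (F (σ, y + (s - σ))) (F (σ, y - (s - σ)))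
    rw [abs_mul, abs_of_pos (by norm_num : (0 : ℝ) < 1 / 2)]
    linarith [hb σ (y + (s - σ)), hb σ (y - (s - σ))]
  · rw [coneS, integral_eq_zero_of_nonpos hs fun σ h => by rw [hF _ _ h, hF _ _ h, add_zero]]
    simp only [mul_zero, abs_zero]; positivity

theorem abs_coneY_le (hK : 0 < K) (hF : ∀ s y, s ≤ 0 → F (s, y) = 0)
    (hb : ∀ s y, |F (s, y)| ≤ M * Real.exp (K * s)) (s y : ℝ) :
    |coneY F s y| ≤ M / K * Real.exp (K * s) := by
  have hM : 0 ≤ M := by simpa using (abs_nonneg _).trans (hb 0 0)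
  rcases le_total 0 s with hs | hs
  · rw [coneY, ← intervalIntegral.integral_const_mul]
    refine abs_integral_le_exp hK hM hs fun σ _ => ?_
    have h1 := abs_sub (F (σ, y + (s - σ))) (F (σ, y - (s - σ)))
    rw [abs_mul, abs_of_pos (by norm_num : (0 : ℝ) < 1 / 2)]
    linarith [hb σ (y + (s - σ)), hb σ (y - (s - σ))]
  · rw [coneY, integral_eq_zero_of_nonpos hs fun σ h => by rw [hF _ _ h, hF _ _ h, sub_zero]]
    simp only [mul_zero, abs_zero]; positivity

/-- The width of the triangle is absorbed by `s - σ ≤ exp (s - σ)`, which replaces `K` by `K - 1`. -/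
theorem abs_coneInt_le (hK : 2 ≤ K) (hF : ∀ s y, s ≤ 0 → F (s, y) = 0)
    (hb : ∀ s y, |F (s, y)| ≤ M * Real.exp (K * s)) (s y : ℝ) :
    |coneInt F s y| ≤ 2 * M / K * Real.exp (K * s) := by
  have hM : 0 ≤ M := by simpa using (abs_nonneg _).trans (hb 0 0)
  rcases le_total 0 s with hs | hs
  · rw [coneInt, ← intervalIntegral.integral_const_mul]
    have h := abs_integral_le_exp (K := K - 1) (M := M * Real.exp s) (s := s)
      (g := fun σ => 1 / 2 * ∫ η in (y - (s - σ))..(y + (s - σ)), F (σ, η))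
      (by linarith) (by positivity) hs fun σ hσ => ?_
    · refine h.trans ?_
      have e : M * Real.exp s / (K - 1) * Real.exp ((K - 1) * s) = M / (K - 1) * Real.exp (K * s) := by
        rw [mul_div_right_comm, mul_assoc, ← Real.exp_add]; congr 2; ring
      rw [e]
      gcongr ?_ * _
      rw [div_le_div_iff₀ (by linarith) (by linarith)]
      nlinarith
    · have h1 := intervalIntegral.norm_integral_le_of_norm_le_const (a := y - (s - σ))
        (b := y + (s - σ)) (f := fun η => F (σ, η)) (C := M * Real.exp (K * σ)) fun η _ => hb σ η
      rw [Real.norm_eq_abs] at h1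
      have h0 : 0 ≤ s - σ := by linarith [hσ.2]
      rw [show y + (s - σ) - (y - (s - σ)) = 2 * (s - σ) by ring,
        abs_of_nonneg (a := 2 * (s - σ)) (by linarith)] at h1
      rw [abs_mul, abs_of_pos (by norm_num : (0 : ℝ) < 1 / 2)]
      have h2 : s - σ ≤ Real.exp (s - σ) := by linarith [Real.add_one_le_exp (s - σ)]
      have e : M * Real.exp s * Real.exp ((K - 1) * σ) = M * Real.exp (K * σ) * Real.exp (s - σ) := by
        rw [mul_assoc, mul_assoc, ← Real.exp_add, ← Real.exp_add]; congr 2; ring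
      rw [e]
      have : M * Real.exp (K * σ) * (s - σ) ≤ M * Real.exp (K * σ) * Real.exp (s - σ) := by gcongr
      linarith
  · rw [coneInt, integral_eq_zero_of_nonpos hs fun σ h =>
      intervalIntegral.integral_zero_ae (Eventually.of_forall fun η _ => hF _ _ h)]
    have : 0 < K := by linarith
    simp only [mul_zero, abs_zero]; positivity

theorem Admissible.F_zero' (h : Admissible L f k F) : ∀ s y, s ≤ 0 → F (s, y) = 0 :=
  fun s y hs => h.F_zero s y (Or.inl hs)

theorem Admissible.coneInt_zero (h : Admissible L f k F) (hsy : s ≤ y) (hsL : s ≤ L) :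
    coneInt F s y = 0 := by
  rw [coneInt]
  refine mul_eq_zero_of_right _ <| intervalIntegral.integral_zero_ae <|
    Eventually.of_forall fun σ hσ =>
      intervalIntegral.integral_zero_ae <| Eventually.of_forall fun η hη => ?_
  rcases le_total s 0 with hs | hs
  · rw [uIoc_of_ge hs] at hσ
    exact h.F_zero _ _ (Or.inl hσ.2)
  · rw [uIoc_of_le hs] at hσ
    rw [uIoc_of_le (by linarith [hσ.2])] at hη
    exact h.F_zero _ _ (Or.inr ⟨by linarith [hη.1], hσ.2.trans hsL⟩)

theorem Admissible.F_cone_zero (h : Admissible L f k F) (hsy : s ≤ y) (hsL : s ≤ L) {σ : ℝ}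
    (hσ : σ ∈ uIoc 0 s) : F (σ, y + (s - σ)) = 0 ∧ F (σ, y - (s - σ)) = 0 := by
  rcases le_total s 0 with hs | hs
  · rw [uIoc_of_ge hs] at hσ
    exact ⟨h.F_zero _ _ (Or.inl hσ.2), h.F_zero _ _ (Or.inl hσ.2)⟩
  · rw [uIoc_of_le hs] at hσ
    exact ⟨h.F_zero _ _ (Or.inr ⟨by linarith [hσ.2], hσ.2.trans hsL⟩),
      h.F_zero _ _ (Or.inr ⟨by linarith, hσ.2.trans hsL⟩)⟩

theorem Admissible.coneS_zero (h : Admissible L f k F) (hsy : s ≤ y) (hsL : s ≤ L) :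
    coneS F s y = 0 := by
  rw [coneS]
  refine mul_eq_zero_of_right _ <| intervalIntegral.integral_zero_ae <|
    Eventually.of_forall fun σ hσ => ?_
  rw [(h.F_cone_zero hsy hsL hσ).1, (h.F_cone_zero hsy hsL hσ).2, add_zero]

theorem Admissible.coneY_zero (h : Admissible L f k F) (hsy : s ≤ y) (hsL : s ≤ L) :
    coneY F s y = 0 := by
  rw [coneY]
  refine mul_eq_zero_of_right _ <| intervalIntegral.integral_zero_ae <|
    Eventually.of_forall fun σ hσ => ?_
  rw [(h.F_cone_zero hsy hsL hσ).1, (h.F_cone_zero hsy hsL hσ).2, sub_zero]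

theorem prim_zero {a t : ℝ} (ha : 0 ≤ a) (hf : ∀ t ≤ a, f t = 0) (ht : t ≤ a) : prim f t = 0 :=
  intervalIntegral.integral_zero_ae <| Eventually.of_forall fun x hx =>
    hf x (hx.2.trans (max_le ha ht))

/-- Finite propagation speed. -/
theorem Admissible.wave_zero (h : Admissible L f k F) (hy : y ∈ Icc 0 L) (hs : s ≤ y) :
    wave L f k F s y = 0 := by
  have hL : 0 ≤ L := hy.1.trans hy.2
  rw [wave, prim_zero le_rfl h.f_zero (by linarith), prim_zero le_rfl h.f_zero (by linarith [hy.2]),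
    prim_zero hL h.k_zero (by linarith [hy.2]), h.coneInt_zero hs (hs.trans hy.2)]
  norm_num

theorem Admissible.waveS_zero (h : Admissible L f k F) (hy : y ∈ Icc 0 L) (hs : s ≤ y) :
    waveS L f k F s y = 0 := by
  rw [waveS, h.f_zero _ (by linarith), h.f_zero _ (by linarith [hy.2]),
    h.k_zero _ (by linarith [hy.2]), h.coneS_zero hs (hs.trans hy.2)]
  norm_num

theorem abs_wave_le (hK : 2 ≤ K) (h : Admissible L f k F) (hb : ExpBound K M f k F)
    (hy : y ∈ Icc 0 L) : |wave L f k F s y| ≤ 5 * M / K * Real.exp (K * s) := by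
  have hM := hb.nonneg
  have hL : 0 ≤ L := hy.1.trans hy.2
  have hK0 : 0 < K := by linarith
  have mono : ∀ t, t ≤ s → M / K * Real.exp (K * t) ≤ M / K * Real.exp (K * s) := fun t ht => by
    gcongr
  have h1 := (abs_prim_le hK0 hM h.f_zero hb.bd_f (s - y)).trans (mono _ (by linarith [hy.1]))
  have h2 := (abs_prim_le hK0 hM h.f_zero hb.bd_f (s + y - 2 * L)).trans (mono _ (by linarith [hy.2]))
  have h3 := (abs_prim_le hK0 hM (fun t ht => h.k_zero t (ht.trans hL)) hb.bd_k (s + y - L)).trans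
    (mono _ (by linarith [hy.2]))
  have h4 := abs_coneInt_le hK h.F_zero' hb.bd_F s y
  have e : 5 * M / K * Real.exp (K * s) = M / K * Real.exp (K * s) + M / K * Real.exp (K * s) +
    M / K * Real.exp (K * s) + 2 * M / K * Real.exp (K * s) := by ring
  rw [e, wave]
  refine (abs_add_le _ _).trans (add_le_add ((abs_add_le _ _).trans (add_le_add
    ((abs_add_le _ _).trans (add_le_add h1 h2)) h3)) h4)

/-- The decaying exponentials are kept: the profiles are only bounded by `M exp (K t)`, but the
integral over `y` of this bound gains a factor `1 / K`. -/
theorem abs_waveS_le (hK : 0 < K) (h : Admissible L f k F) (hb : ExpBound K M f k F)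
    (hy : y ∈ Icc 0 L) : |waveS L f k F s y| ≤ M * Real.exp (K * s) *
      (Real.exp (-K * y) + 2 * Real.exp (K * (y - L)) + 1 / K) := by
  have hM := hb.nonneg
  have hL : 0 ≤ L := hy.1.trans hy.2
  have h1 := hb.bd_f (s - y)
  have h2 : |f (s + y - 2 * L)| ≤ M * Real.exp (K * (s + (y - L))) :=
    (hb.bd_f (s + y - 2 * L)).trans (by gcongr; linarith)
  have h3 := hb.bd_k (s + y - L)
  have h4 := abs_coneS_le hK h.F_zero' hb.bd_F s y
  rw [show K * (s - y) = K * s + -K * y by ring, Real.exp_add] at h1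
  rw [mul_add, Real.exp_add] at h2
  rw [show K * (s + y - L) = K * s + K * (y - L) by ring, Real.exp_add] at h3
  have e : M * Real.exp (K * s) * (Real.exp (-K * y) + 2 * Real.exp (K * (y - L)) + 1 / K) =
    M * (Real.exp (K * s) * Real.exp (-K * y)) + M * (Real.exp (K * s) * Real.exp (K * (y - L))) +
    M * (Real.exp (K * s) * Real.exp (K * (y - L))) + M / K * Real.exp (K * s) := by ring
  rw [e, waveS]
  refine (abs_add_le _ _).trans (add_le_add ((abs_add_le _ _).trans (add_le_add
    ((abs_add_le _ _).trans (add_le_add h1 h2)) h3)) h4)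

theorem continuous_prim (hf : Measurable f) (hb : ∀ t, |f t| ≤ M * Real.exp (K * t)) :
    Continuous (prim f) :=
  intervalIntegral.continuous_primitive (fun a b => intervalIntegrable_of_expBound hf hb a b) 0

theorem continuous_wave (h : Admissible L f k F) (hb : ExpBound K M f k F) :
    Continuous fun p : ℝ × ℝ => wave L f k F p.1 p.2 := by
  have h1 := continuous_prim h.meas hb.bd_f
  have h2 := continuous_prim h.cont_k.measurable hb.bd_k
  have h3 := (contDiff_coneInt h.cont_F).continuous
  unfold wave
  fun_prop

theorem measurable_waveS (h : Admissible L f k F) :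
    Measurable fun p : ℝ × ℝ => waveS L f k F p.1 p.2 := by
  have h1 := h.meas
  have h2 := h.cont_k.measurable
  have h3 := (continuous_coneS h.cont_F).measurable
  unfold waveS
  fun_prop

/-- The bound of `abs_waveS_le`, made uniform in `y`. -/
theorem abs_waveS_le' (hK : 2 ≤ K) (h : Admissible L f k F) (hb : ExpBound K M f k F)
    (hy : y ∈ Icc 0 L) : |waveS L f k F s y| ≤ 4 * M * Real.exp (K * s) := by
  have hM := hb.nonneg
  refine (abs_waveS_le (by linarith) h hb hy).trans ?_
  have h1 : Real.exp (-K * y) ≤ 1 := Real.exp_le_one_iff.2 (by nlinarith [hy.1])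
  have h2 : Real.exp (K * (y - L)) ≤ 1 := Real.exp_le_one_iff.2 (by nlinarith [hy.2])
  have h3 : 1 / K ≤ 1 := by rw [div_le_one (by linarith)]; linarith
  calc _ ≤ M * Real.exp (K * s) * 4 := by gcongr; linarith
    _ = _ := by ring

/-- At a fixed time the discontinuities of the profile are met at countably many points `y` only, so
integrals over `y` are continuous in time. -/
theorem ae_continuousAt_waveS (h : Admissible L f k F) (s : ℝ) :
    ∀ᵐ y, ContinuousAt (fun s => waveS L f k F s y) s := by
  have hc : ({y | ¬ ContinuousAt f (s - y)} ∪ {y | ¬ ContinuousAt f (s + y - 2 * L)}).Countable := by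
    refine Countable.union ?_ ?_
    · exact h.disc.preimage_of_injOn (f := fun y => s - y) (fun a _ b _ hab => by
        simpa using hab)
    · exact h.disc.preimage_of_injOn (f := fun y => s + y - 2 * L) (fun a _ b _ hab => by
        simpa using hab)
  filter_upwards [hc.ae_notMem volume] with y hy
  simp only [mem_union, mem_ofPred_eq, not_or, not_not] at hy
  have h1 : ContinuousAt (fun s => f (s - y)) s :=
    ContinuousAt.comp (f := fun s => s - y) hy.1 (by fun_prop)
  have h2 : ContinuousAt (fun s => f (s + y - 2 * L)) s :=
    ContinuousAt.comp (f := fun s => s + y - 2 * L) hy.2 (by fun_prop)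
  have h3 := h.cont_k
  have h4 : Continuous fun s => coneS F s y :=
    (continuous_coneS h.cont_F).comp (by fun_prop : Continuous fun s : ℝ => (s, y))
  unfold waveS
  exact ((h1.add h2).add (by fun_prop)).add h4.continuousAt

theorem continuous_integral_waveS (hL : 0 ≤ L) (hK : 2 ≤ K) (h : Admissible L f k F)
    (hb : ExpBound K M f k F) {β : ℝ → ℝ} (hβ : Measurable β) {B : ℝ} (hB : ∀ y, |β y| ≤ B) :
    Continuous fun s => ∫ y in (0 : ℝ)..L, waveS L f k F s y * β y := by
  have hM := hb.nonneg
  refine continuous_iff_continuousAt.2 fun s => ?_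
  refine intervalIntegral.continuousAt_of_dominated_interval
    (bound := fun _ => 4 * M * Real.exp (K * (s + 1)) * B) ?_ ?_ intervalIntegrable_const ?_
  · refine Eventually.of_forall fun s => Measurable.aestronglyMeasurable ?_
    exact ((measurable_waveS h).comp (by fun_prop : Measurable fun y : ℝ => (s, y))).mul hβ
  · filter_upwards [Iic_mem_nhds (lt_add_one s)] with t ht
    refine Eventually.of_forall fun y hy => ?_
    rw [uIoc_of_le hL] at hy
    rw [norm_mul]
    refine mul_le_mul ((abs_waveS_le' hK h hb ⟨hy.1.le, hy.2⟩).trans ?_) (hB y) (norm_nonneg _)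
      (by positivity)
    gcongr
    exact ht
  · filter_upwards [ae_continuousAt_waveS h s] with y hy _
    exact hy.mul continuousAt_const

theorem continuous_integral_wave (h : Admissible L f k F) (hL : 0 ≤ L) (hK : 2 ≤ K)
    (hb : ExpBound K M f k F) {β : ℝ → ℝ} (hβ : Measurable β) {B : ℝ} (hB : ∀ y, |β y| ≤ B) :
    Continuous fun s => ∫ y in (0 : ℝ)..L, wave L f k F s y * β y := by
  have hM := hb.nonneg
  have hB0 : 0 ≤ B := (abs_nonneg _).trans (hB 0)
  have hc := continuous_wave h hb
  have hcy : ∀ s, Continuous fun y => wave L f k F s y := fun s =>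
    hc.comp (by fun_prop : Continuous fun y : ℝ => (s, y))
  have hcs : ∀ y, Continuous fun s => wave L f k F s y := fun y =>
    hc.comp (by fun_prop : Continuous fun s : ℝ => (s, y))
  refine continuous_iff_continuousAt.2 fun s => ?_
  refine intervalIntegral.continuousAt_of_dominated_interval
    (bound := fun _ => 5 * M / K * Real.exp (K * (s + 1)) * B) ?_ ?_ intervalIntegrable_const ?_
  · exact Eventually.of_forall fun s => ((hcy s).measurable.mul hβ).aestronglyMeasurable
  · filter_upwards [Iic_mem_nhds (lt_add_one s)] with t ht
    refine Eventually.of_forall fun y hy => ?_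
    rw [uIoc_of_le hL] at hy
    rw [norm_mul]
    have hK0 : 0 < K := by linarith
    refine mul_le_mul ((abs_wave_le hK h hb ⟨hy.1.le, hy.2⟩).trans ?_) (hB y) (norm_nonneg _)
      (by positivity)
    gcongr
    exact ht
  · exact Eventually.of_forall fun y _ => (hcs y).continuousAt.mul continuousAt_const

/-! ### Linearity in the data of a wave -/

theorem coneS_sub (hF : Continuous F) (hF' : Continuous F') (s y : ℝ) :
    coneS (F - F') s y = coneS F s y - coneS F' s y := by
  rw [coneS, coneS, coneS, ← mul_sub, ← intervalIntegral.integral_sub]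
  · congr 2; ext σ; simp only [Pi.sub_apply]; ring
  all_goals exact Continuous.intervalIntegrable (by fun_prop) _ _

theorem coneY_sub (hF : Continuous F) (hF' : Continuous F') (s y : ℝ) :
    coneY (F - F') s y = coneY F s y - coneY F' s y := by
  rw [coneY, coneY, coneY, ← mul_sub, ← intervalIntegral.integral_sub]
  · congr 2; ext σ; simp only [Pi.sub_apply]; ring
  all_goals exact Continuous.intervalIntegrable (by fun_prop) _ _

theorem coneInt_sub (hF : Continuous F) (hF' : Continuous F') (s y : ℝ) :
    coneInt (F - F') s y = coneInt F s y - coneInt F' s y := by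
  have e : ∀ ε σ x, fibreInt (F - F') ε σ x = fibreInt F ε σ x - fibreInt F' ε σ x := by
    intro ε σ x
    rw [fibreInt, fibreInt, fibreInt, ← intervalIntegral.integral_sub]
    · rfl
    all_goals exact Continuous.intervalIntegrable (by fun_prop) _ _
  have c : ∀ G : ℝ × ℝ → ℝ, Continuous G → ∀ ε x,
      IntervalIntegrable (fun σ => fibreInt G ε σ x) volume 0 s := fun G hG ε x =>
    Continuous.intervalIntegrable ((continuous_fibreInt hG ε).comp
      (by fun_prop : Continuous fun σ : ℝ => (σ, x))) _ _
  rw [coneInt_eq hF, coneInt_eq hF', coneInt_eq (hF.sub hF')]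
  simp only [e]
  rw [intervalIntegral.integral_sub (c F hF _ _) (c F' hF' _ _),
    intervalIntegral.integral_sub (c F hF _ _) (c F' hF' _ _)]
  ring

theorem prim_sub (hf : ∀ a b, IntervalIntegrable f volume a b)
    (hf' : ∀ a b, IntervalIntegrable f' volume a b) (t : ℝ) :
    prim (f - f') t = prim f t - prim f' t :=
  intervalIntegral.integral_sub (hf _ _) (hf' _ _)

theorem wave_sub (h : Admissible L f k F) (hb : ExpBound K M f k F) {M' : ℝ}
    (h' : Admissible L f' k' F') (hb' : ExpBound K M' f' k' F') (s y : ℝ) :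
    wave L (f - f') (k - k') (F - F') s y = wave L f k F s y - wave L f' k' F' s y := by
  have i1 := intervalIntegrable_of_expBound h.meas hb.bd_f
  have i2 := intervalIntegrable_of_expBound h'.meas hb'.bd_f
  rw [wave, wave, wave, prim_sub i1 i2, prim_sub i1 i2,
    prim_sub (fun a b => h.cont_k.intervalIntegrable a b)
      (fun a b => h'.cont_k.intervalIntegrable a b), coneInt_sub h.cont_F h'.cont_F]
  ring

theorem waveS_sub (h : Admissible L f k F) (h' : Admissible L f' k' F') (s y : ℝ) :
    waveS L (f - f') (k - k') (F - F') s y = waveS L f k F s y - waveS L f' k' F' s y := by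
  rw [waveS, waveS, waveS, coneS_sub h.cont_F h'.cont_F]
  simp only [Pi.sub_apply]
  ring

end

/-! ### Boundary feedback and existence of waves -/

/-- A linear feedback of a wave into a boundary condition at `y = 0`: pointwise terms in the
arriving reflected wave, in the derivatives of the source part and in the value of the wave, and
distributed terms in its time derivative and its value. -/
structure Feedback where
  /-- coefficient of the arriving reflected wave -/
  p : ℝ
  /-- coefficient of the time derivative of the source part -/
  a : ℝ
  /-- coefficient of the space derivative of the source part -/
  b : ℝ
  /-- coefficient of the value -/
  c : ℝ
  /-- weight of the time derivative -/
  β : ℝ → ℝ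
  /-- weight of the value -/
  γ : ℝ → ℝ
  /-- a bound of the weights -/
  B : ℝ
  meas_β : Measurable β
  meas_γ : Measurable γ
  le_β : ∀ y, |β y| ≤ B
  le_γ : ∀ y, |γ y| ≤ B

/-- The value of the feedback at time `s`. -/
def Feedback.apply (Φ : Feedback) (L : ℝ) (f k : ℝ → ℝ) (F : ℝ × ℝ → ℝ) (s : ℝ) : ℝ :=
  Φ.p * (f (s - 2 * L) + k (s - L)) + Φ.a * coneS F s 0 + Φ.b * coneY F s 0
    + Φ.c * wave L f k F s 0 + (∫ y in (0 : ℝ)..L, waveS L f k F s y * Φ.β y)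
    + ∫ y in (0 : ℝ)..L, wave L f k F s y * Φ.γ y

/-- The part of the feedback that is continuous in time. -/
def Feedback.smoothPart (Φ : Feedback) (L : ℝ) (f k : ℝ → ℝ) (F : ℝ × ℝ → ℝ) (s : ℝ) : ℝ :=
  Φ.p * k (s - L) + Φ.a * coneS F s 0 + Φ.b * coneY F s 0
    + Φ.c * wave L f k F s 0 + (∫ y in (0 : ℝ)..L, waveS L f k F s y * Φ.β y)
    + ∫ y in (0 : ℝ)..L, wave L f k F s y * Φ.γ y

/-- A delay by `x` costs a factor `exp (-K x)` in the weighted norm, which is `O(1 / K)`. -/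
theorem exp_neg_le {K x : ℝ} (hK : 0 < K) (hx : 0 < x) : Real.exp (-(K * x)) ≤ 1 / (K * x) := by
  rw [Real.exp_neg, ← one_div]
  have : 0 < K * x := by positivity
  exact one_div_le_one_div_of_le this (by linarith [Real.add_one_le_exp (K * x)])

section

variable {L K M : ℝ} {f k f' k' : ℝ → ℝ} {F F' : ℝ × ℝ → ℝ} (Φ : Feedback)

/-- Discontinuities in time come from the once reflected profile alone. -/
theorem Feedback.apply_eq (s : ℝ) :
    Φ.apply L f k F s = Φ.p * f (s - 2 * L) + Φ.smoothPart L f k F s := by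
  simp only [Feedback.apply, Feedback.smoothPart]; ring

theorem Feedback.continuous_smoothPart (hL : 0 ≤ L) (hK : 2 ≤ K) (h : Admissible L f k F)
    (hb : ExpBound K M f k F) : Continuous (Φ.smoothPart L f k F) := by
  have h1 := continuous_integral_waveS hL hK h hb Φ.meas_β Φ.le_β
  have h2 := continuous_integral_wave h hL hK hb Φ.meas_γ Φ.le_γ
  have hs : Continuous fun s : ℝ => (s, (0 : ℝ)) := by fun_prop
  have h3 := (continuous_wave h hb).comp hs
  have h4 := (continuous_coneS h.cont_F).comp hs
  have h5 := (continuous_coneY h.cont_F).comp hs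
  have h6 : Continuous fun s => k (s - L) := h.cont_k.comp (by fun_prop)
  exact ((((((continuous_const.mul h6).add (continuous_const.mul h4)).add
    (continuous_const.mul h5)).add (continuous_const.mul h3)).add h1).add h2)

/-- Feedback is causal. -/
theorem Feedback.apply_zero (hL : 0 < L) (h : Admissible L f k F) {s : ℝ} (hs : s ≤ 0) :
    Φ.apply L f k F s = 0 := by
  rw [Feedback.apply, h.f_zero _ (by linarith), h.k_zero _ (by linarith),
    h.coneS_zero hs (by linarith), h.coneY_zero hs (by linarith), h.wave_zero ⟨le_rfl, hL.le⟩ hs]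
  have h1 : ∫ y in (0 : ℝ)..L, waveS L f k F s y * Φ.β y = 0 :=
    intervalIntegral.integral_zero_ae <| Eventually.of_forall fun y hy => by
      rw [uIoc_of_le hL.le] at hy
      rw [h.waveS_zero ⟨hy.1.le, hy.2⟩ (hs.trans hy.1.le), zero_mul]
  have h2 : ∫ y in (0 : ℝ)..L, wave L f k F s y * Φ.γ y = 0 :=
    intervalIntegral.integral_zero_ae <| Eventually.of_forall fun y hy => by
      rw [uIoc_of_le hL.le] at hy
      rw [h.wave_zero ⟨hy.1.le, hy.2⟩ (hs.trans hy.1.le), zero_mul]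
  rw [h1, h2]; ring

theorem intervalIntegrable_waveS (hL : 0 ≤ L) (hK : 2 ≤ K) (h : Admissible L f k F)
    (hb : ExpBound K M f k F) {β : ℝ → ℝ} (hβ : Measurable β) {B : ℝ} (hB : ∀ y, |β y| ≤ B)
    (s : ℝ) : IntervalIntegrable (fun y => waveS L f k F s y * β y) volume 0 L := by
  have hM := hb.nonneg
  refine (intervalIntegrable_const (c := 4 * M * Real.exp (K * s) * B)).mono_fun'
    (((measurable_waveS h).comp
      (by fun_prop : Measurable fun y : ℝ => (s, y))).mul hβ).aestronglyMeasurable ?_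
  refine (ae_restrict_iff' measurableSet_uIoc).2 (Eventually.of_forall fun y hy => ?_)
  rw [uIoc_of_le hL] at hy
  refine (norm_mul _ _).trans_le ?_
  exact mul_le_mul (abs_waveS_le' hK h hb ⟨hy.1.le, hy.2⟩) (hB y) (norm_nonneg _) (by positivity)

theorem intervalIntegrable_wave (hL : 0 ≤ L) (hK : 2 ≤ K) (h : Admissible L f k F)
    (hb : ExpBound K M f k F) {β : ℝ → ℝ} (hβ : Measurable β) {B : ℝ} (hB : ∀ y, |β y| ≤ B)
    (s : ℝ) : IntervalIntegrable (fun y => wave L f k F s y * β y) volume 0 L := by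
  have hM := hb.nonneg
  refine (intervalIntegrable_const (c := 5 * M / K * Real.exp (K * s) * B)).mono_fun'
    (((continuous_wave h hb).measurable.comp
      (by fun_prop : Measurable fun y : ℝ => (s, y))).mul hβ).aestronglyMeasurable ?_
  refine (ae_restrict_iff' measurableSet_uIoc).2 (Eventually.of_forall fun y hy => ?_)
  rw [uIoc_of_le hL] at hy
  refine (norm_mul _ _).trans_le ?_
  have : 0 < K := by linarith
  exact mul_le_mul (abs_wave_le hK h hb ⟨hy.1.le, hy.2⟩) (hB y) (norm_nonneg _) (by positivity)

theorem Feedback.apply_sub (hL : 0 ≤ L) (hK : 2 ≤ K) (h : Admissible L f k F)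
    (hb : ExpBound K M f k F) {M' : ℝ} (h' : Admissible L f' k' F') (hb' : ExpBound K M' f' k' F')
    (s : ℝ) : Φ.apply L (f - f') (k - k') (F - F') s
      = Φ.apply L f k F s - Φ.apply L f' k' F' s := by
  simp only [Feedback.apply, wave_sub h hb h' hb', waveS_sub h h', coneS_sub h.cont_F h'.cont_F,
    coneY_sub h.cont_F h'.cont_F, sub_mul, Pi.sub_apply]
  rw [intervalIntegral.integral_sub (intervalIntegrable_waveS hL hK h hb Φ.meas_β Φ.le_β s)
      (intervalIntegrable_waveS hL hK h' hb' Φ.meas_β Φ.le_β s),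
    intervalIntegral.integral_sub (intervalIntegrable_wave hL hK h hb Φ.meas_γ Φ.le_γ s)
      (intervalIntegrable_wave hL hK h' hb' Φ.meas_γ Φ.le_γ s)]
  ring

/-- The constant `C` in the bound `C M exp (K s) / K` of a feedback. -/
def Feedback.const (Φ : Feedback) (L : ℝ) : ℝ :=
  |Φ.p| * (2 / L) + |Φ.a| + |Φ.b| + |Φ.c| * 5 + Φ.B * (3 + L) + Φ.B * 5 * L

theorem Feedback.const_nonneg (hL : 0 < L) : 0 ≤ Φ.const L := by
  have hB : 0 ≤ Φ.B := (abs_nonneg _).trans (Φ.le_β 0)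
  unfold Feedback.const
  positivity

/-- The gain `1 / K` for the distributed feedback of the time derivative comes from integrating
the bound of `abs_waveS_le` over `y`. -/
theorem abs_integral_waveS_le (hL : 0 ≤ L) (hK : 0 < K) (h : Admissible L f k F)
    (hb : ExpBound K M f k F) {β : ℝ → ℝ} {B : ℝ} (hB : ∀ y, |β y| ≤ B) (s : ℝ) :
    |∫ y in (0 : ℝ)..L, waveS L f k F s y * β y| ≤ B * (3 + L) * (M / K * Real.exp (K * s)) := by
  have hM := hb.nonneg
  have hB0 : 0 ≤ B := (abs_nonneg _).trans (hB 0)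
  have h1 := intervalIntegral.norm_integral_le_of_norm_le (μ := volume)
    (f := fun y => waveS L f k F s y * β y)
    (g := fun y => M * Real.exp (K * s) * (Real.exp (-K * y) + 2 * Real.exp (K * (y - L)) + 1 / K) * B)
    hL (Eventually.of_forall fun y hy => ?_) (Continuous.intervalIntegrable (by fun_prop) _ _)
  · refine h1.trans ?_
    have i1 : ∫ y in (0 : ℝ)..L, Real.exp (-K * y) ≤ 1 / K := by
      rw [integral_exp_const_mul (neg_ne_zero.2 hK.ne'), div_neg, ← neg_div, neg_sub,
        div_le_div_iff_of_pos_right hK]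
      have := Real.exp_pos (-K * L)
      simp only [mul_zero, Real.exp_zero]; linarith
    have i2 : ∫ y in (0 : ℝ)..L, Real.exp (K * (y - L)) ≤ 1 / K := by
      rw [intervalIntegral.integral_comp_sub_right (fun y => Real.exp (K * y)),
        integral_exp_const_mul hK.ne', div_le_div_iff_of_pos_right hK]
      have := Real.exp_pos (K * (0 - L))
      simp only [sub_self, mul_zero, Real.exp_zero]; linarith
    rw [intervalIntegral.integral_mul_const, intervalIntegral.integral_const_mul,
      intervalIntegral.integral_add, intervalIntegral.integral_add,
      intervalIntegral.integral_const_mul, intervalIntegral.integral_const]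
    · calc _ ≤ M * Real.exp (K * s) * (1 / K + 2 * (1 / K) + (L - 0) • (1 / K)) * B := by gcongr
        _ = _ := by rw [smul_eq_mul]; ring
    all_goals exact Continuous.intervalIntegrable (by fun_prop) _ _
  · rw [norm_mul]
    have h2 := abs_waveS_le hK h hb (s := s) ⟨hy.1.le, hy.2⟩
    exact mul_le_mul h2 (hB y) (norm_nonneg _) ((abs_nonneg _).trans h2)

theorem abs_integral_wave_le (hL : 0 ≤ L) (hK : 2 ≤ K) (h : Admissible L f k F)
    (hb : ExpBound K M f k F) {β : ℝ → ℝ} {B : ℝ} (hB : ∀ y, |β y| ≤ B) (s : ℝ) :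
    |∫ y in (0 : ℝ)..L, wave L f k F s y * β y| ≤ B * 5 * L * (M / K * Real.exp (K * s)) := by
  have hM := hb.nonneg
  have hK0 : 0 < K := by linarith
  have h1 := intervalIntegral.norm_integral_le_of_norm_le_const (a := 0) (b := L)
    (f := fun y => wave L f k F s y * β y) (C := 5 * M / K * Real.exp (K * s) * B) fun y hy => ?_
  · refine h1.trans (le_of_eq ?_)
    rw [sub_zero, abs_of_nonneg hL]; ring
  · rw [uIoc_of_le hL] at hy
    rw [norm_mul]
    exact mul_le_mul (abs_wave_le hK h hb ⟨hy.1.le, hy.2⟩) (hB y) (norm_nonneg _) (by positivity)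

/-- The gain `1 / K` makes a feedback a contraction if `K` is large. -/
theorem Feedback.abs_apply_le (hL : 0 < L) (hK : 2 ≤ K) (h : Admissible L f k F)
    (hb : ExpBound K M f k F) (s : ℝ) :
    |Φ.apply L f k F s| ≤ Φ.const L * (M / K * Real.exp (K * s)) := by
  have hM := hb.nonneg
  have hK0 : 0 < K := by linarith
  set E := M / K * Real.exp (K * s) with hE
  have d0 : M * Real.exp (K * (s - L)) ≤ 1 / L * E := by
    have := exp_neg_le hK0 hL
    rw [mul_sub, sub_eq_add_neg, Real.exp_add]
    calc _ ≤ M * (Real.exp (K * s) * (1 / (K * L))) := by gcongr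
      _ = _ := by rw [hE]; field_simp
  have d1 : |f (s - 2 * L)| ≤ 1 / L * E :=
    ((hb.bd_f _).trans (by gcongr; linarith)).trans d0
  have d2 : |k (s - L)| ≤ 1 / L * E := (hb.bd_k _).trans d0
  have d3 : |f (s - 2 * L) + k (s - L)| ≤ 2 / L * E :=
    (abs_add_le _ _).trans (by linarith [show 2 / L * E = 1 / L * E + 1 / L * E by ring])
  have e1 := abs_coneS_le hK0 h.F_zero' hb.bd_F s 0
  have e2 := abs_coneY_le hK0 h.F_zero' hb.bd_F s 0
  have e3 := abs_wave_le hK h hb (s := s) ⟨le_refl 0, hL.le⟩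
  have e3' : |wave L f k F s 0| ≤ 5 * E := e3.trans (le_of_eq (by rw [hE]; ring))
  have e4 := abs_integral_waveS_le hL.le hK0 h hb Φ.le_β s
  have e5 := abs_integral_wave_le hL.le hK h hb Φ.le_γ s
  have t1 : |Φ.p * (f (s - 2 * L) + k (s - L))| ≤ |Φ.p| * (2 / L * E) := by
    rw [abs_mul]; gcongr
  have t2 : |Φ.a * coneS F s 0| ≤ |Φ.a| * E := by rw [abs_mul]; gcongr
  have t3 : |Φ.b * coneY F s 0| ≤ |Φ.b| * E := by rw [abs_mul]; gcongr
  have t4 : |Φ.c * wave L f k F s 0| ≤ |Φ.c| * (5 * E) := by rw [abs_mul]; gcongr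
  have e : Φ.const L * E = |Φ.p| * (2 / L * E) + |Φ.a| * E + |Φ.b| * E + |Φ.c| * (5 * E)
      + Φ.B * (3 + L) * E + Φ.B * 5 * L * E := by rw [Feedback.const]; ring
  rw [e, Feedback.apply]
  exact (abs_add_le _ _).trans (add_le_add ((abs_add_le _ _).trans (add_le_add
    ((abs_add_le _ _).trans (add_le_add ((abs_add_le _ _).trans (add_le_add
    ((abs_add_le _ _).trans (add_le_add t1 t2)) t3)) t4)) e4)) e5)

end

/-- The point of `[0, L]` closest to `y`. -/
def clamp (L y : ℝ) : ℝ := max 0 (min y L)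

theorem clamp_mem {L : ℝ} (hL : 0 ≤ L) (y : ℝ) : clamp L y ∈ Icc 0 L :=
  ⟨le_max_left _ _, max_le hL (min_le_right _ _)⟩

theorem clamp_of_mem {L y : ℝ} (hy : y ∈ Icc 0 L) : clamp L y = y := by
  rw [clamp, min_eq_left hy.2, max_eq_right hy.1]

theorem continuous_clamp (L : ℝ) : Continuous (clamp L) := by unfold clamp; fun_prop

theorem le_clamp {L s y : ℝ} (h : s ≤ 0 ∨ (s ≤ y ∧ s ≤ L)) : s ≤ clamp L y := by
  rcases h with h | h
  · exact h.trans (le_max_left _ _)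
  · exact (le_min h.1 h.2).trans (le_max_right _ _)

/-- Weighted uniform limits of functions continuous at a point are continuous there. -/
theorem continuousAt_of_weighted_approx {β : Type*} [TopologicalSpace β] {X : ℕ → β → ℝ}
    {x W : β → ℝ} {ε : ℕ → ℝ} {a : β} (hW : ContinuousAt W a) (hX : ∀ n, ContinuousAt (X n) a)
    (hε : Tendsto ε atTop (𝓝 0)) (h : ∀ n b, |X n b - x b| ≤ ε n * W b) : ContinuousAt x a := by
  refine continuousAt_of_locally_uniform_approx_of_continuousAt fun u hu => ?_
  obtain ⟨δ, hδ, hu⟩ := Metric.mem_uniformity_dist.1 hu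
  have h1 : Tendsto (fun n => |ε n| * (|W a| + 1)) atTop (𝓝 0) := by
    simpa using hε.abs.mul_const (|W a| + 1)
  obtain ⟨n, hn⟩ := (h1.eventually (gt_mem_nhds hδ)).exists
  have hWa : ∀ᶠ b in 𝓝 a, |W b| < |W a| + 1 :=
    hW.abs.eventually (gt_mem_nhds (lt_add_one _))
  refine ⟨_, hWa, X n, hX n, fun b hb => hu ?_⟩
  rw [dist_comm, Real.dist_eq]
  calc _ ≤ ε n * W b := h n b
    _ ≤ |ε n| * |W b| := by rw [← abs_mul]; exact le_abs_self _
    _ ≤ |ε n| * (|W a| + 1) := by gcongr; exact (show |W b| < |W a| + 1 from hb).le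
    _ < δ := hn

theorem Admissible.sub {L : ℝ} {f k f' k' : ℝ → ℝ} {F F' : ℝ × ℝ → ℝ} (h : Admissible L f k F)
    (h' : Admissible L f' k' F') : Admissible L (f - f') (k - k') (F - F') where
  meas := h.meas.sub h'.meas
  disc := (h.disc.union h'.disc).mono fun t ht => by
    by_contra hc
    simp only [mem_union, mem_ofPred_eq, not_or, not_not] at hc
    exact ht (hc.1.sub hc.2)
  cont_k := h.cont_k.sub h'.cont_k
  cont_F := h.cont_F.sub h'.cont_F
  f_zero t ht := by simp [h.f_zero t ht, h'.f_zero t ht]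
  k_zero t ht := by simp [h.k_zero t ht, h'.k_zero t ht]
  F_zero s y hs := by simp [h.F_zero s y hs, h'.F_zero s y hs]

theorem Admissible.add {L : ℝ} {f k f' k' : ℝ → ℝ} {F F' : ℝ × ℝ → ℝ} (h : Admissible L f k F)
    (h' : Admissible L f' k' F') : Admissible L (f + f') (k + k') (F + F') where
  meas := h.meas.add h'.meas
  disc := (h.disc.union h'.disc).mono fun t ht => by
    by_contra hc
    simp only [mem_union, mem_ofPred_eq, not_or, not_not] at hc
    exact ht (hc.1.add hc.2)
  cont_k := h.cont_k.add h'.cont_k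
  cont_F := h.cont_F.add h'.cont_F
  f_zero t ht := by simp [h.f_zero t ht, h'.f_zero t ht]
  k_zero t ht := by simp [h.k_zero t ht, h'.k_zero t ht]
  F_zero s y hs := by simp [h.F_zero s y hs, h'.F_zero s y hs]

/-- Admissible data are closed under weighted uniform limits; for the profile `f` the
discontinuities of the limit lie in the countable union of those of the approximants. -/
theorem Admissible.lim {L K : ℝ} {f k : ℕ → ℝ → ℝ} {F : ℕ → ℝ × ℝ → ℝ} {f' k' : ℝ → ℝ}
    {F' : ℝ × ℝ → ℝ} {ε : ℕ → ℝ} (h : ∀ n, Admissible L (f n) (k n) (F n))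
    (hε : Tendsto ε atTop (𝓝 0)) (hf : ∀ n t, |f n t - f' t| ≤ ε n * Real.exp (K * t))
    (hk : ∀ n t, |k n t - k' t| ≤ ε n * Real.exp (K * t))
    (hF : ∀ n p, |F n p - F' p| ≤ ε n * Real.exp (K * p.1)) : Admissible L f' k' F' := by
  have key : ∀ {β : Type} (X : ℕ → β → ℝ) (x W : β → ℝ), (∀ n b, |X n b - x b| ≤ ε n * W b) →
      ∀ b, Tendsto (fun n => X n b) atTop (𝓝 (x b)) := by
    intro β X x W hX b
    rw [tendsto_iff_dist_tendsto_zero]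
    refine squeeze_zero (fun _ => dist_nonneg) (fun n => ?_) (by simpa using hε.mul_const (W b))
    rw [Real.dist_eq]; exact hX n b
  have tf := key f f' _ hf
  have tk := key k k' _ hk
  have tF := key F F' _ hF
  refine ⟨measurable_of_tendsto_metrizable (fun n => (h n).meas) (tendsto_pi_nhds.2 tf), ?_, ?_, ?_,
    fun t ht => ?_, fun t ht => ?_, fun s y hs => ?_⟩
  · refine (countable_iUnion fun n => (h n).disc).mono fun t ht => ?_
    by_contra hc
    simp only [mem_iUnion, mem_ofPred_eq, not_exists, not_not] at hc
    exact ht (continuousAt_of_weighted_approx (by fun_prop) hc hε hf)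
  · exact continuous_iff_continuousAt.2 fun t =>
      continuousAt_of_weighted_approx (by fun_prop) (fun n => (h n).cont_k.continuousAt) hε hk
  · exact continuous_iff_continuousAt.2 fun t =>
      continuousAt_of_weighted_approx (by fun_prop) (fun n => (h n).cont_F.continuousAt) hε hF
  · exact tendsto_nhds_unique (tf t) (by simp [(h _).f_zero t ht])
  · exact tendsto_nhds_unique (tk t) (by simp [(h _).k_zero t ht])
  · exact tendsto_nhds_unique (tF (s, y)) (by simp [(h _).F_zero s y hs])

/-- Existence of finitely many waves that are coupled at `y = 0` by feedback into their profiles,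
satisfy a Robin condition with constant `h e` at `y = L e`, and have the potential `q e` times
the wave as source. The source is evaluated at `clamp (L e) y`, so that it is defined on the
whole plane and uses the wave on `[0, L e]` only. -/
theorem exists_wave_system {ι : Type} [Fintype ι] (L h : ι → ℝ) (hL : ∀ e, 0 < L e)
    (q : ι → ℝ × ℝ → ℝ) (hq : ∀ e, Continuous (q e)) (hqb : ∀ e, ∃ B, ∀ p, |q e p| ≤ B)
    (Φ : ι → ι → Feedback) (d : ι → ℝ → ℝ) (hd_meas : ∀ e, Measurable (d e))
    (hd_disc : ∀ e, {t | ¬ ContinuousAt (d e) t}.Countable) (hd_bd : ∀ e, ∃ B, ∀ t, |d e t| ≤ B)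
    (hd_zero : ∀ e, ∀ t ≤ 0, d e t = 0) :
    ∃ (f k : ι → ℝ → ℝ) (F : ι → ℝ × ℝ → ℝ) (K M : ℝ), 2 ≤ K ∧
      (∀ e, Admissible (L e) (f e) (k e) (F e)) ∧ (∀ e, ExpBound K M (f e) (k e) (F e)) ∧
      (∀ e s, f e s = d e s + ∑ e', (Φ e e').apply (L e') (f e') (k e') (F e') s) ∧
      (∀ e s, k e s = -(coneY (F e) s (L e) + h e * wave (L e) (f e) (k e) (F e) s (L e))) ∧
      (∀ e s y, F e (s, y) = q e (s, y) * wave (L e) (f e) (k e) (F e) s (clamp (L e) y)) := by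
  classical
  choose Bq hBq using hqb
  choose Bd hBd using hd_bd
  have hBq0 : ∀ e, 0 ≤ Bq e := fun e => (abs_nonneg _).trans (hBq e 0)
  have hBd0 : ∀ e, 0 ≤ Bd e := fun e => (abs_nonneg _).trans (hBd e 0)
  have hconst : ∀ e e', 0 ≤ (Φ e e').const (L e') := fun e e' => (Φ e e').const_nonneg (hL e')
  -- the exponent of the weight: each of the three equations then maps data of size `M` to data of
  -- size at most `M / 2`
  set K : ℝ := 2 + 2 * ((∑ e, ∑ e', (Φ e e').const (L e')) + (∑ e, (1 + |h e| * 5))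
    + ∑ e, Bq e * 5) with hKdef
  have s1 : 0 ≤ ∑ e, ∑ e', (Φ e e').const (L e') :=
    Finset.sum_nonneg fun e _ => Finset.sum_nonneg fun e' _ => hconst e e'
  have s2 : 0 ≤ ∑ e, (1 + |h e| * 5) := Finset.sum_nonneg fun e _ => by positivity
  have s3 : 0 ≤ ∑ e, Bq e * 5 := Finset.sum_nonneg fun e _ => mul_nonneg (hBq0 e) (by norm_num)
  have hK : 2 ≤ K := by linarith
  have hK0 : 0 < K := by linarith
  have k1 : ∀ e, ∑ e', (Φ e e').const (L e') ≤ K / 2 := fun e => by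
    have := Finset.single_le_sum (f := fun e => ∑ e', (Φ e e').const (L e'))
      (fun e _ => Finset.sum_nonneg fun e' _ => hconst e e') (Finset.mem_univ e)
    linarith
  have k2 : ∀ e, 1 + |h e| * 5 ≤ K / 2 := fun e => by
    have := Finset.single_le_sum (f := fun e => 1 + |h e| * 5)
      (fun e _ => by positivity) (Finset.mem_univ e)
    linarith
  have k3 : ∀ e, Bq e * 5 ≤ K / 2 := fun e => by
    have := Finset.single_le_sum (f := fun e => Bq e * 5)
      (fun e _ => mul_nonneg (hBq0 e) (by norm_num)) (Finset.mem_univ e)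
    linarith
  -- the three unknown functions of each wave are glued to one function on a disjoint union
  let W : ι × (ℝ ⊕ ℝ ⊕ ℝ × ℝ) → ℝ := fun a => match a with
    | (_, Sum.inl t) => Real.exp (K * t)
    | (_, Sum.inr (Sum.inl t)) => Real.exp (K * t)
    | (_, Sum.inr (Sum.inr p)) => Real.exp (K * p.1)
  let f : (ι × (ℝ ⊕ ℝ ⊕ ℝ × ℝ) → ℝ) → ι → ℝ → ℝ := fun x e t => x (e, Sum.inl t)
  let k : (ι × (ℝ ⊕ ℝ ⊕ ℝ × ℝ) → ℝ) → ι → ℝ → ℝ := fun x e t => x (e, Sum.inr (Sum.inl t))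
  let F : (ι × (ℝ ⊕ ℝ ⊕ ℝ × ℝ) → ℝ) → ι → ℝ × ℝ → ℝ := fun x e p => x (e, Sum.inr (Sum.inr p))
  let A : (ι × (ℝ ⊕ ℝ ⊕ ℝ × ℝ) → ℝ) → ι × (ℝ ⊕ ℝ ⊕ ℝ × ℝ) → ℝ := fun x a => match a with
    | (e, Sum.inl s) => ∑ e', (Φ e e').apply (L e') (f x e') (k x e') (F x e') s
    | (e, Sum.inr (Sum.inl s)) =>
        -(coneY (F x e) s (L e) + h e * wave (L e) (f x e) (k x e) (F x e) s (L e))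
    | (e, Sum.inr (Sum.inr p)) =>
        q e p * wave (L e) (f x e) (k x e) (F x e) p.1 (clamp (L e) p.2)
  let D : ι × (ℝ ⊕ ℝ ⊕ ℝ × ℝ) → ℝ := fun a => match a with
    | (e, Sum.inl s) => d e s
    | (_, Sum.inr _) => 0
  let C : (ι × (ℝ ⊕ ℝ ⊕ ℝ × ℝ) → ℝ) → Prop := fun x =>
    (∃ M, 0 ≤ M ∧ ∀ a, |x a| ≤ M * W a) ∧ ∀ e, Admissible (L e) (f x e) (k x e) (F x e)
  have hEB : ∀ x M, (∀ a, |x a| ≤ M * W a) → ∀ e, ExpBound K M (f x e) (k x e) (F x e) :=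
    fun x M hx e => ⟨fun t => hx (e, Sum.inl t), fun t => hx (e, Sum.inr (Sum.inl t)),
      fun s y => hx (e, Sum.inr (Sum.inr (s, y)))⟩
  have hWpos : ∀ a, 0 < W a := by
    rintro ⟨e, t | t | p⟩ <;> exact Real.exp_pos _
  have hAbd : ∀ x M, (∀ e, Admissible (L e) (f x e) (k x e) (F x e)) → 0 ≤ M →
      (∀ a, |x a| ≤ M * W a) → ∀ a, |A x a| ≤ M / 2 * W a := by
    intro x M hx hM hb
    have hE := hEB x M hb
    have red : ∀ (c : ℝ) (t : ℝ), c ≤ K / 2 → c * (M / K * Real.exp (K * t)) ≤ M / 2 * Real.exp (K * t) := by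
      intro c t hc
      calc _ ≤ K / 2 * (M / K * Real.exp (K * t)) := by gcongr
        _ = _ := by field_simp
    rintro ⟨e, s | s | p⟩
    · refine (Finset.abs_sum_le_sum_abs _ _).trans ((Finset.sum_le_sum fun e' _ =>
        (Φ e e').abs_apply_le (hL e') hK (hx e') (hE e') s).trans ?_)
      rw [← Finset.sum_mul]
      exact red _ _ (k1 e)
    · have h1 := abs_coneY_le hK0 (hx e).F_zero' (hE e).bd_F s (L e)
      have h2 : |h e * wave (L e) (f x e) (k x e) (F x e) s (L e)|
          ≤ |h e| * 5 * (M / K * Real.exp (K * s)) := by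
        rw [abs_mul, mul_assoc]
        gcongr
        exact (abs_wave_le hK (hx e) (hE e) ⟨(hL e).le, le_rfl⟩).trans (le_of_eq (by ring))
      refine (abs_neg _).trans_le ((abs_add_le _ _).trans (le_trans ?_ (red _ s (k2 e))))
      rw [add_mul, one_mul]
      exact add_le_add h1 h2
    · refine le_trans ?_ (red _ p.1 (k3 e))
      refine (abs_mul _ _).trans_le ?_
      rw [mul_assoc]
      exact mul_le_mul (hBq e p) ((abs_wave_le hK (hx e) (hE e) (clamp_mem (hL e).le _)).trans
        (le_of_eq (by ring))) (abs_nonneg _) (hBq0 e)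
  have hsubAB : ∀ x y, C x → C y → C (x - y) := by
    rintro x y ⟨⟨M, hM0, hM⟩, hx⟩ ⟨⟨M', hM0', hM'⟩, hy⟩
    refine ⟨⟨M + M', by positivity, fun a => (abs_sub _ _).trans ?_⟩, fun e => (hx e).sub (hy e)⟩
    rw [add_mul]; exact add_le_add (hM a) (hM' a)
  have key : ∃ x, C x ∧ ∀ a, x a = D a + A x a := by
    refine exists_affine_fixed_point (W := W) C A D ?_ ?_ hsubAB ?_ ?_
      (fun x hx => hx.1) (fun x M hx hM hb => hAbd x M hx.2 hM hb) ?_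
    · refine ⟨⟨∑ e, Bd e, Finset.sum_nonneg fun e _ => hBd0 e, ?_⟩, fun e => ?_⟩
      · rintro ⟨e, s | s⟩
        · rcases le_total s 0 with hs | hs
          · have : D (e, Sum.inl s) = 0 := hd_zero e s hs
            rw [this, abs_zero]
            exact mul_nonneg (Finset.sum_nonneg fun e _ => hBd0 e) (hWpos (e, Sum.inl s)).le
          · have h1 : 1 ≤ Real.exp (K * s) := Real.one_le_exp (by positivity)
            have h2 := Finset.single_le_sum (f := Bd) (fun e _ => hBd0 e) (Finset.mem_univ e)
            calc _ ≤ Bd e := hBd e s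
              _ ≤ (∑ e, Bd e) * 1 := by linarith
              _ ≤ _ := mul_le_mul_of_nonneg_left h1 (Finset.sum_nonneg fun e _ => hBd0 e)
        · simp only [D, abs_zero]
          exact mul_nonneg (Finset.sum_nonneg fun e _ => hBd0 e) (hWpos (e, Sum.inr s)).le
      · exact ⟨hd_meas e, hd_disc e, continuous_const, continuous_const, hd_zero e, fun _ _ => rfl,
          fun _ _ _ => rfl⟩
    · rintro x y ⟨⟨M, hM0, hM⟩, hx⟩ ⟨⟨M', hM0', hM'⟩, hy⟩
      refine ⟨⟨M + M', by positivity, fun a => (abs_add_le _ _).trans ?_⟩, fun e => (hx e).add (hy e)⟩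
      rw [add_mul]; exact add_le_add (hM a) (hM' a)
    · rintro x ⟨⟨M, hM0, hM⟩, hx⟩
      have hE := hEB x M hM
      refine ⟨⟨M / 2, by positivity, hAbd x M hx hM0 hM⟩, fun e => ?_⟩
      have hf_eq : f (A x) e = fun s => ∑ e', ((Φ e e').p * f x e' (s - 2 * L e')
          + (Φ e e').smoothPart (L e') (f x e') (k x e') (F x e') s) := by
        ext s
        exact Finset.sum_congr rfl fun e' _ => (Φ e e').apply_eq s
      have hsm : ∀ e', Continuous ((Φ e e').smoothPart (L e') (f x e') (k x e') (F x e')) := fun e' =>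
        (Φ e e').continuous_smoothPart (hL e').le hK (hx e') (hE e')
      have cw := continuous_wave (hx e) (hE e)
      refine ⟨?_, ?_, ?_, ?_, ?_, ?_, ?_⟩
      · rw [hf_eq]
        refine Finset.measurable_sum _ fun e' _ => ?_
        have h1 := (hx e').meas
        have h2 := (hsm e').measurable
        fun_prop
      · rw [hf_eq]
        refine (countable_iUnion (t := fun e' => {t | ¬ ContinuousAt (f x e') (t - 2 * L e')})
          fun e' => (hx e').disc.preimage_of_injOn (f := fun t => t - 2 * L e')
            fun a _ b _ hab => by simpa using hab).mono fun t ht => ?_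
        by_contra hc
        simp only [mem_iUnion, mem_ofPred_eq, not_exists, not_not] at hc
        refine ht (tendsto_finsetSum _ fun e' _ => ?_)
        have h1 : ContinuousAt (fun t => f x e' (t - 2 * L e')) t :=
          ContinuousAt.comp (f := fun t => t - 2 * L e') (hc e') (by fun_prop)
        exact (h1.const_mul _).add (hsm e').continuousAt
      · have h1 := (continuous_coneY (hx e).cont_F).comp (by fun_prop : Continuous fun s : ℝ => (s, L e))
        have h2 := cw.comp (by fun_prop : Continuous fun s : ℝ => (s, L e))
        exact (h1.add (continuous_const.mul h2)).neg
      · have h1 := continuous_clamp (L e)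
        have h2 := cw.comp (by fun_prop : Continuous fun p : ℝ × ℝ => (p.1, clamp (L e) p.2))
        exact (hq e).mul h2
      · intro t ht
        exact Finset.sum_eq_zero fun e' _ => (Φ e e').apply_zero (hL e') (hx e') ht
      · intro t ht
        change -(coneY (F x e) t (L e) + h e * wave (L e) (f x e) (k x e) (F x e) t (L e)) = 0
        rw [(hx e).coneY_zero ht ht, (hx e).wave_zero ⟨(hL e).le, le_rfl⟩ ht]
        ring
      · intro s y hs
        change q e (s, y) * wave (L e) (f x e) (k x e) (F x e) s (clamp (L e) y) = 0
        rw [(hx e).wave_zero (clamp_mem (hL e).le y) (le_clamp hs), mul_zero]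
    · rintro x y ⟨⟨M, hM0, hM⟩, hx⟩ ⟨⟨M', hM0', hM'⟩, hy⟩
      have hE := hEB x M hM
      have hE' := hEB y M' hM'
      have ef : ∀ e, f (x - y) e = f x e - f y e := fun e => rfl
      have ek : ∀ e, k (x - y) e = k x e - k y e := fun e => rfl
      have eF : ∀ e, F (x - y) e = F x e - F y e := fun e => rfl
      funext a
      rcases a with ⟨e, s | s | p⟩
      · simp only [A, Pi.sub_apply, ef, ek, eF, ← Finset.sum_sub_distrib]
        exact Finset.sum_congr rfl fun e' _ =>
          (Φ e e').apply_sub (hL e').le hK (hx e') (hE e') (hy e') (hE' e') s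
      · simp only [A, Pi.sub_apply, ef, ek, eF, wave_sub (hx e) (hE e) (hy e) (hE' e),
          coneY_sub (hx e).cont_F (hy e).cont_F]
        ring
      · simp only [A, Pi.sub_apply, ef, ek, eF, wave_sub (hx e) (hE e) (hy e) (hE' e)]
        ring
    · intro X x ε hX hε hXx
      refine ⟨?_, fun e => ?_⟩
      · obtain ⟨⟨M, hM0, hM⟩, -⟩ := hX 0
        refine ⟨M + |ε 0|, by positivity, fun a => ?_⟩
        have h1 : |x a| ≤ |X 0 a| + |X 0 a - x a| := by
          have := abs_sub (X 0 a) (X 0 a - x a)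
          simpa using this
        refine h1.trans ?_
        rw [add_mul]
        refine add_le_add (hM a) ((hXx 0 a).trans ?_)
        have := (hWpos a).le
        gcongr
        exact le_abs_self _
      · exact Admissible.lim (fun n => (hX n).2 e) hε (fun n t => hXx n (e, Sum.inl t))
          (fun n t => hXx n (e, Sum.inr (Sum.inl t))) (fun n p => hXx n (e, Sum.inr (Sum.inr p)))
  obtain ⟨x, ⟨⟨M, hM0, hM⟩, hx⟩, hfix⟩ := key
  refine ⟨f x, k x, F x, K, M, hK, hx, hEB x M hM, fun e s => hfix (e, Sum.inl s), fun e s => ?_,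
    fun e s y => ?_⟩
  · exact (hfix (e, Sum.inr (Sum.inl s))).trans (zero_add _)
  · exact (hfix (e, Sum.inr (Sum.inr (s, y)))).trans (zero_add _)

/-! ### Sums of continuous functions and step functions -/

/-- The function that jumps from `0` to `a` at `t`, continuous from the left. -/
def step (t a x : ℝ) : ℝ := if t < x then a else 0

/-- `g` is the sum of a continuous function and finitely many steps. -/
def StepCont (g : ℝ → ℝ) : Prop :=
  ∃ (c : ℝ → ℝ) (J : ℝ →₀ ℝ), Continuous c ∧ ∀ x, g x = c x + J.sum fun t a => step t a x

theorem step_zero (t x : ℝ) : step t 0 x = 0 := by simp [step]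

theorem step_add (t a b x : ℝ) : step t (a + b) x = step t a x + step t b x := by
  unfold step; split_ifs <;> simp

theorem StepCont.of_continuous {g : ℝ → ℝ} (hg : Continuous g) : StepCont g :=
  ⟨g, 0, hg, fun x => by simp⟩

theorem StepCont.add {g h : ℝ → ℝ} (hg : StepCont g) (hh : StepCont h) :
    StepCont fun x => g x + h x := by
  obtain ⟨c, J, hc, hJ⟩ := hg
  obtain ⟨c', J', hc', hJ'⟩ := hh
  refine ⟨fun x => c x + c' x, J + J', hc.add hc', fun x => ?_⟩
  change g x + h x = c x + c' x + _
  rw [hJ, hJ', Finsupp.sum_add_index' (h := fun t a => Folding.step t a x) (fun t => step_zero t x)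
    (fun t a b => step_add t a b x)]
  ring

theorem StepCont.step (t a : ℝ) : StepCont (step t a) :=
  ⟨0, Finsupp.single t a, continuous_const, fun x => by
    rw [Finsupp.sum_single_index (h := fun t a => Folding.step t a x) (step_zero t x)]; simp⟩

theorem StepCont.sum {κ : Type*} (s : Finset κ) {g : κ → ℝ → ℝ} (hg : ∀ i ∈ s, StepCont (g i)) :
    StepCont fun x => ∑ i ∈ s, g i x := by
  classical
  induction s using Finset.induction_on with
  | empty => simpa using StepCont.of_continuous continuous_const
  | insert i s hi ih =>
    simp only [Finset.sum_insert hi]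
    exact (hg i (Finset.mem_insert_self _ _)).add
      (ih fun j hj => hg j (Finset.mem_insert_of_mem hj))

/-- A linear operation that preserves continuity and maps steps to sums of this kind preserves
`StepCont`. -/
theorem StepCont.lift {g g' : ℝ → ℝ} {T : (ℝ → ℝ) → ℝ → ℝ} (hg : StepCont g)
    (hT : ∀ (c : ℝ → ℝ) (s : Finset ℝ) (h : ℝ → ℝ → ℝ) x,
      T (fun x => c x + ∑ t ∈ s, h t x) x = T c x + ∑ t ∈ s, T (h t) x)
    (hc : ∀ c, Continuous c → StepCont (T c)) (hs : ∀ t a, StepCont (T (Folding.step t a)))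
    (hg' : ∀ x, g' x = T g x) : StepCont g' := by
  obtain ⟨c, J, hcc, hJ⟩ := hg
  have e : g = fun x => c x + ∑ t ∈ J.support, Folding.step t (J t) x := funext hJ
  have : g' = fun x => T c x + ∑ t ∈ J.support, T (Folding.step t (J t)) x := by
    ext x; rw [hg', e, hT]
  rw [this]
  exact (hc c hcc).add (StepCont.sum _ fun t _ => hs t _)

theorem StepCont.mul_continuous {g κ : ℝ → ℝ} (hg : StepCont g) (hκ : Continuous κ) :
    StepCont fun x => g x * κ x := by
  refine hg.lift (T := fun g x => g x * κ x) (fun c s h x => by simp [add_mul, Finset.sum_mul])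
    (fun c hc => .of_continuous (hc.mul hκ)) (fun t a => ?_) fun _ => rfl
  -- the product jumps by `a κ(t)`, and what remains is continuous
  have e : (fun x => Folding.step t a x * κ x) =
      fun x => Folding.step t (a * κ t) x + a * (κ (max x t) - κ t) := by
    ext x
    simp only [Folding.step]
    split_ifs with h
    · rw [max_eq_left h.le]; ring
    · rw [max_eq_right (not_lt.1 h)]; ring
  rw [e]
  exact (StepCont.step _ _).add (.of_continuous (by fun_prop))

theorem StepCont.const_mul {g : ℝ → ℝ} (hg : StepCont g) (a : ℝ) : StepCont fun x => a * g x := by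
  simpa only [mul_comm a] using hg.mul_continuous (continuous_const (y := a))

/-- A change of variables with `τ` as inverse moves a step at `t` to `τ t`. -/
theorem StepCont.comp {g Z τ : ℝ → ℝ} (hg : StepCont g) (hZ : Continuous Z)
    (h : ∀ t x, t < Z x ↔ τ t < x) : StepCont fun x => g (Z x) := by
  refine hg.lift (T := fun g x => g (Z x)) (fun c s h x => rfl)
    (fun c hc => .of_continuous (hc.comp hZ)) (fun t a => ?_) fun _ => rfl
  have e : (fun x => Folding.step t a (Z x)) = Folding.step (τ t) a := by
    ext x; simp only [Folding.step, h]
  rw [e]; exact StepCont.step _ _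

theorem StepCont.comp_sub {g : ℝ → ℝ} (hg : StepCont g) (a : ℝ) : StepCont fun x => g (x - a) :=
  hg.comp (τ := fun t => t + a) (by fun_prop) fun t x => lt_sub_iff_add_lt

theorem StepCont.mul_step {g : ℝ → ℝ} (hg : StepCont g) (u : ℝ) :
    StepCont fun x => g x * Folding.step u 1 x := by
  refine hg.lift (T := fun g x => g x * Folding.step u 1 x)
    (fun c s h x => by simp [add_mul, Finset.sum_mul])
    (fun c hc => ?_) (fun t a => ?_) fun _ => rfl
  · simpa only [mul_comm] using (StepCont.step u 1).mul_continuous hc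
  · have e : (fun x => Folding.step t a x * Folding.step u 1 x) = Folding.step (max t u) a := by
      ext x; simp only [Folding.step, max_lt_iff, ite_and]
      split_ifs <;> simp
    rw [e]; exact StepCont.step _ _

theorem measurable_step (t a : ℝ) : Measurable (step t a) :=
  Measurable.ite measurableSet_Ioi measurable_const measurable_const

theorem StepCont.measurable {g : ℝ → ℝ} (hg : StepCont g) : Measurable g := by
  obtain ⟨c, J, hc, hJ⟩ := hg
  have e : g = fun x => c x + ∑ t ∈ J.support, Folding.step t (J t) x := funext hJ
  rw [e]
  exact hc.measurable.add (Finset.measurable_sum _ fun t _ => measurable_step _ _)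

theorem continuousAt_step {t a x : ℝ} (h : x ≠ t) : ContinuousAt (step t a) x := by
  rcases lt_or_gt_of_ne h with h | h
  · refine ContinuousAt.congr (f := fun _ => 0) continuousAt_const ?_
    filter_upwards [Iio_mem_nhds h] with y hy
    rw [step, if_neg (not_lt.2 (le_of_lt hy))]
  · refine ContinuousAt.congr (f := fun _ => a) continuousAt_const ?_
    filter_upwards [Ioi_mem_nhds h] with y hy
    rw [step, if_pos (show t < y from hy)]

theorem StepCont.continuousAt {g : ℝ → ℝ} (hg : StepCont g) :
    ∃ T : Finset ℝ, ∀ x, x ∉ T → ContinuousAt g x := by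
  obtain ⟨c, J, hc, hJ⟩ := hg
  have e : g = fun x => c x + ∑ t ∈ J.support, Folding.step t (J t) x := funext hJ
  refine ⟨J.support, fun x hx => ?_⟩
  rw [e]
  exact hc.continuousAt.add (tendsto_finsetSum _ fun t ht =>
    continuousAt_step fun h => hx (h ▸ ht))

theorem tendsto_step_right (t a x : ℝ) :
    Tendsto (step t a) (𝓝[>] x) (𝓝 (if t ≤ x then a else 0)) := by
  split_ifs with h
  · refine tendsto_const_nhds.congr' ?_
    filter_upwards [self_mem_nhdsWithin] with y hy
    rw [step, if_pos (h.trans_lt hy)]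
  · have := (continuousAt_step (a := a) (ne_of_lt (not_le.1 h))).mono_left
      (nhdsWithin_le_nhds (s := Ioi x))
    rwa [step, if_neg (not_lt.2 (not_le.1 h).le)] at this

theorem tendsto_step_left (t a x : ℝ) :
    Tendsto (step t a) (𝓝[<] x) (𝓝 (if t < x then a else 0)) := by
  split_ifs with h
  · have := (continuousAt_step (a := a) (ne_of_gt h)).mono_left (nhdsWithin_le_nhds (s := Iio x))
    rwa [step, if_pos h] at this
  · refine tendsto_const_nhds.congr' ?_
    filter_upwards [self_mem_nhdsWithin] with y hy
    rw [step, if_neg (not_lt.2 ((le_of_lt hy).trans (not_lt.1 h)))]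

theorem StepCont.tendsto_right {g : ℝ → ℝ} (hg : StepCont g) (x : ℝ) :
    ∃ l, Tendsto g (𝓝[>] x) (𝓝 l) := by
  obtain ⟨c, J, hc, hJ⟩ := hg
  have e : g = fun x => c x + ∑ t ∈ J.support, Folding.step t (J t) x := funext hJ
  rw [e]
  exact ⟨_, (hc.continuousAt.mono_left nhdsWithin_le_nhds).add
    (tendsto_finsetSum _ fun t _ => tendsto_step_right t (J t) x)⟩

theorem StepCont.bounded_on {g : ℝ → ℝ} (hg : StepCont g) (a b : ℝ) :
    ∃ B, ∀ x ∈ Icc a b, |g x| ≤ B := by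
  obtain ⟨c, J, hc, hJ⟩ := hg
  obtain ⟨B, hB⟩ := isCompact_Icc.exists_bound_of_continuousOn (hc.continuousOn (s := Icc a b))
  refine ⟨B + ∑ t ∈ J.support, |J t|, fun x hx => ?_⟩
  rw [hJ]
  refine (abs_add_le _ _).trans (add_le_add (hB x hx) ((Finset.abs_sum_le_sum_abs _ _).trans
    (Finset.sum_le_sum fun t _ => ?_)))
  change |Folding.step t (J t) x| ≤ |J t|
  unfold Folding.step; split_ifs <;> simp

/-- Cut-off to `(0, S]`: the function may be changed outside so that it is bounded and vanishes
on the left. -/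
theorem StepCont.exists_cutoff {g : ℝ → ℝ} (hg : StepCont g) (S : ℝ) :
    ∃ g', StepCont g' ∧ (∃ B, ∀ x, |g' x| ≤ B) ∧ (∀ x ≤ 0, g' x = 0) ∧
      ∀ x ∈ Ioc 0 S, g' x = g x := by
  refine ⟨fun x => g x * Folding.step 0 1 x + -(g x * Folding.step 0 1 x) * Folding.step S 1 x,
    ?_, ?_, ?_, ?_⟩
  · refine (hg.mul_step 0).add (StepCont.mul_step ?_ S)
    simpa using (hg.mul_step 0).const_mul (-1)
  · obtain ⟨B, hB⟩ := hg.bounded_on 0 S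
    refine ⟨max B 0, fun x => ?_⟩
    by_cases h0 : 0 < x
    · by_cases hS : S < x
      · simp [Folding.step, h0, hS]
      · simpa [Folding.step, h0, hS] using Or.inl (hB x ⟨h0.le, not_lt.1 hS⟩)
    · simp [Folding.step, h0]
  · intro x hx
    simp [Folding.step, not_lt.2 hx]
  · intro x hx
    simp [Folding.step, hx.1, not_lt.2 hx.2]

/-- A piecewise continuous function is, off a finite set, a continuous function plus steps: after
its jumps are subtracted, it extends continuously. -/
theorem PiecewiseContinuous.exists_stepCont {f : ℝ → ℝ} (hf : PiecewiseContinuous f) :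
    ∃ h, StepCont h ∧ ∃ T : Finset ℝ, ∀ x ∈ Icc (0 : ℝ) 1 \ (T : Set ℝ), f x = h x := by
  classical
  obtain ⟨⟨S, hS⟩, hr, hl⟩ := hf
  have hlr : ∀ x ∈ Ioo (0 : ℝ) 1, ∃ p : ℝ × ℝ, Tendsto f (𝓝[<] x) (𝓝 p.1) ∧
      Tendsto f (𝓝[>] x) (𝓝 p.2) := fun x hx => by
    obtain ⟨a, ha⟩ := hl x ⟨hx.1, hx.2.le⟩
    obtain ⟨b, hb⟩ := hr x ⟨hx.1.le, hx.2⟩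
    exact ⟨(a, b), ha, hb⟩
  choose! p hp using hlr
  set T := S.filter (· ∈ Ioo (0 : ℝ) 1) with hT
  set J : ℝ → ℝ := fun t => (p t).2 - (p t).1 with hJ
  set g : ℝ → ℝ := fun x => f x - ∑ t ∈ T, step t (J t) x with hg
  set A : Set ℝ := Ioo (0 : ℝ) 1 \ (S : Set ℝ) with hA
  have hcl : Icc (0 : ℝ) 1 ⊆ closure A := by
    have h1 : Ioo (0 : ℝ) 1 ⊆ closure A :=
      ((S.finite_toSet.countable.dense_compl ℝ).open_subset_closure_inter isOpen_Ioo)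
    have h2 := closure_minimal h1 isClosed_closure
    rwa [closure_Ioo zero_ne_one] at h2
  have gr : ∀ x l, Tendsto f (𝓝[>] x) (𝓝 l) →
      Tendsto g (𝓝[>] x) (𝓝 (l - ∑ t ∈ T, if t ≤ x then J t else 0)) := fun x l h =>
    h.sub (tendsto_finsetSum _ fun t _ => tendsto_step_right t (J t) x)
  have gl : ∀ x l, Tendsto f (𝓝[<] x) (𝓝 l) →
      Tendsto g (𝓝[<] x) (𝓝 (l - ∑ t ∈ T, if t < x then J t else 0)) := fun x l h =>
    h.sub (tendsto_finsetSum _ fun t _ => tendsto_step_left t (J t) x)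
  have fc : ∀ x ∈ A, ContinuousAt f x := fun x hx =>
    hS.continuousAt (mem_of_superset ((isOpen_Ioo.sdiff S.finite_toSet.isClosed).mem_nhds hx)
      (sdiff_subset_sdiff_left Ioo_subset_Icc_self))
  -- without its jumps the function has a limit at every point, along the points of continuity `A`
  have hlim : ∀ x ∈ Icc (0 : ℝ) 1, ∃ y, Tendsto g (𝓝[A] x) (𝓝 y) := by
    intro x hx
    rcases eq_or_lt_of_le hx.1 with h0 | h0
    · subst h0
      obtain ⟨l, hl'⟩ := hr 0 ⟨le_rfl, one_pos⟩
      exact ⟨_, (gr 0 l hl').mono_left (nhdsWithin_mono _ fun y hy => hy.1.1)⟩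
    rcases eq_or_lt_of_le hx.2 with h1 | h1
    · subst h1
      obtain ⟨l, hl'⟩ := hl 1 ⟨one_pos, le_rfl⟩
      exact ⟨_, (gl 1 l hl').mono_left (nhdsWithin_mono _ fun y hy => hy.1.2)⟩
    have hxI : x ∈ Ioo (0 : ℝ) 1 := ⟨h0, h1⟩
    by_cases hxS : x ∈ S
    · have hxT : x ∈ T := Finset.mem_filter.2 ⟨hxS, hxI⟩
      have e : (p x).2 - ∑ t ∈ T, (if t ≤ x then J t else 0)
          = (p x).1 - ∑ t ∈ T, (if t < x then J t else 0) := by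
        have h2 : ∀ t, (if t ≤ x then J t else 0) = (if t < x then J t else 0)
            + (if t = x then J x else 0) := by
          intro t
          rcases lt_trichotomy t x with h | h | h
          · simp [h, h.le, h.ne]
          · simp [h]
          · simp [h.not_ge, h.not_gt, h.ne']
        rw [Finset.sum_congr rfl fun t _ => h2 t, Finset.sum_add_distrib, Finset.sum_ite_eq', if_pos hxT]
        simp only [hJ]
        ring
      refine ⟨(p x).1 - ∑ t ∈ T, (if t < x then J t else 0), ?_⟩
      have h3 := gr x _ (hp x hxI).2
      rw [e] at h3
      have h4 := (gl x _ (hp x hxI).1).sup h3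
      rw [← nhdsWithin_union, Iio_union_Ioi] at h4
      refine h4.mono_left (nhdsWithin_mono _ fun y hy => ?_)
      rintro rfl
      exact hy.2 hxS
    · refine ⟨g x, tendsto_nhdsWithin_of_tendsto_nhds ?_⟩
      refine (fc x ⟨hxI, hxS⟩).sub (tendsto_finsetSum _ fun t ht => continuousAt_step ?_)
      rintro rfl
      exact hxS (Finset.mem_filter.1 ht).1
  have hc := continuousOn_extendFrom hcl hlim
  set c : ℝ → ℝ := IccExtend (zero_le_one' ℝ) ((Icc (0 : ℝ) 1).domRestrict (extendFrom A g)) with hcdef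
  have hcc : Continuous c := continuous_IccExtend_iff.2 (continuousOn_iff_continuous_domRestrict.1 hc)
  refine ⟨fun x => c x + ∑ t ∈ T, step t (J t) x, (StepCont.of_continuous hcc).add
    (StepCont.sum _ fun t _ => StepCont.step _ _), insert 0 (insert 1 S), fun x hx => ?_⟩
  have hxI : x ∈ Icc (0 : ℝ) 1 := hx.1
  have hx' : x ≠ 0 ∧ x ≠ 1 ∧ x ∉ S := by simpa using hx.2
  have hxA : x ∈ A := ⟨⟨lt_of_le_of_ne hxI.1 hx'.1.symm, lt_of_le_of_ne hxI.2 hx'.2.1⟩, hx'.2.2⟩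
  have e : c x = g x := by
    rw [hcdef, IccExtend_of_mem _ _ hxI, domRestrict_apply]
    refine extendFrom_eq (hcl hxI) (tendsto_nhdsWithin_of_tendsto_nhds ?_)
    refine (fc x hxA).sub (tendsto_finsetSum _ fun t ht => continuousAt_step ?_)
    rintro rfl
    exact hx'.2.2 (Finset.mem_filter.1 ht).1
  simp only [e, hg]; ring

/-- Solutions of a delay system with piecewise continuous data are piecewise continuous: on a
bounded time interval the jumps of the data are repeated only finitely often. -/
theorem exists_stepCont_of_delay {ι : Type} [Fintype ι] {L : ι → ℝ} (hL : ∀ e, 0 < L e)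
    {f d : ι → ℝ → ℝ} {p : ι → ι → ℝ} {c : ι → ι → ℝ → ℝ} (hd : ∀ e, StepCont (d e))
    (hc : ∀ e e', Continuous (c e e')) (hf0 : ∀ e, ∀ s ≤ 0, f e s = 0)
    (hf : ∀ e s, f e s = d e s + ∑ e', (p e e' * f e' (s - 2 * L e') + c e e' s)) (S : ℝ) (e : ι) :
    ∃ g, StepCont g ∧ ∀ s ≤ S, f e s = g s := by
  have : Nonempty ι := ⟨e⟩
  obtain ⟨e₀, he₀⟩ := Finite.exists_min L
  -- method of steps, with the shortest delay as step size
  have key : ∀ m : ℕ, ∀ e, ∃ g, StepCont g ∧ ∀ s ≤ m * (2 * L e₀), f e s = g s := by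
    intro m
    induction m with
    | zero => exact fun e => ⟨0, .of_continuous continuous_const, fun s hs => hf0 e s (by simpa using hs)⟩
    | succ m ih =>
      choose g hg hfg using ih
      intro e
      refine ⟨fun s => d e s + ∑ e', (p e e' * g e' (s - 2 * L e') + c e e' s), (hd e).add
        (StepCont.sum _ fun e' _ => (((hg e').comp_sub _).const_mul _).add (.of_continuous (hc e e'))),
        fun s hs => ?_⟩
      rw [hf]
      congr 1
      refine Finset.sum_congr rfl fun e' _ => ?_
      rw [hfg e']
      have := he₀ e'
      push_cast at hs
      linarith
  obtain ⟨m, hm⟩ := exists_nat_ge (S / (2 * L e₀))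
  obtain ⟨g, hg, hfg⟩ := key m e
  have : 0 < 2 * L e₀ := by linarith [hL e₀]
  exact ⟨g, hg, fun s hs => hfg s (hs.trans ((div_le_iff₀ this).1 hm))⟩

/-! ### Calculus of waves -/

section

variable {L K M : ℝ} {f k : ℝ → ℝ} {F : ℝ × ℝ → ℝ}

theorem hasDerivAt_prim {t : ℝ} (hf : Measurable f) (hb : ∀ t, |f t| ≤ M * Real.exp (K * t))
    (hc : ContinuousAt f t) : HasDerivAt (prim f) (f t) t :=
  intervalIntegral.integral_hasDerivAt_right (intervalIntegrable_of_expBound hf hb 0 t)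
    hf.stronglyMeasurable.stronglyMeasurableAtFilter hc

theorem hasDerivAt_prim_of_continuous (hk : Continuous k) (t : ℝ) : HasDerivAt (prim k) (k t) t :=
  intervalIntegral.integral_hasDerivAt_right (hk.intervalIntegrable 0 t)
    hk.measurable.stronglyMeasurable.stronglyMeasurableAtFilter hk.continuousAt

/-- The wave has a space derivative at each point that does not lie on a characteristic issuing from
a jump of the profile. -/
theorem hasDerivAt_wave_right (h : Admissible L f k F) (hb : ExpBound K M f k F) {s y : ℝ}
    (h1 : ContinuousAt f (s - y)) (h2 : ContinuousAt f (s + y - 2 * L)) :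
    HasDerivAt (fun y => wave L f k F s y) (waveY L f k F s y) y := by
  have d1 := HasDerivAt.comp (h := fun y => s - y) y (hasDerivAt_prim h.meas hb.bd_f h1)
    ((hasDerivAt_id y).const_sub s)
  have d2 := HasDerivAt.comp (h := fun y => s + y - 2 * L) y (hasDerivAt_prim h.meas hb.bd_f h2)
    (((hasDerivAt_id y).const_add s).sub_const (2 * L))
  have d3 := HasDerivAt.comp (h := fun y => s + y - L) y
    (hasDerivAt_prim_of_continuous h.cont_k (s + y - L)) (((hasDerivAt_id y).const_add s).sub_const L)
  have d4 := hasDerivAt_coneInt_right h.cont_F s y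
  refine (((d1.add d2).add d3).add d4).congr_deriv ?_
  rw [waveY]; ring

theorem integral_shift {a : ℝ} (ha : 0 ≤ a) (hf : ∀ t ≤ 0, f t = 0)
    (hi : ∀ a b, IntervalIntegrable f volume a b) (s : ℝ) :
    ∫ σ in (0 : ℝ)..s, f (σ - a) = prim f (s - a) := by
  rw [intervalIntegral.integral_comp_sub_right f a, prim,
    ← intervalIntegral.integral_add_adjacent_intervals (hi (0 - a) 0) (hi 0 (s - a)),
    intervalIntegral.integral_zero_ae (Eventually.of_forall fun x hx => ?_), zero_add]
  rw [uIoc_of_le (by linarith)] at hx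
  exact hf x hx.2

/-- The wave is the time integral of `waveS`, although it is not differentiable everywhere. -/
theorem integral_waveS (h : Admissible L f k F) (hb : ExpBound K M f k F) {y : ℝ}
    (hy : y ∈ Icc 0 L) (s : ℝ) : ∫ σ in (0 : ℝ)..s, waveS L f k F σ y = wave L f k F s y := by
  have hL : 0 ≤ L := hy.1.trans hy.2
  have i1 := intervalIntegrable_of_expBound h.meas hb.bd_f
  have i2 : ∀ a b, IntervalIntegrable k volume a b := fun a b => h.cont_k.intervalIntegrable a b
  have c3 : Continuous fun σ => coneS F σ y :=
    (continuous_coneS h.cont_F).comp (by fun_prop : Continuous fun σ : ℝ => (σ, y))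
  have e : ∀ σ, waveS L f k F σ y = f (σ - y) + f (σ - (2 * L - y)) + k (σ - (L - y)) + coneS F σ y := by
    intro σ
    rw [waveS, show σ + y - 2 * L = σ - (2 * L - y) by ring, show σ + y - L = σ - (L - y) by ring]
  have ish : ∀ a, IntervalIntegrable (fun σ => f (σ - a)) volume 0 s := fun a => by
    have := (i1 (0 - a) (s - a)).comp_sub_right a
    simpa using this
  have ik : IntervalIntegrable (fun σ => k (σ - (L - y))) volume 0 s :=
    Continuous.intervalIntegrable (h.cont_k.comp (by fun_prop)) _ _
  simp only [e]
  rw [intervalIntegral.integral_add (((ish _).add (ish _)).add ik) (c3.intervalIntegrable _ _),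
    intervalIntegral.integral_add ((ish _).add (ish _)) ik,
    intervalIntegral.integral_add (ish _) (ish _), integral_shift hy.1 h.f_zero i1,
    integral_shift (by linarith [hy.2]) h.f_zero i1,
    integral_shift (by linarith [hy.2]) (fun t ht => h.k_zero t (ht.trans hL)) i2,
    intervalIntegral.integral_eq_sub_of_hasDerivAt
      (fun σ _ => hasDerivAt_coneInt_left h.cont_F σ y) (c3.intervalIntegrable _ _), wave,
    show s - (2 * L - y) = s + y - 2 * L by ring, show s - (L - y) = s + y - L by ring,
    show coneInt F 0 y = 0 by simp [coneInt]]
  ring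

/-- A boundary condition imposed in its time-differentiated form is recovered by integration. -/
theorem integral_integral_waveS (hL : 0 ≤ L) (hK : 2 ≤ K) (h : Admissible L f k F)
    (hb : ExpBound K M f k F) {β : ℝ → ℝ} (hβ : Measurable β) {B : ℝ} (hB : ∀ y, |β y| ≤ B)
    {s : ℝ} (hs : 0 ≤ s) :
    ∫ σ in (0 : ℝ)..s, ∫ y in (0 : ℝ)..L, waveS L f k F σ y * β y
      = ∫ y in (0 : ℝ)..L, wave L f k F s y * β y := by
  have hM := hb.nonneg
  simp only [intervalIntegral.integral_of_le hs, intervalIntegral.integral_of_le hL]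
  rw [integral_integral_swap]
  · refine setIntegral_congr_fun measurableSet_Ioc fun y hy => ?_
    rw [← integral_waveS h hb ⟨hy.1.le, hy.2⟩ s, intervalIntegral.integral_of_le hs]
    exact integral_mul_const _ _
  · have hm : Measurable (Function.uncurry fun σ y => waveS L f k F σ y * β y) :=
      (measurable_waveS h).mul (hβ.comp measurable_snd)
    refine Integrable.of_bound (C := 4 * M * Real.exp (K * s) * B) hm.aestronglyMeasurable ?_
    rw [Measure.prod_restrict]
    refine (ae_restrict_iff' (measurableSet_Ioc.prod measurableSet_Ioc)).2
      (Eventually.of_forall fun p hp => ?_)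
    refine (norm_mul _ _).trans_le (mul_le_mul ((abs_waveS_le' hK h hb
      ⟨hp.2.1.le, hp.2.2⟩).trans ?_) (hB _) (norm_nonneg _) (by positivity))
    gcongr
    exact hp.1.2

theorem hasDerivWithinAt_prim_right {δ : ℝ} (hf : Measurable f)
    (hb : ∀ t, |f t| ≤ M * Real.exp (K * t)) {t : ℝ} (hδ : Tendsto f (𝓝[>] t) (𝓝 δ)) :
    HasDerivWithinAt (prim f) δ (Ici t) t :=
  intervalIntegral.integral_hasDerivWithinAt_of_tendsto_ae_right
    (intervalIntegrable_of_expBound hf hb 0 t)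
    hf.stronglyMeasurable.stronglyMeasurableAtFilter (hδ.mono_left inf_le_left)

/-- The one-sided derivatives of a wave at its front `y = s`, from behind the front. They are
opposite, as the wave depends there on `s - y` to first order. -/
theorem hasDerivWithinAt_wave_front (h : Admissible L f k F) (hb : ExpBound K M f k F) {δ s : ℝ}
    (hδ : Tendsto f (𝓝[>] 0) (𝓝 δ)) (hs : s < L) :
    HasDerivWithinAt (fun y => wave L f k F s y) (-δ) (Iic s) s ∧
      HasDerivWithinAt (fun t => wave L f k F t s) δ (Ici s) s := by
  have d0 : ∀ t, t = 0 → HasDerivWithinAt (prim f) δ (Ici t) t := fun t ht => by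
    rw [ht]; exact hasDerivWithinAt_prim_right h.meas hb.bd_f hδ
  have d2 : HasDerivAt (prim f) 0 (s + s - 2 * L) := by
    have hlt : s + s - 2 * L < 0 := by linarith
    have hc : ContinuousAt f (s + s - 2 * L) := by
      refine ContinuousAt.congr (f := fun _ => 0) continuousAt_const ?_
      filter_upwards [Iio_mem_nhds hlt] with t ht
      exact (h.f_zero t (le_of_lt ht)).symm
    have := hasDerivAt_prim h.meas hb.bd_f hc
    rwa [h.f_zero _ hlt.le] at this
  have d3 : HasDerivAt (prim k) 0 (s + s - L) := by
    have := hasDerivAt_prim_of_continuous h.cont_k (s + s - L)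
    rwa [h.k_zero _ (by linarith)] at this
  constructor
  · have e1 := HasDerivWithinAt.comp (h := fun y => s - y) s (d0 (s - s) (sub_self s))
      ((hasDerivAt_id s).const_sub s).hasDerivWithinAt (s := Iic s)
      (fun y hy => by simpa using hy)
    have e2 := HasDerivAt.comp (h := fun y => s + y - 2 * L) s d2
      (((hasDerivAt_id s).const_add s).sub_const (2 * L))
    have e3 := HasDerivAt.comp (h := fun y => s + y - L) s d3
      (((hasDerivAt_id s).const_add s).sub_const L)
    have e4 := hasDerivAt_coneInt_right h.cont_F s s
    rw [h.coneY_zero le_rfl hs.le] at e4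
    refine (((e1.add e2.hasDerivWithinAt).add e3.hasDerivWithinAt).add e4.hasDerivWithinAt).congr_deriv ?_
    ring
  · have e1 := HasDerivWithinAt.comp (h := fun t => t - s) s (d0 (s - s) (sub_self s))
      ((hasDerivAt_id s).sub_const s).hasDerivWithinAt (s := Ici s)
      (fun y hy => by simpa using hy)
    have e2 := HasDerivAt.comp (h := fun t => t + s - 2 * L) s d2
      (((hasDerivAt_id s).add_const s).sub_const (2 * L))
    have e3 := HasDerivAt.comp (h := fun t => t + s - L) s d3
      (((hasDerivAt_id s).add_const s).sub_const L)
    have e4 := hasDerivAt_coneInt_left h.cont_F s s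
    rw [h.coneS_zero le_rfl hs.le] at e4
    refine (((e1.add e2.hasDerivWithinAt).add e3.hasDerivWithinAt).add e4.hasDerivWithinAt).congr_deriv ?_
    ring

end

/-! ### The wave equation in the sense of distributions -/

/-- The shear `(s, y) ↦ (s, y + ε s)`, which takes the lines `y = const` to characteristics. -/
def shear (ε : ℝ) : ℝ × ℝ ≃ₜ ℝ × ℝ :=
  ⟨⟨fun p => (p.1, p.2 + ε * p.1), fun p => (p.1, p.2 - ε * p.1), fun p => by simp,
    fun p => by simp⟩, by fun_prop, by fun_prop⟩

theorem integral_shear {G : ℝ × ℝ → ℝ} (hG : Continuous G) (hGc : HasCompactSupport G) (ε : ℝ) :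
    ∫ p, G p = ∫ p : ℝ × ℝ, G (p.1, p.2 + ε * p.1) := by
  have hc : Continuous fun p : ℝ × ℝ => G (p.1, p.2 + ε * p.1) := by fun_prop
  have hcs : HasCompactSupport fun p : ℝ × ℝ => G (p.1, p.2 + ε * p.1) :=
    hGc.comp_homeomorph (shear ε)
  rw [Measure.volume_eq_prod, integral_prod _ (hG.integrable_of_hasCompactSupport hGc),
    integral_prod _ (hc.integrable_of_hasCompactSupport hcs)]
  refine integral_congr_ae (Eventually.of_forall fun s => ?_)
  exact (integral_add_right_eq_self (fun y => G (s, y)) (ε * s)).symm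

/-- Integration by parts along the lines `y - ε s = const`. -/
theorem integral_transport {h p : ℝ → ℝ → ℝ} {V : ℝ × ℝ → ℝ} {ε : ℝ}
    (hd : ∀ s x, HasDerivAt (fun s => h s x) (p s x) s)
    (ch : Continuous fun q : ℝ × ℝ => h q.1 q.2) (cp : Continuous fun q : ℝ × ℝ => p q.1 q.2)
    (hV : ContDiff ℝ 1 V) (hVc : HasCompactSupport V) :
    ∫ q : ℝ × ℝ, h q.1 (q.2 - ε * q.1) * fderiv ℝ V q (1, ε)
      = -∫ q : ℝ × ℝ, p q.1 (q.2 - ε * q.1) * V q := by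
  have cV := hV.continuous
  have cV' : Continuous fun q => fderiv ℝ V q (1, ε) :=
    (hV.continuous_fderiv one_ne_zero).clm_apply continuous_const
  have sV' : HasCompactSupport fun q => fderiv ℝ V q (1, ε) := hVc.fderiv_apply ℝ (1, ε)
  have cs : Continuous fun q : ℝ × ℝ => (q.1, q.2 - ε * q.1) := by fun_prop
  have c1 : Continuous fun q : ℝ × ℝ => h q.1 (q.2 - ε * q.1) * fderiv ℝ V q (1, ε) :=
    (ch.comp cs).mul cV'
  have c2 : Continuous fun q : ℝ × ℝ => p q.1 (q.2 - ε * q.1) * V q := (cp.comp cs).mul cV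
  have s1 : HasCompactSupport fun q : ℝ × ℝ => h q.1 (q.2 - ε * q.1) * fderiv ℝ V q (1, ε) :=
    sV'.mul_left
  have s2 : HasCompactSupport fun q : ℝ × ℝ => p q.1 (q.2 - ε * q.1) * V q := hVc.mul_left
  rw [eq_neg_iff_add_eq_zero, ← integral_add (c1.integrable_of_hasCompactSupport s1)
    (c2.integrable_of_hasCompactSupport s2)]
  refine (integral_shear (c1.add c2) (s1.add s2) ε).trans ?_
  simp only [Pi.add_apply]
  have c3 : Continuous fun q : ℝ × ℝ => h q.1 q.2 * V (q.1, q.2 + ε * q.1) := by fun_prop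
  have c4 : Continuous fun q : ℝ × ℝ =>
      h q.1 (q.2 + ε * q.1 - ε * q.1) * fderiv ℝ V (q.1, q.2 + ε * q.1) (1, ε)
      + p q.1 (q.2 + ε * q.1 - ε * q.1) * V (q.1, q.2 + ε * q.1) :=
    (c1.add c2).comp (by fun_prop : Continuous fun q : ℝ × ℝ => (q.1, q.2 + ε * q.1))
  have s4 : HasCompactSupport fun q : ℝ × ℝ =>
      h q.1 (q.2 + ε * q.1 - ε * q.1) * fderiv ℝ V (q.1, q.2 + ε * q.1) (1, ε)
      + p q.1 (q.2 + ε * q.1 - ε * q.1) * V (q.1, q.2 + ε * q.1) :=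
    (s1.add s2).comp_homeomorph (shear ε)
  have s3 : HasCompactSupport fun q : ℝ × ℝ => h q.1 q.2 * V (q.1, q.2 + ε * q.1) :=
    (hVc.comp_homeomorph (shear ε)).mul_left
  have line : ∀ x : ℝ, Topology.IsClosedEmbedding fun s : ℝ => (s, x) := fun x =>
    .of_continuous_injective_isClosedMap (by fun_prop) (fun a b hab => (Prod.mk.inj hab).1)
      (isClosedMap_prodMk_right x)
  rw [Measure.volume_eq_prod, integral_prod_symm _ (c4.integrable_of_hasCompactSupport s4)]
  refine integral_eq_zero_of_ae (Eventually.of_forall fun x => ?_)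
  refine integral_eq_zero_of_hasDerivAt_of_integrable (f := fun s => h s x * V (s, x + ε * s))
    (fun s => ?_)
    ((c4.comp (by fun_prop : Continuous fun s : ℝ => (s, x))).integrable_of_hasCompactSupport
      (s4.comp_isClosedEmbedding (line x)))
    ((c3.comp (by fun_prop : Continuous fun s : ℝ => (s, x))).integrable_of_hasCompactSupport
      (s3.comp_isClosedEmbedding (line x)))
  have h1 : HasDerivAt (fun s : ℝ => (s, x + ε * s)) (1, ε) s := by
    refine (hasDerivAt_id s).prodMk ?_
    simpa using ((hasDerivAt_id s).const_mul ε).const_add x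
  have h2 := ((hV.differentiable one_ne_zero (s, x + ε * s)).hasFDerivAt).comp_hasDerivAt s h1
  refine ((hd s x).mul h2).congr_deriv ?_
  simp only [add_sub_cancel_right, Function.comp_apply]
  ring

/-- Mixed second derivatives agree. -/
theorem fderiv_dir_symm {v : ℝ × ℝ → ℝ} (hv : ContDiff ℝ 2 v) (p a b : ℝ × ℝ) :
    fderiv ℝ (fun q => fderiv ℝ v q a) p b = fderiv ℝ (fun q => fderiv ℝ v q b) p a := by
  have hd : DifferentiableAt ℝ (fderiv ℝ v) p :=
    (hv.fderiv_right (m := 1) (by norm_num)).differentiable one_ne_zero p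
  have e : ∀ a b, fderiv ℝ (fun q => fderiv ℝ v q a) p b = fderiv ℝ (fderiv ℝ v) p b a := by
    intro a b
    rw [fderiv_clm_apply hd (differentiableAt_const a)]
    simp
  rw [e, e]
  exact (hv.contDiffAt.isSymmSndFDerivAt (by simp)) b a

/-- The wave equation `w_ss - w_yy = F` for `wave`, tested against functions of class `C²`. The wave
is the sum of a part transported to the right and a part transported to the left, and the wave
operator factors into the two transport operators. -/
theorem integral_wave_mul_box {L K M : ℝ} {f k : ℝ → ℝ} {F : ℝ × ℝ → ℝ} (h : Admissible L f k F)
    (hb : ExpBound K M f k F) {v : ℝ × ℝ → ℝ} (hv : ContDiff ℝ 2 v) (hvc : HasCompactSupport v) :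
    ∫ p : ℝ × ℝ, wave L f k F p.1 p.2 * (fderiv ℝ (fun q => fderiv ℝ v q (1, 0)) p (1, 0)
      - fderiv ℝ (fun q => fderiv ℝ v q (0, 1)) p (0, 1)) = ∫ p : ℝ × ℝ, F p * v p := by
  have hdir : ∀ a : ℝ × ℝ, ContDiff ℝ 1 fun q => fderiv ℝ v q a := fun a =>
    (hv.fderiv_right (m := 1) (by norm_num)).clm_apply contDiff_const
  have sdir : ∀ a : ℝ × ℝ, HasCompactSupport fun q => fderiv ℝ v q a := fun a =>
    hvc.fderiv_apply ℝ a
  have ddir : ∀ (a p : ℝ × ℝ), DifferentiableAt ℝ (fun q => fderiv ℝ v q a) p := fun a p =>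
    (hdir a).differentiable one_ne_zero p
  set V₁ : ℝ × ℝ → ℝ := fun q => fderiv ℝ v q (1, 0) - fderiv ℝ v q (0, 1) with hV₁
  set V₂ : ℝ × ℝ → ℝ := fun q => fderiv ℝ v q (1, 0) + fderiv ℝ v q (0, 1) with hV₂
  -- `v_ss - v_yy` is the derivative of `v_s - v_y` along `(1, 1)` and of `v_s + v_y` along `(1, -1)`
  have box₁ : ∀ p, fderiv ℝ V₁ p (1, 1) = fderiv ℝ (fun q => fderiv ℝ v q (1, 0)) p (1, 0)
      - fderiv ℝ (fun q => fderiv ℝ v q (0, 1)) p (0, 1) := by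
    intro p
    have e : ((1 : ℝ), (1 : ℝ)) = (1, 0) + (0, 1) := by simp
    rw [hV₁, fderiv_fun_sub (ddir _ p) (ddir _ p), e, map_add, sub_apply,
      sub_apply, fderiv_dir_symm hv p (1, 0) (0, 1)]
    ring
  have box₂ : ∀ p, fderiv ℝ V₂ p (1, -1) = fderiv ℝ (fun q => fderiv ℝ v q (1, 0)) p (1, 0)
      - fderiv ℝ (fun q => fderiv ℝ v q (0, 1)) p (0, 1) := by
    intro p
    have e : ((1 : ℝ), (-1 : ℝ)) = (1, 0) - (0, 1) := by simp
    rw [hV₂, fderiv_fun_add (ddir _ p) (ddir _ p), e, map_sub, add_apply,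
      add_apply, fderiv_dir_symm hv p (1, 0) (0, 1)]
    ring
  -- the parts moving to the right and to the left, as functions of time and of the characteristic
  set h₁ : ℝ → ℝ → ℝ := fun s x => prim f (-x) - 1 / 2 * ∫ σ in (0 : ℝ)..s, fibreInt F 1 σ x with hh₁
  set h₂ : ℝ → ℝ → ℝ := fun s x => prim f (x - 2 * L) + prim k (x - L)
    + 1 / 2 * ∫ σ in (0 : ℝ)..s, fibreInt F (-1) σ x with hh₂
  have cΦ := fun ε => continuous_fibreInt h.cont_F ε
  have dΦ : ∀ ε s x, HasDerivAt (fun s => ∫ σ in (0 : ℝ)..s, fibreInt F ε σ x) (fibreInt F ε s x) s := by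
    intro ε s x
    have : Continuous fun σ => fibreInt F ε σ x :=
      (cΦ ε).comp (by fun_prop : Continuous fun σ : ℝ => (σ, x))
    exact intervalIntegral.integral_hasDerivAt_right (this.intervalIntegrable _ _)
      (this.stronglyMeasurableAtFilter _ _) this.continuousAt
  have cI : ∀ ε, Continuous fun p : ℝ × ℝ => ∫ σ in (0 : ℝ)..p.1, fibreInt F ε σ p.2 := fun ε =>
    (contDiff_parametric_integral (hasDerivAt_fibreInt h.cont_F ε) (cΦ ε)
      (by have := h.cont_F; fun_prop)).continuous
  have cf := continuous_prim h.meas hb.bd_f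
  have ck := continuous_prim h.cont_k.measurable hb.bd_k
  have ch₁ : Continuous fun p : ℝ × ℝ => h₁ p.1 p.2 :=
    (cf.comp (continuous_snd.neg)).sub (continuous_const.mul (cI 1))
  have ch₂ : Continuous fun p : ℝ × ℝ => h₂ p.1 p.2 :=
    ((cf.comp (continuous_snd.sub continuous_const)).add
      (ck.comp (continuous_snd.sub continuous_const))).add (continuous_const.mul (cI (-1)))
  have t₁ := integral_transport (h := h₁) (p := fun s x => -(1 / 2 * fibreInt F 1 s x)) (ε := 1)
    (V := V₁) (fun s x => ((dΦ 1 s x).const_mul (1 / 2)).const_sub _)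
    ch₁ (continuous_const.mul (cΦ 1)).neg
    ((hdir _).sub (hdir _)) ((sdir _).sub (sdir _))
  have t₂ := integral_transport (h := h₂) (p := fun s x => 1 / 2 * fibreInt F (-1) s x) (ε := -1)
    (V := V₂) (fun s x => ((dΦ (-1) s x).const_mul (1 / 2)).const_add _)
    ch₂ (continuous_const.mul (cΦ (-1)))
    ((hdir _).add (hdir _)) ((sdir _).add (sdir _))
  have hw : ∀ s y, wave L f k F s y = h₁ s (y - 1 * s) + h₂ s (y - -1 * s) := by
    intro s y
    simp only [wave, coneInt_eq h.cont_F, hh₁, hh₂]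
    rw [show -(y - 1 * s) = s - y by ring, show y - -1 * s - 2 * L = s + y - 2 * L by ring,
      show y - -1 * s - L = s + y - L by ring, show y + -1 * s = y - 1 * s by ring,
      show y + 1 * s = y - -1 * s by ring]
    ring
  -- back on the characteristic through `(s, y)` the upper limit of `fibreInt` is `y`, whatever `ε` is
  have ef : ∀ ε s y, fibreInt F ε s (y - ε * s) = fibreInt F 0 s y := by
    intro ε s y
    simp only [fibreInt]; congr 1; ring
  simp only [ef, box₁, box₂] at t₁ t₂
  have cbox : Continuous fun p => fderiv ℝ (fun q => fderiv ℝ v q (1, 0)) p (1, 0)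
      - fderiv ℝ (fun q => fderiv ℝ v q (0, 1)) p (0, 1) :=
    (((hdir _).continuous_fderiv one_ne_zero).clm_apply continuous_const).sub
      (((hdir _).continuous_fderiv one_ne_zero).clm_apply continuous_const)
  have sbox : HasCompactSupport fun p => fderiv ℝ (fun q => fderiv ℝ v q (1, 0)) p (1, 0)
      - fderiv ℝ (fun q => fderiv ℝ v q (0, 1)) p (0, 1) :=
    ((sdir _).fderiv_apply ℝ _).sub ((sdir _).fderiv_apply ℝ _)
  have i₁ : Integrable fun p : ℝ × ℝ => h₁ p.1 (p.2 - 1 * p.1) *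
      (fderiv ℝ (fun q => fderiv ℝ v q (1, 0)) p (1, 0)
        - fderiv ℝ (fun q => fderiv ℝ v q (0, 1)) p (0, 1)) :=
    ((ch₁.comp (by fun_prop : Continuous fun p : ℝ × ℝ =>
      (p.1, p.2 - 1 * p.1))).mul cbox).integrable_of_hasCompactSupport sbox.mul_left
  have i₂ : Integrable fun p : ℝ × ℝ => h₂ p.1 (p.2 - -1 * p.1) *
      (fderiv ℝ (fun q => fderiv ℝ v q (1, 0)) p (1, 0)
        - fderiv ℝ (fun q => fderiv ℝ v q (0, 1)) p (0, 1)) :=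
    ((ch₂.comp (by fun_prop : Continuous fun p : ℝ × ℝ =>
      (p.1, p.2 - -1 * p.1))).mul cbox).integrable_of_hasCompactSupport sbox.mul_left
  simp only [hw, add_mul]
  rw [integral_add i₁ i₂, t₁, t₂]
  have c0 := cΦ 0
  have cv := fun a => (hdir a).continuous
  have i1 : ∀ a, Integrable fun p : ℝ × ℝ => fibreInt F 0 p.1 p.2 * fderiv ℝ v p a := fun a =>
    (c0.mul (cv a)).integrable_of_hasCompactSupport (sdir a).mul_left
  have e1 : ∫ q : ℝ × ℝ, -(1 / 2 * fibreInt F 0 q.1 q.2) * V₁ q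
      = -(1 / 2) * ((∫ q : ℝ × ℝ, fibreInt F 0 q.1 q.2 * fderiv ℝ v q (1, 0))
        - ∫ q : ℝ × ℝ, fibreInt F 0 q.1 q.2 * fderiv ℝ v q (0, 1)) := by
    rw [← integral_sub (i1 _) (i1 _), ← integral_const_mul]
    refine integral_congr_ae (Eventually.of_forall fun q => ?_)
    simp only [hV₁]; ring
  have e2 : ∫ q : ℝ × ℝ, (1 / 2 * fibreInt F 0 q.1 q.2) * V₂ q
      = (1 / 2) * ((∫ q : ℝ × ℝ, fibreInt F 0 q.1 q.2 * fderiv ℝ v q (1, 0))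
        + ∫ q : ℝ × ℝ, fibreInt F 0 q.1 q.2 * fderiv ℝ v q (0, 1)) := by
    rw [← integral_add (i1 _) (i1 _), ← integral_const_mul]
    refine integral_congr_ae (Eventually.of_forall fun q => ?_)
    simp only [hV₂]; ring
  have iF : Integrable fun p : ℝ × ℝ => F p * v p :=
    (h.cont_F.mul hv.continuous).integrable_of_hasCompactSupport hvc.mul_left
  -- `fibreInt F 0` is a primitive of `F` in the space variable
  have e3 : (∫ q : ℝ × ℝ, F q * v q) +
      ∫ q : ℝ × ℝ, fibreInt F 0 q.1 q.2 * fderiv ℝ v q (0, 1) = 0 := by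
    have cc : Continuous fun q : ℝ × ℝ => F q * v q + fibreInt F 0 q.1 q.2 * fderiv ℝ v q (0, 1) :=
      (h.cont_F.mul hv.continuous).add (c0.mul (cv _))
    have sc : HasCompactSupport fun q : ℝ × ℝ =>
      F q * v q + fibreInt F 0 q.1 q.2 * fderiv ℝ v q (0, 1) := hvc.mul_left.add (sdir _).mul_left
    have line : ∀ s : ℝ, Topology.IsClosedEmbedding fun y : ℝ => (s, y) := fun s =>
      .of_continuous_injective_isClosedMap (by fun_prop) (fun a b hab => (Prod.mk.inj hab).2)
        (isClosedMap_prodMk_left s)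
    rw [← integral_add iF (i1 _), Measure.volume_eq_prod,
      integral_prod _ (cc.integrable_of_hasCompactSupport sc)]
    refine integral_eq_zero_of_ae (Eventually.of_forall fun s => ?_)
    refine integral_eq_zero_of_hasDerivAt_of_integrable (f := fun y => fibreInt F 0 s y * v (s, y))
      (fun y => ?_)
      ((cc.comp (by fun_prop : Continuous fun y : ℝ => (s, y))).integrable_of_hasCompactSupport
        (sc.comp_isClosedEmbedding (line s)))
      (((c0.mul hv.continuous).comp
        (by fun_prop : Continuous fun y : ℝ => (s, y))).integrable_of_hasCompactSupport
        (hvc.mul_left.comp_isClosedEmbedding (line s)))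
    have h1 : HasDerivAt (fun y : ℝ => (s, y)) (0, 1) y := (hasDerivAt_const y s).prodMk (hasDerivAt_id y)
    have h2 := ((hv.differentiable two_ne_zero (s, y)).hasFDerivAt).comp_hasDerivAt y h1
    refine ((hasDerivAt_fibreInt h.cont_F 0 s y).mul h2).congr_deriv ?_
    simp
  rw [e1, e2]
  linarith

/-! ### Travel time coordinates -/

/-- The coordinate in which a wave with diffusion coefficient `r ^ 4` has unit speed: `τ` is the
travel time from `0`, and `Z` its inverse. All functions live on the whole real line, so that no
boundary of the coordinate range has to be considered; only their values on `[0, 1]` matter.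
The fourth root is the primary datum because it normalizes the kernels. -/
structure Coord where
  /-- the fourth root of the coefficient -/
  r : ℝ → ℝ
  /-- the travel time -/
  τ : ℝ → ℝ
  /-- the inverse of the travel time -/
  Z : ℝ → ℝ
  contDiff_r : ContDiff ℝ 2 r
  r_pos : ∀ z, 0 < r z
  hasDerivAt_τ : ∀ z, HasDerivAt τ (1 / r z ^ 2) z
  τ_zero : τ 0 = 0
  τ_Z : ∀ s, τ (Z s) = s

namespace Coord

variable (A : Coord)

theorem strictMono_τ : StrictMono A.τ :=
  strictMono_of_hasDerivAt_pos A.hasDerivAt_τ fun z => by have := A.r_pos z; positivity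

theorem Z_τ (z : ℝ) : A.Z (A.τ z) = z := A.strictMono_τ.injective (A.τ_Z _)

/-- The travel time as a homeomorphism of the real line. -/
def homeo : ℝ ≃ₜ ℝ := (A.strictMono_τ.orderIsoOfRightInverse A.τ A.Z A.τ_Z).toHomeomorph

theorem coe_homeo_symm : (A.homeo.symm : ℝ → ℝ) = A.Z := rfl

theorem contDiff_τ : ContDiff ℝ 2 A.τ := by
  have h : ContDiff ℝ 2 (deriv A.τ) := by
    rw [funext fun z => (A.hasDerivAt_τ z).deriv]
    exact contDiff_const.div (A.contDiff_r.pow 2) fun z => (pow_pos (A.r_pos z) 2).ne'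
  have : ContDiff ℝ (1 + 1) A.τ := contDiff_succ_iff_deriv.2
    ⟨fun z => (A.hasDerivAt_τ z).differentiableAt, by simp, h.of_le (by norm_num)⟩
  exact this

theorem contDiff_Z : ContDiff ℝ 2 A.Z := by
  have := Homeomorph.contDiff_symm_deriv (n := 2) A.homeo (f' := fun z => 1 / A.r z ^ 2)
    (fun z => by have := A.r_pos z; positivity) A.hasDerivAt_τ A.contDiff_τ
  rwa [coe_homeo_symm] at this

theorem continuous_τ : Continuous A.τ := A.contDiff_τ.continuous

theorem continuous_Z : Continuous A.Z := A.contDiff_Z.continuous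

theorem continuous_r : Continuous A.r := A.contDiff_r.continuous

theorem lt_Z_iff (t s : ℝ) : t < A.Z s ↔ A.τ t < s := by
  rw [← A.strictMono_τ.lt_iff_lt, A.τ_Z]

theorem Z_zero : A.Z 0 = 0 := by
  have h := A.Z_τ 0
  rwa [A.τ_zero] at h

theorem hasDerivAt_Z (s : ℝ) : HasDerivAt A.Z (A.r (A.Z s) ^ 2) s := by
  have h := HasDerivAt.of_local_left_inverse (f := A.τ) (g := A.Z) (a := s) A.continuous_Z.continuousAt
    (A.hasDerivAt_τ (A.Z s)) (by have := A.r_pos (A.Z s); positivity)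
    (Eventually.of_forall A.τ_Z)
  simpa using h

theorem hasDerivAt_r (z : ℝ) : HasDerivAt A.r (deriv A.r z) z :=
  (A.contDiff_r.differentiable two_ne_zero z).hasDerivAt

theorem contDiff_deriv_r : ContDiff ℝ 1 (deriv A.r) := by
  have h : ContDiff ℝ (1 + 1) A.r := A.contDiff_r
  exact (contDiff_succ_iff_deriv.1 h).2.2

theorem hasDerivAt_deriv_r (z : ℝ) : HasDerivAt (deriv A.r) (deriv (deriv A.r) z) z :=
  (A.contDiff_deriv_r.differentiable one_ne_zero z).hasDerivAt

theorem continuous_deriv_deriv_r : Continuous (deriv (deriv A.r)) :=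
  A.contDiff_deriv_r.continuous_deriv_one

theorem hasDerivAt_comp_Z {g : ℝ → ℝ} {g₁ s : ℝ} (hg : HasDerivAt g g₁ (A.Z s)) :
    HasDerivAt (fun s => g (A.Z s)) (g₁ * A.r (A.Z s) ^ 2) s := hg.comp s (A.hasDerivAt_Z s)

/-- In the coordinate `τ` the first order term of `r ^ 4 g''` disappears for `g / r`. -/
theorem hasDerivAt_normalized {g g₁ g₂ : ℝ → ℝ} (h₁ : ∀ z, HasDerivAt g (g₁ z) z)
    (h₂ : ∀ z, HasDerivAt g₁ (g₂ z) z) (s : ℝ) :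
    HasDerivAt (fun s => g (A.Z s) / A.r (A.Z s))
      (A.r (A.Z s) * g₁ (A.Z s) - deriv A.r (A.Z s) * g (A.Z s)) s ∧
    HasDerivAt (fun s => A.r (A.Z s) * g₁ (A.Z s) - deriv A.r (A.Z s) * g (A.Z s))
      (A.r (A.Z s) ^ 3 * g₂ (A.Z s) - A.r (A.Z s) ^ 2 * deriv (deriv A.r) (A.Z s) * g (A.Z s)) s := by
  have hr := (A.r_pos (A.Z s)).ne'
  constructor
  · refine (A.hasDerivAt_comp_Z ((h₁ _).div (A.hasDerivAt_r _) hr)).congr_deriv ?_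
    field_simp
  · refine (A.hasDerivAt_comp_Z (((A.hasDerivAt_r _).mul (h₂ _)).sub
      ((A.hasDerivAt_deriv_r _).mul (h₁ _)))).congr_deriv ?_
    ring

end Coord

/-- The second derivative is extended by constants and integrated twice. -/
theorem exists_contDiff_extension {f : ℝ → ℝ} (hf : ContDiffOn ℝ 2 f (Icc 0 1)) :
    ∃ g : ℝ → ℝ, ContDiff ℝ 2 g ∧ ∀ x ∈ Icc (0 : ℝ) 1, g x = f x := by
  have hu : UniqueDiffOn ℝ (Icc (0 : ℝ) 1) := uniqueDiffOn_Icc one_pos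
  have h2 : ContDiffOn ℝ (1 + 1) f (Icc 0 1) := hf
  have hf1 : ContDiffOn ℝ 1 (derivWithin f (Icc 0 1)) (Icc 0 1) :=
    ((contDiffOn_succ_iff_derivWithin hu).1 h2).2.2
  have hc2 : ContinuousOn (derivWithin (derivWithin f (Icc 0 1)) (Icc 0 1)) (Icc 0 1) :=
    hf1.continuousOn_derivWithin hu le_rfl
  set f₁ := derivWithin f (Icc 0 1) with hf₁
  set f₂ := derivWithin f₁ (Icc 0 1) with hf₂
  set F₂ : ℝ → ℝ := IccExtend (zero_le_one' ℝ) ((Icc (0 : ℝ) 1).domRestrict f₂) with hF₂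
  have cF₂ : Continuous F₂ :=
    continuous_IccExtend_iff.2 (continuousOn_iff_continuous_domRestrict.1 hc2)
  have eF₂ : ∀ x ∈ Icc (0 : ℝ) 1, F₂ x = f₂ x := fun x hx => by
    rw [hF₂, IccExtend_of_mem _ _ hx, domRestrict_apply]
  have hd : ∀ g : ℝ → ℝ, Continuous g → ∀ c x, HasDerivAt (fun x => c + prim g x) (g x) x :=
    fun g hg c x => (hasDerivAt_prim_of_continuous hg x).const_add c
  set F₁ : ℝ → ℝ := fun x => f₁ 0 + prim F₂ x with hF₁
  have dF₁ := hd F₂ cF₂ (f₁ 0)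
  have cF₁ : Continuous F₁ := continuous_iff_continuousAt.2 fun x => (dF₁ x).continuousAt
  have eF₁ : ∀ x ∈ Icc (0 : ℝ) 1, F₁ x = f₁ x := by
    refine eq_of_derivWithin_eq (fun x _ => (dF₁ x).differentiableAt.differentiableWithinAt)
      (hf1.differentiableOn one_ne_zero) (fun x hx => ?_) (by simp [hF₁, prim])
    have hx' := Ico_subset_Icc_self hx
    rw [(dF₁ x).hasDerivWithinAt.derivWithin (hu x hx'), eF₂ x hx']
  set F₀ : ℝ → ℝ := fun x => f 0 + prim F₁ x with hF₀
  have dF₀ := hd F₁ cF₁ (f 0)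
  refine ⟨F₀, ?_, ?_⟩
  · have c1 : ContDiff ℝ 1 F₁ := by
      refine contDiff_one_iff_deriv.2 ⟨fun x => (dF₁ x).differentiableAt, ?_⟩
      rw [funext fun x => (dF₁ x).deriv]; exact cF₂
    have : ContDiff ℝ (1 + 1) F₀ := by
      refine contDiff_succ_iff_deriv.2 ⟨fun x => (dF₀ x).differentiableAt, by simp, ?_⟩
      rw [funext fun x => (dF₀ x).deriv]; exact c1
    exact this
  · refine eq_of_derivWithin_eq (fun x _ => (dF₀ x).differentiableAt.differentiableWithinAt)
      (hf.differentiableOn two_ne_zero) (fun x hx => ?_) (by simp [hF₀, prim])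
    have hx' := Ico_subset_Icc_self hx
    rw [(dF₀ x).hasDerivWithinAt.derivWithin (hu x hx'), eF₁ x hx']

/-- A `C²` extension is joined to the constant `1` by a bump function. -/
theorem exists_pos_bounded_extension {f : ℝ → ℝ} (hf : ContDiffOn ℝ 2 f (Icc 0 1))
    (hpos : ∀ x ∈ Icc (0 : ℝ) 1, 0 < f x) :
    ∃ g : ℝ → ℝ, ContDiff ℝ 2 g ∧ (∀ x, 0 < g x) ∧ (∃ B, ∀ x, g x ≤ B) ∧
      ∀ x ∈ Icc (0 : ℝ) 1, g x = f x := by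
  obtain ⟨G, hG, hGf⟩ := exists_contDiff_extension hf
  have hball : Icc (0 : ℝ) 1 = Metric.closedBall (1 / 2) (1 / 2) := by
    rw [Real.closedBall_eq_Icc]; norm_num
  obtain ⟨δ, hδ, hsub⟩ := (isCompact_Icc (a := (0 : ℝ)) (b := 1)).exists_thickening_subset_open
    (isOpen_lt continuous_const hG.continuous) (fun x hx => by
      simpa [hGf x hx] using hpos x hx : Icc (0 : ℝ) 1 ⊆ {x | 0 < G x})
  rw [hball, thickening_closedBall hδ (by norm_num)] at hsub
  let χ : ContDiffBump (1 / 2 : ℝ) := ⟨1 / 2, δ + 1 / 2, by norm_num, by linarith⟩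
  have hχ : ContDiff ℝ 2 χ := χ.contDiff
  refine ⟨fun x => χ x * G x + (1 - χ x), ?_, fun x => ?_, ?_, fun x hx => ?_⟩
  · exact (hχ.mul hG).add (contDiff_const.sub hχ)
  · by_cases hx : x ∈ Metric.ball (1 / 2 : ℝ) (δ + 1 / 2)
    · have h1 : 0 < G x := hsub hx
      have h2 : 0 < χ x := χ.pos_of_mem_ball hx
      have h3 : χ x ≤ 1 := χ.le_one
      have := mul_pos h2 h1
      linarith
    · have : χ x = 0 := χ.zero_of_le_dist (not_lt.1 hx)
      simp [this]
  · have hc : HasCompactSupport fun x => χ x * G x := χ.hasCompactSupport.mul_right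
    obtain ⟨B, hB⟩ := hc.exists_bound_of_continuous (hχ.continuous.mul hG.continuous)
    refine ⟨B + 1, fun x => ?_⟩
    have h1 := (le_abs_self _).trans (hB x)
    have h2 : 0 ≤ χ x := χ.nonneg
    linarith
  · have : χ x = 1 := χ.one_of_mem_closedBall (by rwa [hball] at hx)
    simp [this, hGf x hx]

/-- Each positive `C²` coefficient on `[0, 1]` has a travel time coordinate; the bound of the extended
coefficient makes the travel time map onto the real line. -/
theorem exists_coord {lam : ℝ → ℝ} (hlam : ContDiffOn ℝ 2 lam (Icc 0 1))
    (hpos : ∀ x ∈ Icc (0 : ℝ) 1, 0 < lam x) :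
    ∃ A : Coord, ∀ x ∈ Icc (0 : ℝ) 1, lam x = A.r x ^ 4 := by
  have hs : ∀ x ∈ Icc (0 : ℝ) 1, 0 < √(√(lam x)) := fun x hx =>
    Real.sqrt_pos.2 (Real.sqrt_pos.2 (hpos x hx))
  obtain ⟨r, hr, hr0, ⟨B, hB⟩, hrl⟩ := exists_pos_bounded_extension
    (f := fun x => √(√(lam x)))
    ((hlam.sqrt fun x hx => (hpos x hx).ne').sqrt fun x hx => (Real.sqrt_pos.2 (hpos x hx)).ne') hs
  have hB0 : 0 < B := (hr0 0).trans_le (hB 0)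
  have hc : Continuous fun x => 1 / r x ^ 2 :=
    continuous_const.div (hr.continuous.pow 2) fun x => (pow_pos (hr0 x) 2).ne'
  have hd : ∀ z, HasDerivAt (prim fun x => 1 / r x ^ 2) (1 / r z ^ 2) z :=
    hasDerivAt_prim_of_continuous hc
  have hge : ∀ x, 1 / B ^ 2 ≤ 1 / r x ^ 2 := fun x =>
    one_div_le_one_div_of_le (pow_pos (hr0 x) 2) (pow_le_pow_left₀ (hr0 x).le (hB x) 2)
  have hmono : Monotone fun z => prim (fun x => 1 / r x ^ 2) z - 1 / B ^ 2 * z := by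
    refine monotone_of_hasDerivAt_nonneg (f' := fun z => 1 / r z ^ 2 - 1 / B ^ 2)
      (fun z => ?_) fun z => sub_nonneg.2 (hge z)
    exact ((hd z).sub ((hasDerivAt_id z).const_mul (1 / B ^ 2))).congr_deriv (by rw [mul_one])
  have h0 : prim (fun x => 1 / r x ^ 2) 0 = 0 := by simp [prim]
  have hBp : 0 < 1 / B ^ 2 := by positivity
  have hsurj : Function.Surjective (prim fun x => 1 / r x ^ 2) := by
    refine Continuous.surjective (continuous_iff_continuousAt.2 fun z => (hd z).continuousAt) ?_ ?_
    · refine tendsto_atTop_mono' _ ?_ (tendsto_id.const_mul_atTop hBp)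
      filter_upwards [eventually_ge_atTop 0] with z hz
      have := hmono hz
      simp only [h0, mul_zero, sub_zero] at this
      simp only [id]; linarith
    · refine tendsto_atBot_mono' _ ?_ (tendsto_id.const_mul_atBot hBp)
      filter_upwards [eventually_le_atBot 0] with z hz
      have := hmono hz
      simp only [h0, mul_zero, sub_zero] at this
      simp only [id]; linarith
  refine ⟨⟨r, _, Function.surjInv hsurj, hr, hr0, hd, h0, Function.surjInv_eq hsurj⟩, fun x hx => ?_⟩
  have h1 := hrl x hx
  change lam x = r x ^ 4
  rw [h1, show (4 : ℕ) = 2 * 2 by norm_num, pow_mul, Real.sq_sqrt (Real.sqrt_nonneg _),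
    Real.sq_sqrt (hpos x hx).le]

/-! ### The kernel equation in the original coordinates -/

/-- The kernel whose normalized form in the travel time coordinates is `w`. The factor is chosen such
that the kernel equation becomes `w_ss - w_yy = q w`, without terms of first order. -/
def kernelFun (A B : Coord) (w : ℝ → ℝ → ℝ) (z ζ : ℝ) : ℝ :=
  A.r z / B.r ζ ^ 3 * w (A.τ z) (B.τ ζ)

/-- The potential `q` of the normalized wave equation. -/
def potential (A B : Coord) (s y : ℝ) : ℝ :=
  B.r (B.Z y) ^ 3 * deriv (deriv B.r) (B.Z y) - A.r (A.Z s) ^ 3 * deriv (deriv A.r) (A.Z s)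

theorem continuous_potential (A B : Coord) :
    Continuous fun p : ℝ × ℝ => potential A B p.1 p.2 := by
  have h1 := A.continuous_deriv_deriv_r
  have h2 := B.continuous_deriv_deriv_r
  have h3 := A.continuous_Z
  have h4 := B.continuous_Z
  have h5 := A.continuous_r
  have h6 := B.continuous_r
  unfold potential
  fun_prop

/-- Change of variables `z = Z(s)`, without any assumption on `g`. -/
theorem integral_coord (A : Coord) (g : ℝ → ℝ) :
    ∫ z, g z = ∫ s, A.r (A.Z s) ^ 2 * g (A.Z s) := by
  have h := integral_image_eq_integral_abs_deriv_smul (s := univ) MeasurableSet.univ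
    (fun s _ => (A.hasDerivAt_Z s).hasDerivWithinAt)
    (fun a _ b _ hab => by rw [← A.τ_Z a, hab, A.τ_Z]) g
  rw [image_univ, Function.Surjective.range_eq fun z => ⟨A.τ z, A.Z_τ z⟩, setIntegral_univ,
    setIntegral_univ] at h
  rw [h]
  refine integral_congr_ae (Eventually.of_forall fun s => ?_)
  simp only [smul_eq_mul]
  rw [abs_of_nonneg (by positivity : (0 : ℝ) ≤ A.r (A.Z s) ^ 2)]

theorem integral_coord_prod (A B : Coord) {G : ℝ × ℝ → ℝ} (hG : Continuous G)
    (hGc : HasCompactSupport G) :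
    ∫ p, G p = ∫ p : ℝ × ℝ, A.r (A.Z p.1) ^ 2 * (B.r (B.Z p.2) ^ 2 * G (A.Z p.1, B.Z p.2)) := by
  have h3 := A.continuous_Z
  have h4 := B.continuous_Z
  have h5 := A.continuous_r
  have h6 := B.continuous_r
  have hc : Continuous fun p : ℝ × ℝ =>
      A.r (A.Z p.1) ^ 2 * (B.r (B.Z p.2) ^ 2 * G (A.Z p.1, B.Z p.2)) := by fun_prop
  have hs : HasCompactSupport fun p : ℝ × ℝ => G (A.Z p.1, B.Z p.2) :=
    hGc.comp_homeomorph (A.homeo.symm.prodCongr B.homeo.symm)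
  rw [Measure.volume_eq_prod, integral_prod _ (hG.integrable_of_hasCompactSupport hGc),
    integral_prod _ (hc.integrable_of_hasCompactSupport hs.mul_left.mul_left), integral_coord A]
  refine integral_congr_ae (Eventually.of_forall fun s => ?_)
  simp only
  rw [integral_coord B, integral_const_mul]

/-- Iterated partial derivatives along the coordinate axes, as they are computed in one variable,
agree with iterated Fréchet derivatives. -/
theorem fderiv_fst_of_hasDerivAt {v : ℝ × ℝ → ℝ} (hv : ContDiff ℝ 2 v) {y : ℝ} {V₁ : ℝ → ℝ} {V₂ s : ℝ}
    (h₁ : ∀ s, HasDerivAt (fun t => v (t, y)) (V₁ s) s) (h₂ : HasDerivAt V₁ V₂ s) :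
    fderiv ℝ (fun q => fderiv ℝ v q (1, 0)) (s, y) (1, 0) = V₂ := by
  have hl : ∀ t : ℝ, HasDerivAt (fun t : ℝ => (t, y)) (1, 0) t := fun t =>
    (hasDerivAt_id t).prodMk (hasDerivAt_const t y)
  have e : (fun t => fderiv ℝ v (t, y) (1, 0)) = V₁ := funext fun t =>
    (((hv.differentiable two_ne_zero (t, y)).hasFDerivAt).comp_hasDerivAt t (hl t)).unique (h₁ t)
  have hd : ContDiff ℝ 1 fun q => fderiv ℝ v q (1, 0) :=
    (hv.fderiv_right (m := 1) (by norm_num)).clm_apply contDiff_const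
  have h3 := ((hd.differentiable one_ne_zero (s, y)).hasFDerivAt).comp_hasDerivAt s (hl s)
  exact h3.unique (by rw [← e] at h₂; exact h₂)

theorem fderiv_snd_of_hasDerivAt {v : ℝ × ℝ → ℝ} (hv : ContDiff ℝ 2 v) {s : ℝ} {V₁ : ℝ → ℝ} {V₂ y : ℝ}
    (h₁ : ∀ y, HasDerivAt (fun t => v (s, t)) (V₁ y) y) (h₂ : HasDerivAt V₁ V₂ y) :
    fderiv ℝ (fun q => fderiv ℝ v q (0, 1)) (s, y) (0, 1) = V₂ := by
  have hl : ∀ t : ℝ, HasDerivAt (fun t : ℝ => (s, t)) (0, 1) t := fun t =>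
    (hasDerivAt_const t s).prodMk (hasDerivAt_id t)
  have e : (fun t => fderiv ℝ v (s, t) (0, 1)) = V₁ := funext fun t =>
    (((hv.differentiable two_ne_zero (s, t)).hasFDerivAt).comp_hasDerivAt t (hl t)).unique (h₁ t)
  have hd : ContDiff ℝ 1 fun q => fderiv ℝ v q (0, 1) :=
    (hv.fderiv_right (m := 1) (by norm_num)).clm_apply contDiff_const
  have h3 := ((hd.differentiable one_ne_zero (s, y)).hasFDerivAt).comp_hasDerivAt y (hl y)
  exact h3.unique (by rw [← e] at h₂; exact h₂)

theorem hasDerivAt_deriv_of_contDiff_two {g : ℝ → ℝ} (hg : ContDiff ℝ 2 g) :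
    (∀ x, HasDerivAt g (deriv g x) x) ∧ ∀ x, HasDerivAt (deriv g) (iteratedDeriv 2 g x) x := by
  have h : ContDiff ℝ (1 + 1) g := hg
  have h1 : ContDiff ℝ 1 (deriv g) := (contDiff_succ_iff_deriv.1 h).2.2
  refine ⟨fun x => (hg.differentiable two_ne_zero x).hasDerivAt, fun x => ?_⟩
  rw [show (2 : ℕ) = 1 + 1 from rfl, iteratedDeriv_succ, iteratedDeriv_one]
  exact (h1.differentiable one_ne_zero x).hasDerivAt

theorem continuous_iteratedDeriv_fst {v : ℝ × ℝ → ℝ} (hv : ContDiff ℝ 2 v) :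
    Continuous fun p : ℝ × ℝ => iteratedDeriv 2 (fun t => v (t, p.2)) p.1 := by
  have e : (fun p : ℝ × ℝ => iteratedDeriv 2 (fun t => v (t, p.2)) p.1)
      = fun p => fderiv ℝ (fun q => fderiv ℝ v q (1, 0)) p (1, 0) := by
    funext p
    have hc := hasDerivAt_deriv_of_contDiff_two
      (hv.comp (contDiff_id.prodMk contDiff_const : ContDiff ℝ 2 fun t : ℝ => (t, p.2)))
    exact (fderiv_fst_of_hasDerivAt hv (y := p.2) hc.1 (hc.2 p.1)).symm
  rw [e]
  have hd : ContDiff ℝ 1 fun q => fderiv ℝ v q (1, 0) :=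
    (hv.fderiv_right (m := 1) (by norm_num)).clm_apply contDiff_const
  exact (hd.continuous_fderiv one_ne_zero).clm_apply continuous_const

theorem continuous_iteratedDeriv_snd {v : ℝ × ℝ → ℝ} (hv : ContDiff ℝ 2 v) :
    Continuous fun p : ℝ × ℝ => iteratedDeriv 2 (fun t => v (p.1, t)) p.2 := by
  have e : (fun p : ℝ × ℝ => iteratedDeriv 2 (fun t => v (p.1, t)) p.2)
      = fun p => fderiv ℝ (fun q => fderiv ℝ v q (0, 1)) p (0, 1) := by
    funext p
    have hc := hasDerivAt_deriv_of_contDiff_two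
      (hv.comp (contDiff_const.prodMk contDiff_id : ContDiff ℝ 2 fun t : ℝ => (p.1, t)))
    exact (fderiv_snd_of_hasDerivAt hv (s := p.1) hc.1 (hc.2 p.2)).symm
  rw [e]
  have hd : ContDiff ℝ 1 fun q => fderiv ℝ v q (0, 1) :=
    (hv.fderiv_right (m := 1) (by norm_num)).clm_apply contDiff_const
  exact (hd.continuous_fderiv one_ne_zero).clm_apply continuous_const

theorem continuous_kernelFun (A B : Coord) {L K M : ℝ} {f k : ℝ → ℝ} {F : ℝ × ℝ → ℝ}
    (h : Admissible L f k F) (hE : ExpBound K M f k F) :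
    Continuous fun p : ℝ × ℝ => kernelFun A B (wave L f k F) p.1 p.2 := by
  have cA := A.continuous_r
  have cB := B.continuous_r
  have cτA := A.continuous_τ
  have cτB := B.continuous_τ
  have c1 : Continuous fun p : ℝ × ℝ => wave L f k F (A.τ p.1) (B.τ p.2) :=
    (continuous_wave h hE).comp (by fun_prop : Continuous fun p : ℝ × ℝ => (A.τ p.1, B.τ p.2))
  have c2 : Continuous fun p : ℝ × ℝ => A.r p.1 / B.r p.2 ^ 3 :=
    (cA.comp continuous_fst).div ((cB.comp continuous_snd).pow 3)
      fun p => (pow_pos (B.r_pos _) 3).ne'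
  exact c2.mul c1

theorem iteratedDeriv_two_eq_zero {g : ℝ → ℝ} {x : ℝ} (h : g =ᶠ[𝓝 x] fun _ => 0) :
    iteratedDeriv 2 g x = 0 := by
  rw [h.iteratedDeriv_eq 2]
  simp

/-- A wave whose source is the potential times the wave gives a solution of the kernel equation: the
test functions are transformed to the travel time coordinates. The source has to have this form only
where the coordinates lie in `[0, 1]`. -/
theorem weakKernelPDE_kernelFun (A B : Coord) {Ω : Set (ℝ × ℝ)}
    (hΩ : interior Ω ⊆ Ioo 0 1 ×ˢ Ioo 0 1) {a b : ℝ → ℝ}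
    (ha : ∀ x ∈ Icc (0 : ℝ) 1, a x = A.r x ^ 4) (hb : ∀ x ∈ Icc (0 : ℝ) 1, b x = B.r x ^ 4)
    {L K M : ℝ} {f k : ℝ → ℝ} {F : ℝ × ℝ → ℝ} (h : Admissible L f k F) (hE : ExpBound K M f k F)
    (hF : ∀ s ∈ Icc 0 (A.τ 1), ∀ y ∈ Icc 0 (B.τ 1),
      F (s, y) = potential A B s y * wave L f k F s y) :
    WeakKernelPDE Ω a b (kernelFun A B (wave L f k F)) := by
  intro η hη hηc hηs
  have hη2 : ContDiff ℝ 2 η := contDiff_infty.1 hη 2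
  -- the coefficients are replaced by their extensions, as the test function vanishes near the other points
  set θ : ℝ × ℝ → ℝ := fun p => A.r p.1 ^ 4 * η p with hθ
  have hθ2 : ContDiff ℝ 2 θ := ((A.contDiff_r.comp contDiff_fst).pow 4).mul hη2
  have hzero : ∀ p, p ∉ tsupport η → η =ᶠ[𝓝 p] fun _ => 0 := fun p hp =>
    notMem_tsupport_iff_eventuallyEq.1 hp
  have hfst : ∀ p : ℝ × ℝ, Tendsto (fun t : ℝ => (t, p.2)) (𝓝 p.1) (𝓝 p) := fun p =>
    Continuous.tendsto' (by fun_prop) _ _ rfl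
  have hsnd : ∀ p : ℝ × ℝ, Tendsto (fun t : ℝ => (p.1, t)) (𝓝 p.2) (𝓝 p) := fun p =>
    Continuous.tendsto' (by fun_prop) _ _ rfl
  have e1 : ∀ p : ℝ × ℝ, iteratedDeriv 2 (fun t => a t * η (t, p.2)) p.1
      = iteratedDeriv 2 (fun t => θ (t, p.2)) p.1 := by
    intro p
    refine Filter.EventuallyEq.iteratedDeriv_eq 2 ?_
    by_cases hp : p ∈ tsupport η
    · have hp1 := (hΩ (hηs hp)).1
      filter_upwards [Ioo_mem_nhds hp1.1 hp1.2] with t ht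
      simp only [hθ, ha t (Ioo_subset_Icc_self ht)]
    · filter_upwards [(hfst p).eventually (hzero p hp)] with t ht
      simp only [hθ, ht, mul_zero]
  have z1 : ∀ p, p ∉ tsupport η → iteratedDeriv 2 (fun t => θ (t, p.2)) p.1 = 0 := fun p hp => by
    refine iteratedDeriv_two_eq_zero ?_
    filter_upwards [(hfst p).eventually (hzero p hp)] with t ht
    simp only [hθ, ht, mul_zero]
  have z2 : ∀ p, p ∉ tsupport η → iteratedDeriv 2 (fun t => η (p.1, t)) p.2 = 0 := fun p hp => by
    refine iteratedDeriv_two_eq_zero ?_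
    filter_upwards [(hsnd p).eventually (hzero p hp)] with t ht
    exact ht
  have e2 : ∀ p : ℝ × ℝ, b p.2 * iteratedDeriv 2 (fun t => η (p.1, t)) p.2
      = B.r p.2 ^ 4 * iteratedDeriv 2 (fun t => η (p.1, t)) p.2 := by
    intro p
    by_cases hp : p ∈ tsupport η
    · rw [hb _ (Ioo_subset_Icc_self (hΩ (hηs hp)).2)]
    · rw [z2 p hp, mul_zero, mul_zero]
  simp only [e1, e2]
  set D : ℝ × ℝ → ℝ := fun p => iteratedDeriv 2 (fun t => θ (t, p.2)) p.1
    - B.r p.2 ^ 4 * iteratedDeriv 2 (fun t => η (p.1, t)) p.2 with hD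
  have cA := A.continuous_r
  have cB := B.continuous_r
  have cD : Continuous D := by
    have c1 := continuous_iteratedDeriv_fst hθ2
    have c2 := continuous_iteratedDeriv_snd hη2
    rw [hD]; fun_prop
  have sD : HasCompactSupport D := by
    refine HasCompactSupport.intro hηc fun p hp => ?_
    simp only [hD, z1 p hp, z2 p hp, mul_zero, sub_zero]
  have cw := continuous_wave h hE
  have cK := continuous_kernelFun A B h hE
  rw [setIntegral_eq_integral_of_forall_compl_eq_zero fun p hp => by
    have hp' : p ∉ tsupport η := fun hc => hp (interior_subset (hηs hc))
    rw [z1 p hp', z2 p hp']; simp]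
  change ∫ p : ℝ × ℝ, kernelFun A B (wave L f k F) p.1 p.2 * D p = 0
  refine (integral_coord_prod A B (cK.mul cD) sD.mul_left).trans ?_
  -- the test function in the new coordinates
  set v : ℝ × ℝ → ℝ := fun p =>
    θ (A.Z p.1, B.Z p.2) / (A.r (A.Z p.1) * B.r (B.Z p.2)) with hv
  have hZ : ContDiff ℝ 2 fun p : ℝ × ℝ => (A.Z p.1, B.Z p.2) :=
    (A.contDiff_Z.comp contDiff_fst).prodMk (B.contDiff_Z.comp contDiff_snd)
  have hv2 : ContDiff ℝ 2 v := (hθ2.comp hZ).div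
    ((A.contDiff_r.comp (A.contDiff_Z.comp contDiff_fst)).mul
      (B.contDiff_r.comp (B.contDiff_Z.comp contDiff_snd)))
    fun p => (mul_pos (A.r_pos _) (B.r_pos _)).ne'
  have hvc : HasCompactSupport v := by
    have h1 : HasCompactSupport fun p : ℝ × ℝ => θ (A.Z p.1, B.Z p.2) :=
      (hηc.mul_left (f := fun p : ℝ × ℝ => A.r p.1 ^ 4)).comp_homeomorph
        (A.homeo.symm.prodCongr B.homeo.symm)
    have h2 := h1.mul_right (f' := fun p : ℝ × ℝ => (A.r (A.Z p.1) * B.r (B.Z p.2))⁻¹)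
    exact h2
  have b1 : ∀ p : ℝ × ℝ, fderiv ℝ (fun q => fderiv ℝ v q (1, 0)) p (1, 0)
      = (A.r (A.Z p.1) ^ 3 * iteratedDeriv 2 (fun t => θ (t, B.Z p.2)) (A.Z p.1)
        - A.r (A.Z p.1) ^ 2 * deriv (deriv A.r) (A.Z p.1) * θ (A.Z p.1, B.Z p.2))
        / B.r (B.Z p.2) := by
    intro p
    have hc := hasDerivAt_deriv_of_contDiff_two
      (hθ2.comp (contDiff_id.prodMk contDiff_const : ContDiff ℝ 2 fun t : ℝ => (t, B.Z p.2)))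
    refine fderiv_fst_of_hasDerivAt hv2 (y := p.2) (s := p.1) (fun s => ?_)
      ((A.hasDerivAt_normalized hc.1 hc.2 p.1).2.div_const (B.r (B.Z p.2)))
    refine ((A.hasDerivAt_normalized hc.1 hc.2 s).1.div_const (B.r (B.Z p.2))).congr_of_eventuallyEq
      (Eventually.of_forall fun t => ?_)
    simp only [hv, Function.comp_apply, div_div]; rfl
  have b2 : ∀ p : ℝ × ℝ, fderiv ℝ (fun q => fderiv ℝ v q (0, 1)) p (0, 1)
      = (B.r (B.Z p.2) ^ 3 * iteratedDeriv 2 (fun t => η (A.Z p.1, t)) (B.Z p.2)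
        - B.r (B.Z p.2) ^ 2 * deriv (deriv B.r) (B.Z p.2) * η (A.Z p.1, B.Z p.2))
        * A.r (A.Z p.1) ^ 3 := by
    intro p
    have hc := hasDerivAt_deriv_of_contDiff_two
      (hη2.comp (contDiff_const.prodMk contDiff_id : ContDiff ℝ 2 fun t : ℝ => (A.Z p.1, t)))
    refine fderiv_snd_of_hasDerivAt hv2 (s := p.1) (y := p.2) (fun s => ?_)
      ((B.hasDerivAt_normalized hc.1 hc.2 p.2).2.mul_const (A.r (A.Z p.1) ^ 3))
    refine ((B.hasDerivAt_normalized hc.1 hc.2 s).1.mul_const (A.r (A.Z p.1) ^ 3)).congr_of_eventuallyEq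
      (Eventually.of_forall fun t => ?_)
    have h1 := (A.r_pos (A.Z p.1)).ne'
    have h2 := (B.r_pos (B.Z t)).ne'
    simp only [hv, hθ, Function.comp_apply]
    change _ = η (A.Z p.1, B.Z t) / B.r (B.Z t) * A.r (A.Z p.1) ^ 3
    field_simp
  have hFv : ∀ p : ℝ × ℝ, F p * v p = potential A B p.1 p.2 * wave L f k F p.1 p.2 * v p := by
    intro p
    by_cases hp : (A.Z p.1, B.Z p.2) ∈ tsupport η
    · have hp' := hΩ (hηs hp)
      have hs : p.1 ∈ Icc 0 (A.τ 1) := by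
        have h1 := A.strictMono_τ hp'.1.1
        have h2 := A.strictMono_τ hp'.1.2
        rw [A.τ_Z, A.τ_zero] at h1; rw [A.τ_Z] at h2
        exact ⟨h1.le, h2.le⟩
      have hy : p.2 ∈ Icc 0 (B.τ 1) := by
        have h1 := B.strictMono_τ hp'.2.1
        have h2 := B.strictMono_τ hp'.2.2
        rw [B.τ_Z, B.τ_zero] at h1; rw [B.τ_Z] at h2
        exact ⟨h1.le, h2.le⟩
      rw [← hF p.1 hs p.2 hy]
    · have : η (A.Z p.1, B.Z p.2) = 0 := image_eq_zero_of_notMem_tsupport hp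
      simp only [hv, hθ, this, mul_zero, zero_div]
  have hbox := integral_wave_mul_box h hE hv2 hvc
  have cp := continuous_potential A B
  have i1 : Integrable fun p : ℝ × ℝ => wave L f k F p.1 p.2 *
      (fderiv ℝ (fun q => fderiv ℝ v q (1, 0)) p (1, 0)
      - fderiv ℝ (fun q => fderiv ℝ v q (0, 1)) p (0, 1)) := by
    have hd : ∀ a : ℝ × ℝ, ContDiff ℝ 1 fun q => fderiv ℝ v q a := fun a =>
      (hv2.fderiv_right (m := 1) (by norm_num)).clm_apply contDiff_const
    have hc : ∀ a : ℝ × ℝ, Continuous fun p => fderiv ℝ (fun q => fderiv ℝ v q a) p a := fun a =>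
      ((hd a).continuous_fderiv one_ne_zero).clm_apply continuous_const
    have hs : ∀ a : ℝ × ℝ, HasCompactSupport fun p => fderiv ℝ (fun q => fderiv ℝ v q a) p a :=
      fun a => (hvc.fderiv_apply ℝ a).fderiv_apply ℝ a
    exact (cw.mul ((hc _).sub (hc _))).integrable_of_hasCompactSupport ((hs _).sub (hs _)).mul_left
  have i2 : Integrable fun p : ℝ × ℝ => F p * v p :=
    (h.cont_F.mul hv2.continuous).integrable_of_hasCompactSupport hvc.mul_left
  rw [← sub_eq_zero, ← integral_sub i1 i2] at hbox
  rw [← hbox]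
  refine integral_congr_ae (Eventually.of_forall fun p => ?_)
  simp only [hFv, b1, b2, hD, kernelFun, A.τ_Z, B.τ_Z, potential, Pi.mul_apply]
  have h1 := (A.r_pos (A.Z p.1)).ne'
  have h2 := (B.r_pos (B.Z p.2)).ne'
  simp only [hv, hθ]
  field_simp
  ring

/-! ### Piecewise regularity of the kernels -/

/-- The curves and the pieces may be indexed by arbitrary finite types. -/
theorem PiecewiseC1On.of_fintype {Ω : Set (ℝ × ℝ)} {f : ℝ × ℝ → ℝ} {κ ν : Type} [Fintype κ]
    [Fintype ν] (hf : ContinuousOn f Ω) (γ : κ → ℝ → ℝ) (U : ν → Set (ℝ × ℝ))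
    (hγ : ∀ k, ContDiff ℝ 1 (γ k)) (hU : ∀ k, IsOpen (U k))
    (hdisj : ∀ k l, k ≠ l → Disjoint (U k) (U l)) (hsub : ∀ k, U k ⊆ interior Ω)
    (hcover : ∀ p ∈ interior Ω, (∀ k, p.2 ≠ γ k p.1) → ∃ k, p ∈ U k)
    (hreg : ∀ k, ContDiffOn ℝ 1 f (U k) ∧ UniformContinuousOn (fderiv ℝ f) (U k)) :
    PiecewiseC1On Ω f := by
  refine ⟨hf, Fintype.card κ, Fintype.card ν, fun k => γ ((Fintype.equivFin κ).symm k),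
    fun k => U ((Fintype.equivFin ν).symm k), fun k => (hγ _).contDiffOn, fun k => hU _,
    fun k l hkl => hdisj _ _ fun h => hkl ((Fintype.equivFin ν).symm.injective h),
    fun k => hsub _, fun p hp => ?_, fun k => hreg _⟩
  by_cases h : ∀ k, p.2 ≠ γ k p.1
  · obtain ⟨k, hk⟩ := hcover p hp h
    exact Or.inl (mem_iUnion.2 ⟨Fintype.equivFin ν k, by simpa using hk⟩)
  · push Not at h
    obtain ⟨k, hk⟩ := h
    exact Or.inr (mem_iUnion.2 ⟨Fintype.equivFin κ k, by simpa using hk⟩)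

/-- The points on the prescribed side of each of the points of `T`. -/
def cell (T : Finset ℝ) (σ : T → Bool) : Set ℝ :=
  {x | ∀ t : T, if σ t then (t : ℝ) < x else x < t}

theorem isOpen_cell (T : Finset ℝ) (σ : T → Bool) : IsOpen (cell T σ) := by
  have e : cell T σ = ⋂ t : T, {x | if σ t then (t : ℝ) < x else x < t} := by
    ext x; simp [cell]
  rw [e]
  refine isOpen_iInter_of_finite fun t => ?_
  by_cases h : σ t
  · simp only [h, if_true]; exact isOpen_Ioi
  · simp only [h, Bool.false_eq_true, if_false]; exact isOpen_Iio

theorem eq_of_mem_cell {T : Finset ℝ} {σ σ' : T → Bool} {x : ℝ} (h : x ∈ cell T σ)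
    (h' : x ∈ cell T σ') : σ = σ' := by
  funext t
  have h1 := h t
  have h2 := h' t
  by_cases a : σ t <;> by_cases b : σ' t <;> simp only [a, b, if_true] at h1 h2 ⊢
  · exact absurd h2 (by simpa using h1.le)
  · exact absurd h1 (by simpa using h2.le)

theorem exists_mem_cell {T : Finset ℝ} {x : ℝ} (h : x ∉ T) : ∃ σ, x ∈ cell T σ := by
  classical
  refine ⟨fun t => decide ((t : ℝ) < x), fun t => ?_⟩
  by_cases a : (t : ℝ) < x
  · simp [a]
  · have : x ≠ t := fun e => h (e ▸ t.2)
    simpa [a] using lt_of_le_of_ne (not_lt.1 a) this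

theorem mem_cell_of_mem_uIcc {T : Finset ℝ} {σ : T → Bool} {x y z : ℝ} (hx : x ∈ cell T σ)
    (hy : y ∈ cell T σ) (hz : z ∈ uIcc x y) : z ∈ cell T σ := by
  intro t
  have h1 := hx t
  have h2 := hy t
  by_cases a : σ t <;> simp only [a, if_true, Bool.false_eq_true, if_false] at h1 h2 ⊢
  · exact (lt_min h1 h2).trans_le hz.1
  · exact hz.2.trans_lt (max_lt h1 h2)

theorem contDiff_prim {g : ℝ → ℝ} (hg : Continuous g) : ContDiff ℝ 1 (prim g) := by
  refine contDiff_one_iff_deriv.2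
    ⟨fun x => (hasDerivAt_prim_of_continuous hg x).differentiableAt, ?_⟩
  rw [funext fun x => (hasDerivAt_prim_of_continuous hg x).deriv]
  exact hg

theorem StepCont.intervalIntegrable {g : ℝ → ℝ} (hg : StepCont g) (a b : ℝ) :
    IntervalIntegrable g volume a b := by
  obtain ⟨B, hB⟩ := hg.bounded_on (min a b) (max a b)
  rw [intervalIntegrable_iff]
  refine Measure.integrableOn_of_bounded (M := B) (by simp [uIoc]) hg.measurable.aestronglyMeasurable ?_
  refine (ae_restrict_iff' measurableSet_uIoc).2 (Eventually.of_forall fun x hx => ?_)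
  exact hB x ⟨hx.1.le, hx.2⟩

/-- On each cell cut out by its jumps, the primitive coincides with a function that is `C¹` on the
whole line; hence its derivative there is uniformly continuous on bounded sets. -/
theorem StepCont.exists_prim_eq_on_cell {g : ℝ → ℝ} (hg : StepCont g) :
    ∃ T : Finset ℝ, ∀ σ : T → Bool, ∃ G : ℝ → ℝ, ContDiff ℝ 1 G ∧
      ∀ x ∈ cell T σ, prim g x = G x := by
  have hint := hg.intervalIntegrable
  obtain ⟨c, J, hc, hJ⟩ := hg
  refine ⟨J.support, fun σ => ?_⟩
  rcases (cell J.support σ).eq_empty_or_nonempty with he | ⟨x₀, hx₀⟩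
  · exact ⟨0, contDiff_const, by simp [he]⟩
  -- on the cell each step is constant
  set cσ : ℝ → ℝ := fun x => c x + ∑ t : J.support, if σ t then J t else 0 with hcσ
  have ccσ : Continuous cσ := by fun_prop
  have eg : ∀ x ∈ cell J.support σ, g x = cσ x := by
    intro x hx
    rw [hJ, hcσ, Finsupp.sum, ← Finset.sum_coe_sort]
    refine congrArg _ (Finset.sum_congr rfl fun t _ => ?_)
    have h1 := hx t
    by_cases a : σ t <;> simp only [a, if_true, Bool.false_eq_true, if_false] at h1 ⊢
    · exact if_pos h1
    · exact if_neg (not_lt.2 h1.le)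
  refine ⟨fun x => prim g x₀ + (prim cσ x - prim cσ x₀),
    contDiff_const.add ((contDiff_prim ccσ).sub contDiff_const), fun x hx => ?_⟩
  have e1 : prim g x - prim g x₀ = ∫ u in x₀..x, g u :=
    intervalIntegral.integral_interval_sub_left (hint _ _) (hint _ _)
  have e2 : prim cσ x - prim cσ x₀ = ∫ u in x₀..x, cσ u :=
    intervalIntegral.integral_interval_sub_left (ccσ.intervalIntegrable _ _)
      (ccσ.intervalIntegrable _ _)
  have e3 : ∫ u in x₀..x, g u = ∫ u in x₀..x, cσ u :=
    intervalIntegral.integral_congr fun u hu => eg u (mem_cell_of_mem_uIcc hx₀ hx hu)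
  change prim g x = prim g x₀ + (prim cσ x - prim cσ x₀)
  rw [e2, ← e3, ← e1]; ring

theorem prim_congr {f g : ℝ → ℝ} {S x : ℝ} (hS : 0 ≤ S) (hfg : ∀ x ≤ S, f x = g x) (hx : x ≤ S) :
    prim f x = prim g x :=
  intervalIntegral.integral_congr fun u hu => hfg u (hu.2.trans (max_le hS hx))

theorem Coord.τ_mono (A : Coord) {x y : ℝ} (h : x ≤ y) : A.τ x ≤ A.τ y :=
  A.strictMono_τ.monotone h

theorem Coord.τ_nonneg (A : Coord) {x : ℝ} (h : 0 ≤ x) : 0 ≤ A.τ x := by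
  have := A.τ_mono h; rwa [A.τ_zero] at this

/-- The cuts are the characteristics, direct and reflected, that start at the jumps of `f`. -/
theorem piecewiseC1On_kernelFun (A B : Coord) {Ω : Set (ℝ × ℝ)} (hΩ : Ω ⊆ square)
    {L K M S : ℝ} {f k : ℝ → ℝ} {F : ℝ × ℝ → ℝ} (h : Admissible L f k F) (hE : ExpBound K M f k F)
    (hL : B.τ 1 = L) {g : ℝ → ℝ} (hg : StepCont g) (hfg : ∀ x ≤ S, f x = g x) (hS : A.τ 1 ≤ S) :
    PiecewiseC1On Ω fun p => kernelFun A B (wave L f k F) p.1 p.2 := by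
  obtain ⟨T, hT⟩ := hg.exists_prim_eq_on_cell
  choose G hG hGe using hT
  have hS0 : 0 ≤ S := (A.τ_nonneg zero_le_one).trans hS
  have hA1 : ContDiff ℝ 1 A.τ := A.contDiff_τ.of_le (by norm_num)
  have hB1 : ContDiff ℝ 1 B.τ := B.contDiff_τ.of_le (by norm_num)
  have hZ1 : ContDiff ℝ 1 B.Z := B.contDiff_Z.of_le (by norm_num)
  have hrA : ContDiff ℝ 1 A.r := A.contDiff_r.of_le (by norm_num)
  have hrB : ContDiff ℝ 1 B.r := B.contDiff_r.of_le (by norm_num)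
  have cτA := A.continuous_τ
  have cτB := B.continuous_τ
  -- the characteristics `s - y = t` and `s + y - 2 L = t`, as graphs over `z`
  let γ : T ⊕ T → ℝ → ℝ := Sum.elim (fun t z => B.Z (A.τ z - t)) fun t z => B.Z (t + 2 * L - A.τ z)
  let U : (T → Bool) × (T → Bool) → Set (ℝ × ℝ) := fun σ =>
    interior Ω ∩ ((fun p : ℝ × ℝ => A.τ p.1 - B.τ p.2) ⁻¹' cell T σ.1 ∩
      (fun p : ℝ × ℝ => A.τ p.1 + B.τ p.2 - 2 * L) ⁻¹' cell T σ.2)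
  have hU : ∀ σ, IsOpen (U σ) := fun σ => isOpen_interior.inter
    (((isOpen_cell T σ.1).preimage (by fun_prop)).inter ((isOpen_cell T σ.2).preimage (by fun_prop)))
  refine PiecewiseC1On.of_fintype (continuous_kernelFun A B h hE).continuousOn γ U ?_ hU ?_
    (fun σ => inter_subset_left) ?_ fun σ => ?_
  · rintro (t | t)
    · exact hZ1.comp (hA1.sub contDiff_const)
    · exact hZ1.comp (contDiff_const.sub hA1)
  · intro σ σ' hne
    refine Set.disjoint_left.2 fun p hp hp' => hne ?_
    exact Prod.ext (eq_of_mem_cell hp.2.1 hp'.2.1) (eq_of_mem_cell hp.2.2 hp'.2.2)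
  · intro p hp hne
    obtain ⟨σ₁, h1⟩ := exists_mem_cell (T := T) (x := A.τ p.1 - B.τ p.2) fun ht => by
      refine hne (Sum.inl ⟨_, ht⟩) ?_
      change p.2 = B.Z (A.τ p.1 - (A.τ p.1 - B.τ p.2))
      rw [sub_sub_cancel, B.Z_τ]
    obtain ⟨σ₂, h2⟩ := exists_mem_cell (T := T) (x := A.τ p.1 + B.τ p.2 - 2 * L) fun ht => by
      refine hne (Sum.inr ⟨_, ht⟩) ?_
      change p.2 = B.Z (A.τ p.1 + B.τ p.2 - 2 * L + 2 * L - A.τ p.1)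
      rw [sub_add_cancel, add_sub_cancel_left, B.Z_τ]
    exact ⟨(σ₁, σ₂), hp, h1, h2⟩
  · set Φ : ℝ × ℝ → ℝ := fun p => A.r p.1 / B.r p.2 ^ 3 *
      (G σ.1 (A.τ p.1 - B.τ p.2) + G σ.2 (A.τ p.1 + B.τ p.2 - 2 * L)
        + prim k (A.τ p.1 + B.τ p.2 - L) + coneInt F (A.τ p.1) (B.τ p.2)) with hΦ
    have t1 : ContDiff ℝ 1 fun p : ℝ × ℝ => A.τ p.1 := hA1.comp contDiff_fst
    have t2 : ContDiff ℝ 1 fun p : ℝ × ℝ => B.τ p.2 := hB1.comp contDiff_snd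
    have cΦ : ContDiff ℝ 1 Φ := by
      refine ContDiff.mul ((hrA.comp contDiff_fst).div ((hrB.comp contDiff_snd).pow 3)
        fun p => (pow_pos (B.r_pos _) 3).ne') (((ContDiff.add ?_ ?_).add ?_).add ?_)
      · exact (hG _).comp (t1.sub t2)
      · exact (hG _).comp ((t1.add t2).sub contDiff_const)
      · exact (contDiff_prim h.cont_k).comp ((t1.add t2).sub contDiff_const)
      · exact (contDiff_coneInt h.cont_F).comp (t1.prodMk t2)
    have eΦ : ∀ p ∈ U σ, kernelFun A B (wave L f k F) p.1 p.2 = Φ p := by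
      intro p hp
      have hp' := hΩ (interior_subset hp.1)
      have b1 : A.τ p.1 ≤ S := (A.τ_mono hp'.1.2).trans hS
      have b2 : 0 ≤ B.τ p.2 := B.τ_nonneg hp'.2.1
      have b3 : B.τ p.2 ≤ L := hL ▸ B.τ_mono hp'.2.2
      simp only [hΦ, kernelFun, wave]
      rw [prim_congr hS0 hfg (by linarith : A.τ p.1 - B.τ p.2 ≤ S),
        prim_congr hS0 hfg (by linarith : A.τ p.1 + B.τ p.2 - 2 * L ≤ S),
        hGe σ.1 _ hp.2.1, hGe σ.2 _ hp.2.2]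
    have hsq : IsCompact square := isCompact_Icc.prod isCompact_Icc
    have hUs : U σ ⊆ square := inter_subset_left.trans (interior_subset.trans hΩ)
    refine ⟨cΦ.contDiffOn.congr eΦ, ?_⟩
    refine ((hsq.uniformContinuousOn_of_continuous
      (cΦ.continuous_fderiv one_ne_zero).continuousOn).mono hUs).congr fun p hp => ?_
    exact (Filter.EventuallyEq.fderiv_eq
      (eventually_of_mem ((hU σ).mem_nhds hp) eΦ)).symm

theorem piecewiseC1On_zero (Ω : Set (ℝ × ℝ)) : PiecewiseC1On Ω fun _ => 0 :=
  PiecewiseC1On.of_fintype (κ := Empty) (ν := Unit) continuousOn_const (fun k => k.elim)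
    (fun _ => interior Ω) (fun k => k.elim) (fun _ => isOpen_interior)
    (fun k l hkl => absurd rfl hkl) (fun _ => Subset.rfl) (fun _ hp _ => ⟨(), hp⟩)
    fun _ => ⟨contDiffOn_const, by
      rw [fderiv_fun_const]
      exact (uniformContinuous_const (b := (0 : ℝ × ℝ →L[ℝ] ℝ))).uniformContinuousOn⟩

theorem triangle_subset_square : triangle ⊆ square := fun _ hp =>
  ⟨⟨hp.1.trans hp.2.1, hp.2.2⟩, hp.1, hp.2.1.trans hp.2.2⟩

theorem interior_square_subset : interior square ⊆ Ioo 0 1 ×ˢ Ioo 0 1 := by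
  rw [square, interior_prod_eq, interior_Icc]

/-! ### The coupled waves of one row -/

theorem sum_prod_ite_eq {J : Type} [Fintype J] [DecidableEq J] (j : J) (T : J × Bool → ℝ) :
    ∑ e : J × Bool, (if e.1 = j then T e else 0) = ∑ b, T (j, b) := by
  rw [Fintype.sum_prod_type_right]
  exact Finset.sum_congr rfl fun b _ => by simp

/-- The waves that solve the coupling conditions of one row of the kernel equations at `y = 0`.
The index `(j, false)` belongs to the square and `(j, true)` to the triangle; `v` weighs the values
in the first coupling condition. That condition is imposed in the form differentiated in time, so
that both conditions together determine the profiles `f`. -/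
theorem exists_coupled_waves {J : Type} [Fintype J] [DecidableEq J] {L h κ m : J × Bool → ℝ}
    {v : Bool → ℝ} (hL : ∀ e, 0 < L e) (hκ : ∀ e, 0 < κ e) (hv₁ : 0 < v false) (hv₂ : v true < 0)
    {q : J × Bool → ℝ × ℝ → ℝ} (hq : ∀ e, Continuous (q e)) (hqb : ∀ e, ∃ B, ∀ p, |q e p| ≤ B)
    {d₀ d₁ : J → ℝ → ℝ} (hd₀ : ∀ j, StepCont (d₀ j)) (hd₁ : ∀ j, StepCont (d₁ j))
    (hd₀b : ∀ j, ∃ B, ∀ s, |d₀ j s| ≤ B) (hd₁b : ∀ j, ∃ B, ∀ s, |d₁ j s| ≤ B)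
    (hd₀z : ∀ j, ∀ s ≤ 0, d₀ j s = 0) (hd₁z : ∀ j, ∀ s ≤ 0, d₁ j s = 0)
    {β₀ β₁ : J × Bool → J → ℝ → ℝ} (hβ₀ : ∀ e j, Measurable (β₀ e j))
    (hβ₁ : ∀ e j, Measurable (β₁ e j)) (hβ₀b : ∀ e j, ∃ B, ∀ y, |β₀ e j y| ≤ B)
    (hβ₁b : ∀ e j, ∃ B, ∀ y, |β₁ e j y| ≤ B) :
    ∃ (f k : J × Bool → ℝ → ℝ) (F : J × Bool → ℝ × ℝ → ℝ) (K M : ℝ), 2 ≤ K ∧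
      (∀ e, Admissible (L e) (f e) (k e) (F e)) ∧ (∀ e, ExpBound K M (f e) (k e) (F e)) ∧
      (∀ e s, k e s = -(coneY (F e) s (L e) + h e * wave (L e) (f e) (k e) (F e) s (L e))) ∧
      (∀ e s y, F e (s, y) = q e (s, y) * wave (L e) (f e) (k e) (F e) s (clamp (L e) y)) ∧
      (∀ S e, ∃ g, StepCont g ∧ ∀ s ≤ S, f e s = g s) ∧
      (∀ j, ∀ s ≥ 0, ∑ b, v b * κ (j, b) * wave (L (j, b)) (f (j, b)) (k (j, b)) (F (j, b)) s 0
        = prim (d₁ j) s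
          - ∑ e, ∫ y in (0 : ℝ)..L e, wave (L e) (f e) (k e) (F e) s y * β₁ e j y) ∧
      ∀ j s, ∑ b, (waveY (L (j, b)) (f (j, b)) (k (j, b)) (F (j, b)) s 0 / κ (j, b)
          + m (j, b) * wave (L (j, b)) (f (j, b)) (k (j, b)) (F (j, b)) s 0)
        = -d₀ j s + ∑ e, ∫ y in (0 : ℝ)..L e, wave (L e) (f e) (k e) (F e) s y * β₀ e j y := by
  choose B₀ hB₀ using hβ₀b
  choose B₁ hB₁ using hβ₁b
  choose D₀ hD₀ using hd₀b
  choose D₁ hD₁ using hd₁b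
  -- the inverse of the matrix that takes the two profiles to the two conditions
  let Δ : J → ℝ := fun j => v false * κ (j, false) / κ (j, true) - v true * κ (j, true) / κ (j, false)
  have hΔ : ∀ j, 0 < Δ j := fun j => by
    have h1 := hκ (j, false)
    have h2 := hκ (j, true)
    have h3 : 0 < v false * κ (j, false) / κ (j, true) := by positivity
    have h4 : 0 < -v true * κ (j, true) / κ (j, false) :=
      div_pos (mul_pos (neg_pos.2 hv₂) h2) h1
    have h5 : -v true * κ (j, true) / κ (j, false) = -(v true * κ (j, true) / κ (j, false)) := by ring
    simp only [Δ]
    linarith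
  -- `x` and `z` are the columns of the inverse: contributions of the first and of the second condition
  let x : J × Bool → ℝ := fun e => (if e.2 then -1 / κ (e.1, false) else 1 / κ (e.1, true)) / Δ e.1
  let z : J × Bool → ℝ := fun e =>
    (if e.2 then v false * κ (e.1, false) else -v true * κ (e.1, true)) / Δ e.1
  have x1 : ∀ j, ∑ b, v b * κ (j, b) * x (j, b) = 1 := fun j => by
    have h0 := (hΔ j).ne'
    have : ∑ b, v b * κ (j, b) * x (j, b) = Δ j / Δ j := by
      simp only [Fintype.sum_bool, x, if_true, Bool.false_eq_true, if_false]
      simp only [Δ]; ring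
    rw [this, div_self h0]
  have x2 : ∀ j, ∑ b, x (j, b) / κ (j, b) = 0 := fun j => by
    simp only [Fintype.sum_bool, x, if_true, Bool.false_eq_true, if_false]; ring
  have z1 : ∀ j, ∑ b, v b * κ (j, b) * z (j, b) = 0 := fun j => by
    simp only [Fintype.sum_bool, z, if_true, Bool.false_eq_true, if_false]; ring
  have z2 : ∀ j, ∑ b, z (j, b) / κ (j, b) = 1 := fun j => by
    have h0 := (hΔ j).ne'
    have : ∑ b, z (j, b) / κ (j, b) = Δ j / Δ j := by
      simp only [Fintype.sum_bool, z, if_true, Bool.false_eq_true, if_false]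
      simp only [Δ]; ring
    rw [this, div_self h0]
  -- solving for the profiles turns all other terms of the two conditions into feedback
  let Φ : J × Bool → J × Bool → Feedback := fun e e' =>
    { p := if e'.1 = e.1 then -(x e * (v e'.2 * κ e')) + z e / κ e' else 0
      a := if e'.1 = e.1 then -(x e * (v e'.2 * κ e')) else 0
      b := if e'.1 = e.1 then z e / κ e' else 0
      c := if e'.1 = e.1 then z e * m e' else 0
      β := fun y => -x e * β₁ e' e.1 y
      γ := fun y => -z e * β₀ e' e.1 y
      B := max (|x e| * B₁ e' e.1) (|z e| * B₀ e' e.1)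
      meas_β := (hβ₁ _ _).const_mul _
      meas_γ := (hβ₀ _ _).const_mul _
      le_β := fun y => by
        rw [abs_mul, abs_neg]
        exact (mul_le_mul_of_nonneg_left (hB₁ _ _ y) (abs_nonneg _)).trans (le_max_left _ _)
      le_γ := fun y => by
        rw [abs_mul, abs_neg]
        exact (mul_le_mul_of_nonneg_left (hB₀ _ _ y) (abs_nonneg _)).trans (le_max_right _ _) }
  let d : J × Bool → ℝ → ℝ := fun e s => x e * d₁ e.1 s + z e * d₀ e.1 s
  have hd : ∀ e, StepCont (d e) := fun e => ((hd₁ _).const_mul _).add ((hd₀ _).const_mul _)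
  have hdisc : ∀ e, {t | ¬ ContinuousAt (d e) t}.Countable := fun e => by
    obtain ⟨T, hT⟩ := (hd e).continuousAt
    refine T.countable_toSet.mono fun t ht => ?_
    by_contra hc
    exact ht (hT t hc)
  obtain ⟨f, k, F, K, M, hK, hA, hE, hf, hk, hF⟩ := exists_wave_system L h hL q hq hqb Φ d
    (fun e => (hd e).measurable) hdisc
    (fun e => ⟨|x e| * D₁ e.1 + |z e| * D₀ e.1, fun t => (abs_add_le _ _).trans (by
      rw [abs_mul, abs_mul]
      exact add_le_add (mul_le_mul_of_nonneg_left (hD₁ _ t) (abs_nonneg _))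
        (mul_le_mul_of_nonneg_left (hD₀ _ t) (abs_nonneg _)))⟩)
    (fun e t ht => by simp only [d, hd₁z _ t ht, hd₀z _ t ht, mul_zero, add_zero])
  have hL0 : ∀ e, 0 ≤ L e := fun e => (hL e).le
  -- the parts of the two conditions that do not contain the new values of the profiles
  let I : J × Bool → ℝ → ℝ := fun e s => f e (s - 2 * L e) + k e (s - L e)
  let W₁ : J → ℝ → ℝ := fun j s =>
    ∑ e, ∫ y in (0 : ℝ)..L e, waveS (L e) (f e) (k e) (F e) s y * β₁ e j y
  let W₀ : J → ℝ → ℝ := fun j s =>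
    ∑ e, ∫ y in (0 : ℝ)..L e, wave (L e) (f e) (k e) (F e) s y * β₀ e j y
  let X : J → ℝ → ℝ := fun j s =>
    d₁ j s - W₁ j s - ∑ b, v b * κ (j, b) * (I (j, b) s + coneS (F (j, b)) s 0)
  let Y : J → ℝ → ℝ := fun j s => d₀ j s - W₀ j s + ∑ b, ((I (j, b) s + coneY (F (j, b)) s 0) / κ (j, b)
    + m (j, b) * wave (L (j, b)) (f (j, b)) (k (j, b)) (F (j, b)) s 0)
  have hfXY : ∀ e s, f e s = x e * X e.1 s + z e * Y e.1 s := by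
    intro e s
    have happ : ∀ e', (Φ e e').apply (L e') (f e') (k e') (F e') s
        = (if e'.1 = e.1 then -(x e * (v e'.2 * κ e')) * (I e' s + coneS (F e') s 0)
            + z e * ((I e' s + coneY (F e') s 0) / κ e'
              + m e' * wave (L e') (f e') (k e') (F e') s 0) else 0)
          + (-x e * (∫ y in (0 : ℝ)..L e', waveS (L e') (f e') (k e') (F e') s y * β₁ e' e.1 y)
          + -z e * ∫ y in (0 : ℝ)..L e', wave (L e') (f e') (k e') (F e') s y * β₀ e' e.1 y) := by
      intro e'
      have i1 : ∫ y in (0 : ℝ)..L e', waveS (L e') (f e') (k e') (F e') s y * (-x e * β₁ e' e.1 y)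
          = -x e * ∫ y in (0 : ℝ)..L e', waveS (L e') (f e') (k e') (F e') s y * β₁ e' e.1 y := by
        rw [← intervalIntegral.integral_const_mul]
        exact intervalIntegral.integral_congr fun y _ => by ring
      have i2 : ∫ y in (0 : ℝ)..L e', wave (L e') (f e') (k e') (F e') s y * (-z e * β₀ e' e.1 y)
          = -z e * ∫ y in (0 : ℝ)..L e', wave (L e') (f e') (k e') (F e') s y * β₀ e' e.1 y := by
        rw [← intervalIntegral.integral_const_mul]
        exact intervalIntegral.integral_congr fun y _ => by ring
      simp only [Feedback.apply, Φ, i1, i2, I]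
      split_ifs <;> ring
    rw [hf e s, Finset.sum_congr rfl fun e' _ => happ e', Finset.sum_add_distrib,
      sum_prod_ite_eq e.1 fun e' => -(x e * (v e'.2 * κ e')) * (I e' s + coneS (F e') s 0)
            + z e * ((I e' s + coneY (F e') s 0) / κ e'
              + m e' * wave (L e') (f e') (k e') (F e') s 0),
      Finset.sum_add_distrib, Finset.sum_add_distrib, ← Finset.mul_sum, ← Finset.mul_sum,
      ← Finset.mul_sum]
    have e1 : ∑ b, -(x e * (v b * κ (e.1, b))) * (I (e.1, b) s + coneS (F (e.1, b)) s 0)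
        = -x e * ∑ b, v b * κ (e.1, b) * (I (e.1, b) s + coneS (F (e.1, b)) s 0) := by
      rw [Finset.mul_sum]
      exact Finset.sum_congr rfl fun b _ => by ring
    rw [e1]
    simp only [d, X, Y, W₁, W₀]
    ring
  have hX : ∀ j s, ∑ b, v b * κ (j, b) * f (j, b) s = X j s := by
    intro j s
    have : ∑ b, v b * κ (j, b) * f (j, b) s = (∑ b, v b * κ (j, b) * x (j, b)) * X j s
        + (∑ b, v b * κ (j, b) * z (j, b)) * Y j s := by
      simp only [hfXY (j, _), Fintype.sum_bool]; ring
    rw [this, x1, z1, one_mul, zero_mul, add_zero]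
  have hY : ∀ j s, ∑ b, f (j, b) s / κ (j, b) = Y j s := by
    intro j s
    have : ∑ b, f (j, b) s / κ (j, b) = (∑ b, x (j, b) / κ (j, b)) * X j s
        + (∑ b, z (j, b) / κ (j, b)) * Y j s := by
      simp only [hfXY (j, _), Fintype.sum_bool]; ring
    rw [this, x2, z2, one_mul, zero_mul, zero_add]
  refine ⟨f, k, F, K, M, hK, hA, hE, hk, hF, fun S e => ?_, fun j s hs => ?_, fun j s => ?_⟩
  · refine exists_stepCont_of_delay hL (f := f) (p := fun e e' => (Φ e e').p)
      (c := fun e e' => (Φ e e').smoothPart (L e') (f e') (k e') (F e')) hd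
      (fun e e' => (Φ e e').continuous_smoothPart (hL0 e') hK (hA e') (hE e'))
      (fun e => (hA e).f_zero) (fun e s => ?_) S e
    rw [hf e s]
    simp only [Feedback.apply_eq]
  · have h0 : ∀ e, (0 : ℝ) ∈ Icc 0 (L e) := fun e => ⟨le_rfl, hL0 e⟩
    have hsum : ∀ σ, ∑ b, v b * κ (j, b) * waveS (L (j, b)) (f (j, b)) (k (j, b)) (F (j, b)) σ 0
        = d₁ j σ - W₁ j σ := by
      intro σ
      have h1 := hX j σ
      simp only [X, I, Fintype.sum_bool] at h1
      simp only [waveS, Fintype.sum_bool, sub_zero, add_zero]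
      linarith
    have iw : ∀ e, IntervalIntegrable (fun σ => waveS (L e) (f e) (k e) (F e) σ 0) volume 0 s :=
      fun e => intervalIntegrable_of_expBound ((measurable_waveS (hA e)).comp
        (by fun_prop : Measurable fun σ : ℝ => (σ, (0 : ℝ))))
        (fun t => abs_waveS_le' hK (hA e) (hE e) (h0 e)) 0 s
    have cW : ∀ e, Continuous fun s => ∫ y in (0 : ℝ)..L e, waveS (L e) (f e) (k e) (F e) s y * β₁ e j y :=
      fun e => continuous_integral_waveS (hL0 e) hK (hA e) (hE e) (hβ₁ e j) (hB₁ e j)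
    -- integration of the differentiated first condition from `0` to `s`
    have h1 := intervalIntegral.integral_congr (μ := volume) (a := 0) (b := s)
      (fun σ _ => hsum σ)
    rw [intervalIntegral.integral_finsetSum fun b _ => (iw _).const_mul _,
      intervalIntegral.integral_sub ((hd₁ j).intervalIntegrable _ _)
        (Continuous.intervalIntegrable (continuous_finsetSum _ fun e _ => cW e) _ _),
      intervalIntegral.integral_finsetSum fun e _ => (cW e).intervalIntegrable _ _] at h1
    simp only [intervalIntegral.integral_const_mul, integral_waveS (hA _) (hE _) (h0 _),
      fun e => integral_integral_waveS (hL0 e) hK (hA e) (hE e) (hβ₁ e j) (hB₁ e j) hs] at h1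
    exact h1
  · have h1 := hY j s
    simp only [Y, I, Fintype.sum_bool] at h1
    simp only [waveY, Fintype.sum_bool, sub_zero, add_zero]
    have e1 : ∀ a b c d κ : ℝ, (-a + b + c + d) / κ = (b + c + d) / κ - a / κ := fun a b c d κ => by ring
    rw [e1, e1]
    linarith

/-! ### Boundary values of the kernels -/

section

variable {A B : Coord} {K M : ℝ} {f k : ℝ → ℝ} {F : ℝ × ℝ → ℝ} {z ζ : ℝ}

/-- Finite propagation speed. -/
theorem kernelFun_eq_zero (h : Admissible (B.τ 1) f k F) (hζ : ζ ∈ Icc (0 : ℝ) 1)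
    (hz : A.τ z ≤ B.τ ζ) : kernelFun A B (wave (B.τ 1) f k F) z ζ = 0 := by
  rw [kernelFun, h.wave_zero ⟨B.τ_nonneg hζ.1, B.τ_mono hζ.2⟩ hz, mul_zero]

/-- The boundary expression `(u b)_ζ` of the kernel equation, where `b = r ^ 4` is the diffusion
coefficient of the column, in terms of the wave. -/
theorem hasDerivAt_kernelFun_right (h : Admissible (B.τ 1) f k F) (hE : ExpBound K M f k F)
    (h1 : ContinuousAt f (A.τ z - B.τ ζ)) (h2 : ContinuousAt f (A.τ z + B.τ ζ - 2 * B.τ 1)) :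
    ∃ D, HasDerivAt (fun ζ => kernelFun A B (wave (B.τ 1) f k F) z ζ) D ζ ∧
      D * B.r ζ ^ 4 + kernelFun A B (wave (B.τ 1) f k F) z ζ * (4 * B.r ζ ^ 3 * deriv B.r ζ)
        = A.r z * (waveY (B.τ 1) f k F (A.τ z) (B.τ ζ) / B.r ζ
          + deriv B.r ζ * wave (B.τ 1) f k F (A.τ z) (B.τ ζ)) := by
  have hr := (B.r_pos ζ).ne'
  have d1 := HasDerivAt.comp (h := B.τ) ζ (hasDerivAt_wave_right h hE h1 h2) (B.hasDerivAt_τ ζ)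
  have d2 := (hasDerivAt_const ζ (A.r z)).div ((B.hasDerivAt_r ζ).pow 3) (pow_ne_zero 3 hr)
  refine ⟨_, d2.mul d1, ?_⟩
  simp only [kernelFun, Pi.pow_apply, Pi.div_apply]
  field_simp
  push_cast
  ring

/-- At the front the two one-sided derivatives cancel if the front moves along the diagonal. -/
theorem hasDerivWithinAt_kernelFun_front (h : Admissible (A.τ 1) f k F) (hE : ExpBound K M f k F)
    {δ : ℝ} (hδ : Tendsto f (𝓝[>] 0) (𝓝 δ)) (hz : z ∈ Ioo (0 : ℝ) 1) :
    HasDerivWithinAt (fun ζ => kernelFun A A (wave (A.τ 1) f k F) z ζ) (-(δ / A.r z ^ 4)) (Icc 0 z) z ∧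
      HasDerivWithinAt (fun t => kernelFun A A (wave (A.τ 1) f k F) t z) (δ / A.r z ^ 4) (Icc z 1) z := by
  have hr := (A.r_pos z).ne'
  have hw0 : wave (A.τ 1) f k F (A.τ z) (A.τ z) = 0 :=
    h.wave_zero ⟨A.τ_nonneg hz.1.le, A.τ_mono hz.2.le⟩ le_rfl
  obtain ⟨w1, w2⟩ := hasDerivWithinAt_wave_front h hE hδ (A.strictMono_τ hz.2)
  have d0 := (A.hasDerivAt_τ z)
  constructor
  · have d1 := HasDerivWithinAt.comp (h := A.τ) z w1 (d0.hasDerivWithinAt (s := Icc 0 z))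
      fun x hx => A.τ_mono hx.2
    have d2 := ((hasDerivAt_const z (A.r z)).div ((A.hasDerivAt_r z).pow 3)
      (pow_ne_zero 3 hr)).hasDerivWithinAt (s := Icc 0 z)
    refine (d2.mul d1).congr_deriv ?_
    simp only [Pi.pow_apply, Function.comp_apply, hw0, Pi.div_apply]
    field_simp
    ring
  · have d1 := HasDerivWithinAt.comp (h := A.τ) z w2 (d0.hasDerivWithinAt (s := Icc z 1))
      fun x hx => A.τ_mono hx.1
    have d2 := ((A.hasDerivAt_r z).div_const (A.r z ^ 3)).hasDerivWithinAt (s := Icc z 1)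
    refine (d2.mul d1).congr_deriv ?_
    simp only [Function.comp_apply, hw0]
    field_simp
    ring

theorem Coord.Z_mem_Ioc (B : Coord) {y : ℝ} : B.Z y ∈ Ioc (0 : ℝ) 1 ↔ y ∈ Ioc 0 (B.τ 1) := by
  rw [mem_Ioc, mem_Ioc, B.lt_Z_iff, B.τ_zero, ← not_lt, B.lt_Z_iff, not_lt]

/-- Weighted integrals of a kernel become weighted integrals of its wave. -/
theorem integral_kernelFun_mul {w : ℝ → ℝ → ℝ} {N β : ℝ → ℝ} {T : Finset ℝ}
    (hβ : ∀ y ∈ Ioc 0 (B.τ 1), B.Z y ∉ T → β y = N (B.Z y) / B.r (B.Z y)) (z : ℝ) :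
    ∫ ζ in (0 : ℝ)..1, kernelFun A B w z ζ * N ζ
      = A.r z * ∫ y in (0 : ℝ)..B.τ 1, w (A.τ z) y * β y := by
  rw [intervalIntegral.integral_of_le zero_le_one,
    intervalIntegral.integral_of_le (B.τ_nonneg zero_le_one), ← integral_indicator measurableSet_Ioc,
    ← integral_indicator measurableSet_Ioc, integral_coord B, ← integral_const_mul]
  have hT : ∀ᵐ y, B.Z y ∉ T := by
    have hc : (B.Z ⁻¹' (T : Set ℝ)).Countable := T.countable_toSet.preimage_of_injOn
      fun a _ b _ hab => by rw [← B.τ_Z a, hab, B.τ_Z]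
    filter_upwards [hc.ae_notMem volume] with y hy using hy
  refine integral_congr_ae ?_
  filter_upwards [hT] with y hy
  by_cases hm : y ∈ Ioc 0 (B.τ 1)
  · have hr := (B.r_pos (B.Z y)).ne'
    rw [indicator_of_mem hm, indicator_of_mem (B.Z_mem_Ioc.2 hm), hβ y hm hy, kernelFun, B.τ_Z]
    field_simp
  · rw [indicator_of_notMem hm, indicator_of_notMem fun hc => hm (B.Z_mem_Ioc.1 hc), mul_zero, mul_zero]

/-- The datum `N / r` in the travel time coordinate, made bounded and causal. -/
theorem exists_weight (B : Coord) {N : ℝ → ℝ} (hN : PiecewiseContinuous N) :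
    ∃ β, StepCont β ∧ (∃ C, ∀ y, |β y| ≤ C) ∧ (∀ y ≤ 0, β y = 0) ∧
      ∃ T : Finset ℝ, ∀ y ∈ Ioc 0 (B.τ 1), B.Z y ∉ T → β y = N (B.Z y) / B.r (B.Z y) := by
  obtain ⟨g, hg, T, hT⟩ := hN.exists_stepCont
  have h1 : StepCont fun y => g (B.Z y) * (B.r (B.Z y))⁻¹ :=
    (hg.comp B.continuous_Z B.lt_Z_iff).mul_continuous
      ((B.continuous_r.comp B.continuous_Z).inv₀ fun y => (B.r_pos _).ne')
  obtain ⟨β, hβ, hb, h0, he⟩ := h1.exists_cutoff (B.τ 1)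
  refine ⟨β, hβ, hb, h0, T, fun y hy hyT => ?_⟩
  rw [he y hy, hT _ ⟨Ioc_subset_Icc_self (B.Z_mem_Ioc.2 hy), hyT⟩, div_eq_mul_inv]

/-- The derivative of `g / r` in the travel time coordinate, made bounded and causal. As `g`
vanishes at `0`, its primitive is `g / r` itself. -/
theorem exists_derivative_weight (A : Coord) {g : ℝ → ℝ} (hg : PiecewiseC1 g) (hg0 : g 0 = 0) :
    ∃ d, StepCont d ∧ (∃ C, ∀ s, |d s| ≤ C) ∧ (∀ s ≤ 0, d s = 0) ∧
      ∀ z ∈ Icc (0 : ℝ) 1, prim d (A.τ z) = g z / A.r z := by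
  obtain ⟨hc, g', hg', S, hS⟩ := hg
  obtain ⟨G, hG, T, hT⟩ := hg'.exists_stepCont
  have cZ := A.continuous_Z
  have cr := A.continuous_r
  have cr' := A.contDiff_deriv_r.continuous
  have cg : Continuous fun s => g (clamp 1 (A.Z s)) :=
    hc.comp_continuous ((continuous_clamp 1).comp cZ) fun s => clamp_mem zero_le_one _
  have h1 : StepCont fun s => G (A.Z s) * A.r (A.Z s) + -(deriv A.r (A.Z s) * g (clamp 1 (A.Z s))) :=
    ((hG.comp cZ A.lt_Z_iff).mul_continuous (cr.comp cZ)).add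
      (.of_continuous (((cr'.comp cZ).mul cg).neg))
  obtain ⟨d, hd, hb, h0, he⟩ := h1.exists_cutoff (A.τ 1)
  refine ⟨d, hd, hb, h0, fun z hz => ?_⟩
  have hmem : ∀ s ∈ Icc 0 (A.τ z), A.Z s ∈ Icc (0 : ℝ) 1 := by
    intro s hs
    constructor
    · rw [← not_lt, ← A.strictMono_τ.lt_iff_lt, A.τ_Z, A.τ_zero]; exact not_lt.2 hs.1
    · rw [← A.strictMono_τ.le_iff_le, A.τ_Z]; exact hs.2.trans (A.τ_mono hz.2)
  have hco : (A.Z ⁻¹' (S ∪ T : Set ℝ)).Countable :=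
    (S.countable_toSet.union T.countable_toSet).preimage_of_injOn
      fun a _ b _ hab => by rw [← A.τ_Z a, hab, A.τ_Z]
  -- `g / r` is continuous and differentiable off a finite set, so it is the integral of its derivative
  have key := integral_eq_of_hasDerivAt_off_countable_of_le
    (fun s => g (A.Z s) / A.r (A.Z s)) d (A.τ_nonneg hz.1) hco
    ((hc.comp cZ.continuousOn hmem).div (cr.comp cZ).continuousOn fun s _ => (A.r_pos _).ne')
    (fun s hs => ?_) (hd.intervalIntegrable _ _)
  · rw [prim, key, A.Z_τ, A.Z_zero, hg0, zero_div, sub_zero]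
  · have hs1 : s ∈ Ioc 0 (A.τ 1) := ⟨hs.1.1, hs.1.2.le.trans (A.τ_mono hz.2)⟩
    have hZ := A.Z_mem_Ioc.2 hs1
    have hZ1 : A.Z s < 1 := by
      rw [← A.strictMono_τ.lt_iff_lt, A.τ_Z]; exact hs.1.2.trans_le (A.τ_mono hz.2)
    have hnot : A.Z s ∉ S ∧ A.Z s ∉ T := by
      have := hs.2
      simpa [not_or] using this
    have hr := (A.r_pos (A.Z s)).ne'
    refine (A.hasDerivAt_comp_Z ((hS _ ⟨⟨hZ.1, hZ1⟩, hnot.1⟩).div (A.hasDerivAt_r _) hr)).congr_deriv ?_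
    rw [he s hs1, clamp_of_mem (Ioc_subset_Icc_self hZ),
      hT _ ⟨Ioc_subset_Icc_self hZ, hnot.2⟩]
    field_simp
    ring

/-- The potential, frozen outside the rectangle that matters. -/
theorem exists_bounded_potential (A B : Coord) : ∃ q : ℝ × ℝ → ℝ, Continuous q ∧
    (∃ C, ∀ p, |q p| ≤ C) ∧
    ∀ s ∈ Icc 0 (A.τ 1), ∀ y ∈ Icc 0 (B.τ 1), q (s, y) = potential A B s y := by
  have hc : Continuous fun p : ℝ × ℝ => (clamp (A.τ 1) p.1, clamp (B.τ 1) p.2) :=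
    ((continuous_clamp _).comp continuous_fst).prodMk ((continuous_clamp _).comp continuous_snd)
  refine ⟨fun p => potential A B (clamp (A.τ 1) p.1) (clamp (B.τ 1) p.2),
    (continuous_potential A B).comp hc, ?_, fun s hs y hy => ?_⟩
  · obtain ⟨C, hC⟩ := ((isCompact_Icc (a := (0 : ℝ)) (b := A.τ 1)).prod
      (isCompact_Icc (a := (0 : ℝ)) (b := B.τ 1))).exists_bound_of_continuousOn
      (continuous_potential A B).continuousOn
    exact ⟨C, fun p => hC (clamp (A.τ 1) p.1, clamp (B.τ 1) p.2)
      ⟨clamp_mem (A.τ_nonneg zero_le_one) _, clamp_mem (B.τ_nonneg zero_le_one) _⟩⟩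
  · simp only [clamp_of_mem hs, clamp_of_mem hy]

end

/-! ### One row of the kernel equations -/

/-- The functions `u (j, b)` solve one row of the kernel equations, where `A` is the travel time
coordinate of the row and `B (j, b)` that of the column; `b = false` stands for the kernel on the
square and `b = true` for the one on the triangle, here extended to the square. The numbers `v b`
weigh the values in the first coupling condition. -/
structure IsRowKernel {J : Type} [Fintype J] (A : Coord) (B : J × Bool → Coord) (v : Bool → ℝ)
    (g₀ g₁ : J → ℝ → ℝ) (N₀ N₁ : J × Bool → J → ℝ → ℝ) (u : J × Bool → ℝ → ℝ → ℝ) : Prop where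
  /-- The kernels are continuous. -/
  continuous : ∀ e, Continuous fun p : ℝ × ℝ => u e p.1 p.2
  /-- Weighted integrals of the kernels are continuous. -/
  continuous_integral : ∀ e (N : ℝ → ℝ), PiecewiseContinuous N →
    Continuous fun z => ∫ ζ in (0 : ℝ)..1, u e z ζ * N ζ
  /-- The kernels have piecewise continuous first derivatives. -/
  piecewiseC1On : ∀ e, ∀ Ω ⊆ square, PiecewiseC1On Ω fun p => u e p.1 p.2
  /-- The kernel equation, with coefficients that are prescribed on `[0, 1]` only. -/
  weakKernelPDE : ∀ e, ∀ Ω ⊆ square, ∀ a b : ℝ → ℝ, (∀ x ∈ Icc (0 : ℝ) 1, a x = A.r x ^ 4) →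
    (∀ x ∈ Icc (0 : ℝ) 1, b x = (B e).r x ^ 4) → WeakKernelPDE Ω a b (u e)
  /-- Finite propagation speed. -/
  eq_zero : ∀ e z, ∀ ζ ∈ Icc (0 : ℝ) 1, A.τ z ≤ (B e).τ ζ → u e z ζ = 0
  /-- If row and column have the same coefficient, the front is the diagonal, where the one-sided
  derivatives are opposite. -/
  front : ∀ e, B e = A → ∀ z ∈ Ioo (0 : ℝ) 1, ∃ D,
    HasDerivWithinAt (fun ζ => u e z ζ) (-D) (Icc 0 z) z ∧
      HasDerivWithinAt (fun t => u e t z) D (Icc z 1) z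
  /-- The condition `(u b)_ζ = 0` at `ζ = 1`, where `b` is the coefficient of the column. -/
  end_condition : ∀ e, ∃ S : Finset ℝ, ∀ z ∈ Ioo (0 : ℝ) 1 \ (S : Set ℝ), ∃ D,
    HasDerivAt (fun ζ => u e z ζ) D 1 ∧
      D * (B e).r 1 ^ 4 + u e z 1 * (4 * (B e).r 1 ^ 3 * deriv (B e).r 1) = 0
  /-- The first coupling condition at `ζ = 0`. -/
  coupling_value : ∀ j, ∀ z ∈ Icc (0 : ℝ) 1, ∑ b, v b * (u (j, b) z 0 * (B (j, b)).r 0 ^ 4)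
    = g₁ j z - ∑ e, ∫ ζ in (0 : ℝ)..1, u e z ζ * N₁ e j ζ
  /-- The second coupling condition at `ζ = 0`. -/
  coupling_deriv : ∃ S : Finset ℝ, ∀ z ∈ Ioo (0 : ℝ) 1 \ (S : Set ℝ), ∃ D : J × Bool → ℝ,
    (∀ e, HasDerivAt (fun ζ => u e z ζ) (D e) 0) ∧
      ∀ j, ∑ b, (D (j, b) * (B (j, b)).r 0 ^ 4
        + u (j, b) z 0 * (4 * (B (j, b)).r 0 ^ 3 * deriv (B (j, b)).r 0))
      = -g₀ j z + ∑ e, ∫ ζ in (0 : ℝ)..1, u e z ζ * N₀ e j ζ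

theorem interior_subset_of_subset_square {Ω : Set (ℝ × ℝ)} (hΩ : Ω ⊆ square) :
    interior Ω ⊆ Ioo 0 1 ×ˢ Ioo 0 1 :=
  (interior_mono hΩ).trans interior_square_subset

/-- The waves of `exists_coupled_waves`, written in the original coordinates, solve one row of the
kernel equations. -/
theorem exists_isRowKernel {J : Type} [Fintype J] (A : Coord) (B : J × Bool → Coord) {v : Bool → ℝ}
    (hv₁ : 0 < v false) (hv₂ : v true < 0) {g₀ g₁ : J → ℝ → ℝ}
    (hg₀ : ∀ j, PiecewiseContinuous (g₀ j)) (hg₁ : ∀ j, PiecewiseC1 (g₁ j)) (hg₁z : ∀ j, g₁ j 0 = 0)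
    {N₀ N₁ : J × Bool → J → ℝ → ℝ} (hN₀ : ∀ e j, PiecewiseContinuous (N₀ e j))
    (hN₁ : ∀ e j, PiecewiseContinuous (N₁ e j)) : ∃ u, IsRowKernel A B v g₀ g₁ N₀ N₁ u := by
  classical
  choose d₀ hd₀ hd₀b hd₀z T₀ hd₀e using fun j => exists_weight A (hg₀ j)
  choose d₁ hd₁ hd₁b hd₁z hd₁e using fun j => exists_derivative_weight A (hg₁ j) (hg₁z j)
  choose β₀ hβ₀ hβ₀b _ R₀ hβ₀e using fun e j => exists_weight (B e) (hN₀ e j)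
  choose β₁ hβ₁ hβ₁b _ R₁ hβ₁e using fun e j => exists_weight (B e) (hN₁ e j)
  choose q hq hqb hqe using fun e => exists_bounded_potential A (B e)
  have hL : ∀ e, 0 < (B e).τ 1 := fun e => by
    have := (B e).strictMono_τ one_pos
    rwa [(B e).τ_zero] at this
  obtain ⟨f, k, F, K, M, hK, hA, hE, hk, hF, hf, hV, hD⟩ := exists_coupled_waves
    (L := fun e => (B e).τ 1) (h := fun e => (B e).r 1 * deriv (B e).r 1) (κ := fun e => (B e).r 0)
    (m := fun e => deriv (B e).r 0) hL (fun e => (B e).r_pos 0) hv₁ hv₂ hq hqb hd₀ hd₁ hd₀b hd₁b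
    hd₀z hd₁z (fun e j => (hβ₀ e j).measurable) (fun e j => (hβ₁ e j).measurable) hβ₀b hβ₁b
  -- the margin `1` makes the representation of `f` valid in a neighbourhood of each time up to `τ(1)`
  choose g hg hfg using hf (A.τ 1 + 1)
  choose T hT using fun e => (hg e).continuousAt
  have hcont : ∀ e, ∀ t ≤ A.τ 1, t ∉ T e → ContinuousAt (f e) t := by
    intro e t ht htT
    refine (hT e t htT).congr ?_
    filter_upwards [Iio_mem_nhds (by linarith : t < A.τ 1 + 1)] with s hs
    exact (hfg e s (le_of_lt hs)).symm
  have hF' : ∀ e, ∀ s ∈ Icc 0 (A.τ 1), ∀ y ∈ Icc 0 ((B e).τ 1),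
      F e (s, y) = potential A (B e) s y * wave ((B e).τ 1) (f e) (k e) (F e) s y := by
    intro e s hs y hy
    rw [hF, clamp_of_mem hy, hqe e s hs y hy]
  refine ⟨fun e => kernelFun A (B e) (wave ((B e).τ 1) (f e) (k e) (F e)), ?_⟩
  constructor
  · exact fun e => continuous_kernelFun A (B e) (hA e) (hE e)
  · intro e N hN
    obtain ⟨β, hβ, ⟨C, hC⟩, _, R, hR⟩ := exists_weight (B e) hN
    simp only [integral_kernelFun_mul hR]
    exact A.continuous_r.mul ((continuous_integral_wave (hA e) (hL e).le hK (hE e) hβ.measurable hC).comp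
      A.continuous_τ)
  · exact fun e Ω hΩ => piecewiseC1On_kernelFun A (B e) hΩ (hA e) (hE e) rfl (hg e) (hfg e)
      (by linarith)
  · exact fun e Ω hΩ a b ha hb => weakKernelPDE_kernelFun A (B e)
      (interior_subset_of_subset_square hΩ) ha hb (hA e) (hE e) (hF' e)
  · exact fun e z ζ hζ hz => kernelFun_eq_zero (hA e) hζ hz
  · intro e he z hz
    obtain ⟨δ, hδ⟩ := (hg e).tendsto_right 0
    have hδ' : Tendsto (f e) (𝓝[>] 0) (𝓝 δ) := by
      refine hδ.congr' ?_
      have h1 : (0 : ℝ) < A.τ 1 + 1 := by have := A.τ_nonneg zero_le_one; linarith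
      filter_upwards [mem_nhdsWithin_of_mem_nhds (Iio_mem_nhds h1)] with s hs
      exact (hfg e s (le_of_lt hs)).symm
    have h1 := hA e
    have h2 := hE e
    rw [he] at h1 ⊢
    exact ⟨_, hasDerivWithinAt_kernelFun_front h1 h2 hδ' hz⟩
  · intro e
    refine ⟨(T e).image fun t => A.Z (t + (B e).τ 1), fun z hz => ?_⟩
    have hz1 : A.τ z ≤ A.τ 1 := A.τ_mono hz.1.2.le
    have hnot : A.τ z - (B e).τ 1 ∉ T e := fun hc => hz.2 (by
      simp only [Finset.coe_image]
      exact ⟨_, hc, by simp only [sub_add_cancel, A.Z_τ]⟩)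
    have hc := hcont e _ (by linarith [hL e]) hnot
    obtain ⟨D, hD1, hD2⟩ := hasDerivAt_kernelFun_right (A := A) (hA e) (hE e) hc
      (by rwa [show A.τ z + (B e).τ 1 - 2 * (B e).τ 1 = A.τ z - (B e).τ 1 by ring])
    refine ⟨D, hD1, hD2.trans ?_⟩
    have hr := ((B e).r_pos 1).ne'
    have hk' := hk e (A.τ z)
    rw [waveY, show A.τ z + (B e).τ 1 - 2 * (B e).τ 1 = A.τ z - (B e).τ 1 by ring,
      show A.τ z + (B e).τ 1 - (B e).τ 1 = A.τ z by ring, hk']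
    field_simp
    ring
  · intro j z hz
    have h1 := hV j (A.τ z) (A.τ_nonneg hz.1)
    have hr := (A.r_pos z).ne'
    rw [hd₁e j z hz] at h1
    simp only [integral_kernelFun_mul (hβ₁e _ j), ← Finset.mul_sum]
    have e1 : ∀ b, v b * (kernelFun A (B (j, b)) (wave ((B (j, b)).τ 1) (f (j, b)) (k (j, b)) (F (j, b)))
        z 0 * (B (j, b)).r 0 ^ 4) = A.r z * (v b * (B (j, b)).r 0 *
          wave ((B (j, b)).τ 1) (f (j, b)) (k (j, b)) (F (j, b)) (A.τ z) 0) := by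
      intro b
      have := ((B (j, b)).r_pos 0).ne'
      rw [kernelFun, (B (j, b)).τ_zero]
      field_simp
    rw [Finset.sum_congr rfl fun b _ => e1 b, ← Finset.mul_sum, h1, mul_sub, mul_div_cancel₀ _ hr]
  · refine ⟨(Finset.univ.biUnion fun e => (T e).image A.Z ∪ (T e).image fun t => A.Z (t + 2 * (B e).τ 1))
      ∪ Finset.univ.biUnion T₀, fun z hz => ?_⟩
    have hz1 : A.τ z ≤ A.τ 1 := A.τ_mono hz.1.2.le
    have hz2 := hz.2
    simp only [Finset.coe_union, Finset.coe_biUnion, Finset.coe_image, mem_union, mem_iUnion,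
      Finset.coe_univ, mem_univ, exists_prop, true_and, not_or, not_exists] at hz2
    have hc : ∀ e, ContinuousAt (f e) (A.τ z - (B e).τ 0) := fun e => by
      rw [(B e).τ_zero, sub_zero]
      exact hcont e _ hz1 fun hm => (hz2.1 e).1 ⟨_, hm, A.Z_τ z⟩
    have hc2 : ∀ e, ContinuousAt (f e) (A.τ z + (B e).τ 0 - 2 * (B e).τ 1) := fun e => by
      rw [(B e).τ_zero, add_zero]
      refine hcont e _ (by linarith [hL e]) fun hm => (hz2.1 e).2 ⟨_, hm, ?_⟩
      simp only [sub_add_cancel, A.Z_τ]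
    choose D hD1 hD2 using fun e => hasDerivAt_kernelFun_right (A := A) (hA e) (hE e) (hc e) (hc2 e)
    refine ⟨D, hD1, fun j => ?_⟩
    have h1 := hD j (A.τ z)
    have hr := (A.r_pos z).ne'
    rw [hd₀e j (A.τ z) (A.Z_mem_Ioc.1 (by rw [A.Z_τ]; exact Ioo_subset_Ioc_self hz.1))
      (by rw [A.Z_τ]; exact hz2.2 j), A.Z_τ] at h1
    simp only [integral_kernelFun_mul (hβ₀e _ j), ← Finset.mul_sum]
    have e1 := fun b => hD2 (j, b)
    simp only [Coord.τ_zero] at e1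
    rw [Finset.sum_congr rfl fun b _ => e1 b,
      ← Finset.mul_sum, h1, mul_add, neg_div', mul_div_cancel₀ _ hr]

/-! ### From the rows to the matrix equations -/

/-- A smaller diffusion coefficient means a longer travel time. -/
theorem Coord.τ_lt_τ {A B : Coord} (h : ∀ x ∈ Icc (0 : ℝ) 1, B.r x < A.r x) {z : ℝ}
    (hz : z ∈ Ioc (0 : ℝ) 1) : A.τ z < B.τ z := by
  have hd : ∀ x, HasDerivAt (fun x => B.τ x - A.τ x) (1 / B.r x ^ 2 - 1 / A.r x ^ 2) x := fun x =>
    (B.hasDerivAt_τ x).sub (A.hasDerivAt_τ x)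
  have hmono : StrictMonoOn (fun x => B.τ x - A.τ x) (Icc 0 1) := by
    refine strictMonoOn_of_deriv_pos (convex_Icc 0 1)
      (fun x _ => (hd x).continuousAt.continuousWithinAt) fun x hx => ?_
    rw [interior_Icc] at hx
    rw [(hd x).deriv, sub_pos]
    exact one_div_lt_one_div_of_lt (pow_pos (B.r_pos x) 2)
      (pow_lt_pow_left₀ (h x (Ioo_subset_Icc_self hx)) (B.r_pos x).le two_ne_zero)
  have := hmono (left_mem_Icc.2 zero_le_one) (Ioc_subset_Icc_self hz) hz.1
  simp only [A.τ_zero, B.τ_zero, sub_zero] at this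
  linarith

/-- The derivative of a coefficient in terms of its fourth root. -/
theorem Coord.derivWithin_eq {A : Coord} {lam : ℝ → ℝ} (h : ∀ x ∈ Icc (0 : ℝ) 1, lam x = A.r x ^ 4)
    {x : ℝ} (hx : x ∈ Icc (0 : ℝ) 1) :
    derivWithin lam (Icc 0 1) x = 4 * A.r x ^ 3 * deriv A.r x := by
  have hd : HasDerivWithinAt lam (4 * A.r x ^ 3 * deriv A.r x) (Icc 0 1) x := by
    have := ((A.hasDerivAt_r x).pow 4).hasDerivWithinAt (s := Icc 0 1)
    refine (this.congr (fun y hy => h y hy) (h x hx)).congr_deriv ?_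
    norm_num
  exact hd.derivWithin (uniqueDiffOn_Icc one_pos x hx)

theorem PiecewiseContinuous.intervalIntegrable {N : ℝ → ℝ} (hN : PiecewiseContinuous N) :
    IntervalIntegrable N volume 0 1 := by
  obtain ⟨g, hg, T, hT⟩ := hN.exists_stepCont
  refine (hg.intervalIntegrable 0 1).congr_ae ?_
  refine (ae_restrict_iff' measurableSet_uIoc).2 ?_
  filter_upwards [T.countable_toSet.ae_notMem volume] with x hx hxm
  rw [uIoc_of_le zero_le_one] at hxm
  exact (hT x ⟨Ioc_subset_Icc_self hxm, hx⟩).symm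

theorem PiecewiseContinuous.const_mul_add {N g : ℝ → ℝ} (hN : PiecewiseContinuous N)
    (hg : Continuous g) (a : ℝ) : PiecewiseContinuous fun z => a * N z + g z := by
  obtain ⟨⟨S, hS⟩, hr, hl⟩ := hN
  refine ⟨⟨S, (continuousOn_const.mul hS).add hg.continuousOn⟩, fun x hx => ?_, fun x hx => ?_⟩
  · obtain ⟨l, hl⟩ := hr x hx
    exact ⟨_, (hl.const_mul a).add (hg.continuousAt.tendsto.mono_left inf_le_left)⟩
  · obtain ⟨l, hl⟩ := hl x hx
    exact ⟨_, (hl.const_mul a).add (hg.continuousAt.tendsto.mono_left inf_le_left)⟩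

theorem piecewiseContinuous_zero : PiecewiseContinuous fun _ => 0 :=
  ⟨⟨∅, continuousOn_const⟩, fun _ _ => ⟨0, tendsto_const_nhds⟩, fun _ _ => ⟨0, tendsto_const_nhds⟩⟩

theorem weakKernelPDE_zero (Ω : Set (ℝ × ℝ)) (a b : ℝ → ℝ) : WeakKernelPDE Ω a b fun _ _ => 0 :=
  fun φ _ _ _ => by simp

/-- A matrix function that vanishes beyond `z` may be integrated over `[0, 1]` instead of `[0, z]`. -/
theorem matIntegral_mul {n : ℕ} {X : ℝ → Matrix (Fin n) (Fin n) ℝ}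
    {M : ℝ → Matrix (Fin n) (Fin n) ℝ} (hX : ∀ i j, Continuous fun ζ => X ζ i j)
    (hM : ∀ i j, PiecewiseContinuous fun ζ => M ζ i j) {z : ℝ} (hz : z ∈ Icc (0 : ℝ) 1)
    (h0 : ∀ i j, ∀ ζ ∈ Ioc z 1, X ζ i j = 0) (i j : Fin n) :
    matIntegral 0 z (fun ζ => X ζ * M ζ) i j
      = ∑ l, ∫ ζ in (0 : ℝ)..1, X ζ i l * M ζ l j := by
  have hi : ∀ l, IntervalIntegrable (fun ζ => X ζ i l * M ζ l j) volume 0 1 := fun l =>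
    (hM l j).intervalIntegrable.continuousOn_mul (hX i l).continuousOn
  have hz0 : ∀ l, IntervalIntegrable (fun ζ => X ζ i l * M ζ l j) volume 0 z := fun l =>
    (hi l).mono_set (by rw [uIcc_of_le hz.1, uIcc_of_le zero_le_one]; exact Icc_subset_Icc_right hz.2)
  have hz1 : ∀ l, IntervalIntegrable (fun ζ => X ζ i l * M ζ l j) volume z 1 := fun l =>
    (hi l).mono_set (by rw [uIcc_of_le hz.2, uIcc_of_le zero_le_one]; exact Icc_subset_Icc_left hz.1)
  simp only [matIntegral, Matrix.of_apply, Matrix.mul_apply]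
  rw [intervalIntegral.integral_finsetSum fun l _ => hz0 l]
  refine Finset.sum_congr rfl fun l _ => ?_
  rw [← intervalIntegral.integral_add_adjacent_intervals (hz0 l) (hz1 l)]
  have : ∫ ζ in z..1, X ζ i l * M ζ l j = 0 := by
    refine intervalIntegral.integral_zero_ae (Eventually.of_forall fun ζ hζ => ?_)
    rw [uIoc_of_le hz.2] at hζ
    rw [h0 i l ζ hζ, zero_mul]
  rw [this, add_zero]

theorem sum_eq_sum_subtype_le {n : ℕ} (i : Fin n) {G : Fin n → ℝ} (hG : ∀ j, ¬ i ≤ j → G j = 0) :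
    ∑ j, G j = ∑ j : {j // i ≤ j}, G j := by
  rw [← Finset.sum_subtype (Finset.univ.filter (i ≤ ·)) (by simp) G, Finset.sum_filter]
  refine Finset.sum_congr rfl fun j _ => ?_
  split_ifs with h
  · rfl
  · exact hG j h

/-- The matrix whose entries on and above the diagonal are given row by row. -/
def ofRows {n : ℕ} (D : ∀ i : Fin n, {j // i ≤ j} × Bool → ℝ) (b : Bool) :
    Matrix (Fin n) (Fin n) ℝ :=
  Matrix.of fun i j => if h : i ≤ j then D i (⟨j, h⟩, b) else 0

theorem ofRows_of_le {n : ℕ} {D : ∀ i : Fin n, {j // i ≤ j} × Bool → ℝ} {b : Bool} {i j : Fin n}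
    (h : i ≤ j) : ofRows D b i j = D i (⟨j, h⟩, b) := dif_pos h

theorem ofRows_of_not_le {n : ℕ} {D : ∀ i : Fin n, {j // i ≤ j} × Bool → ℝ} {b : Bool} {i j : Fin n}
    (h : ¬ i ≤ j) : ofRows D b i j = 0 := dif_neg h

/-- The rows are solved independently of each other. In row `i` the columns `j ≥ i` carry the kernels
of `exists_isRowKernel` and the columns `j < i` are zero. The coupling conditions of the latter
columns, which contain no boundary value of the kernels, define `A0r` and `A1r`. -/
theorem exists_isDecouplingKernel {n : ℕ} {ll lr : Fin n → ℝ → ℝ} {Cl Cr : Fin n → Coord}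
    (hll : ∀ j, ∀ x ∈ Icc (0 : ℝ) 1, ll j x = (Cl j).r x ^ 4)
    (hlr : ∀ j, ∀ x ∈ Icc (0 : ℝ) 1, lr j x = (Cr j).r x ^ 4)
    (hsort : ∀ i j, i < j → ∀ x ∈ Icc (0 : ℝ) 1, lr j x < lr i x) {c : ℝ} (hc : 0 < c)
    {A0l A1l A0lr A1lr : ℝ → Matrix (Fin n) (Fin n) ℝ}
    (hA0l : ∀ i j, PiecewiseContinuous fun z => A0l z i j)
    (hA1l : ∀ i j, PiecewiseContinuous fun z => A1l z i j)
    (hA0lr : ∀ i j, PiecewiseContinuous fun z => A0lr z i j)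
    (hA1lr : ∀ i j, PiecewiseContinuous fun z => A1lr z i j)
    (hA1lr_C1 : ∀ i j, i ≤ j → PiecewiseC1 fun z => A1lr z i j)
    (hA1lr_zero : ∀ i j, i ≤ j → A1lr 0 i j = 0) :
    ∃ (P Q : ℝ → ℝ → Matrix (Fin n) (Fin n) ℝ) (A0r A1r : ℝ → Matrix (Fin n) (Fin n) ℝ),
      (∀ i j, PiecewiseC1On square fun p => P p.1 p.2 i j) ∧
      (∀ i j, PiecewiseC1On triangle fun p => Q p.1 p.2 i j) ∧
      (∀ z ∈ Icc (0 : ℝ) 1, StrictlyLower (A0r z)) ∧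
      (∀ z ∈ Icc (0 : ℝ) 1, StrictlyLower (A1r z)) ∧
      (∀ i j, PiecewiseContinuous fun z => A0r z i j) ∧
      (∀ i j, PiecewiseContinuous fun z => A1r z i j) ∧
      IsDecouplingKernel ll lr c A0l A1l A0lr A1lr A0r A1r P Q := by
  classical
  let B : ∀ i : Fin n, {j // i ≤ j} × Bool → Coord := fun i e => cond e.2 (Cr e.1) (Cl e.1)
  let v : Bool → ℝ := fun b => cond b (-(1 / c)) 1
  let N₀ : ∀ i : Fin n, {j // i ≤ j} × Bool → {j // i ≤ j} → ℝ → ℝ := fun i e j ζ =>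
    cond e.2 (A0lr ζ e.1 j) (A0l ζ e.1 j)
  let N₁ : ∀ i : Fin n, {j // i ≤ j} × Bool → {j // i ≤ j} → ℝ → ℝ := fun i e j ζ =>
    cond e.2 (A1lr ζ e.1 j) (A1l ζ e.1 j)
  have hv₂ : v true < 0 := by
    change -(1 / c) < 0
    exact neg_neg_of_pos (one_div_pos.2 hc)
  choose u hu using fun i : Fin n => exists_isRowKernel (Cr i) (B i) (v := v) one_pos hv₂
    (g₀ := fun j z => A0lr z i j) (g₁ := fun j z => A1lr z i j) (fun j => hA0lr i j)
    (fun j => hA1lr_C1 i j j.2) (fun j => hA1lr_zero i j j.2) (N₀ := N₀ i) (N₁ := N₁ i)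
    (by rintro ⟨e, _ | _⟩ j; exacts [hA0l e j, hA0lr e j])
    (by rintro ⟨e, _ | _⟩ j; exacts [hA1l e j, hA1lr e j])
  let X : Bool → ℝ → ℝ → Matrix (Fin n) (Fin n) ℝ := fun b z ζ => ofRows (fun i e => u i e z ζ) b
  have X_le : ∀ {b i j} (h : i ≤ j), (fun z ζ => X b z ζ i j) = u i (⟨j, h⟩, b) := fun h =>
    funext fun z => funext fun ζ => ofRows_of_le h
  have X_not : ∀ {b i j}, ¬ i ≤ j → (fun z ζ => X b z ζ i j) = fun _ _ => 0 := fun h =>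
    funext fun z => funext fun ζ => ofRows_of_not_le h
  have X_le' : ∀ {b i j} (h : i ≤ j) z ζ, X b z ζ i j = u i (⟨j, h⟩, b) z ζ := fun h _ _ =>
    ofRows_of_le h
  have X_not' : ∀ {b i j}, ¬ i ≤ j → ∀ z ζ, X b z ζ i j = 0 := fun h _ _ => ofRows_of_not_le h
  have X_cont : ∀ b i j z, Continuous fun ζ => X b z ζ i j := by
    intro b i j z
    by_cases h : i ≤ j
    · simp only [X_le' h]
      exact ((hu i).continuous (⟨j, h⟩, b)).comp (by fun_prop : Continuous fun ζ : ℝ => (z, ζ))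
    · simp only [X_not' h]; exact continuous_const
  have X_int : ∀ b i j (N : ℝ → ℝ), PiecewiseContinuous N →
      Continuous fun z => ∫ ζ in (0 : ℝ)..1, X b z ζ i j * N ζ := by
    intro b i j N hN
    by_cases h : i ≤ j
    · simp only [X_le' h]; exact (hu i).continuous_integral _ N hN
    · simp only [X_not' h, zero_mul, intervalIntegral.integral_zero]; exact continuous_const
  have hr_lt : ∀ i j, i < j → ∀ x ∈ Icc (0 : ℝ) 1, (Cr j).r x < (Cr i).r x := by
    intro i j hij x hx
    have := hsort i j hij x hx
    rw [hlr j x hx, hlr i x hx] at this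
    exact lt_of_pow_lt_pow_left₀ 4 ((Cr i).r_pos x).le this
  -- the front of each entry of the triangular kernel stays below the line `ζ = z`, because the
  -- column `j ≥ i` is not faster than the row `i`
  have Q_zero : ∀ i j z ζ, z ∈ Icc (0 : ℝ) 1 → ζ ∈ Icc z 1 → X true z ζ i j = 0 := by
    intro i j z ζ hz hζ
    by_cases h : i ≤ j
    · rw [X_le' h]
      have hζ0 : ζ ∈ Icc (0 : ℝ) 1 := ⟨hz.1.trans hζ.1, hζ.2⟩
      refine (hu i).eq_zero _ z ζ hζ0 ?_
      change (Cr i).τ z ≤ (Cr j).τ ζ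
      refine ((Cr i).τ_mono hζ.1).trans ?_
      rcases h.eq_or_lt with rfl | hlt
      · rfl
      · rcases hζ0.1.eq_or_lt with rfl | h0
        · rw [(Cr i).τ_zero, (Cr j).τ_zero]
        · exact (Coord.τ_lt_τ (hr_lt i j hlt) ⟨h0, hζ.2⟩).le
    · exact X_not' h z ζ
  have Q_diag_zero : ∀ z ∈ Icc (0 : ℝ) 1, X true z z = 0 := fun z hz =>
    Matrix.ext fun i j => Q_zero i j z z hz ⟨le_rfl, hz.2⟩
  have int_Q : ∀ {M : ℝ → Matrix (Fin n) (Fin n) ℝ}, (∀ i j, PiecewiseContinuous fun ζ => M ζ i j) →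
      ∀ z ∈ Icc (0 : ℝ) 1, ∀ i j, matIntegral 0 z (fun ζ => X true z ζ * M ζ) i j
        = ∑ l, ∫ ζ in (0 : ℝ)..1, X true z ζ i l * M ζ l j := fun hM z hz i j =>
    matIntegral_mul (fun i j => X_cont true i j z) hM hz
      (fun i j ζ hζ => Q_zero i j z ζ hz (Ioc_subset_Icc_self hζ)) i j
  have int_P : ∀ {M : ℝ → Matrix (Fin n) (Fin n) ℝ}, (∀ i j, PiecewiseContinuous fun ζ => M ζ i j) →
      ∀ z i j, matIntegral 0 1 (fun ζ => X false z ζ * M ζ) i j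
        = ∑ l, ∫ ζ in (0 : ℝ)..1, X false z ζ i l * M ζ l j := fun hM z i j =>
    matIntegral_mul (fun i j => X_cont false i j z) hM (right_mem_Icc.2 zero_le_one)
      (fun _ _ _ hζ => absurd hζ.1 (not_lt.2 hζ.2)) i j
  -- the sum of the two integral terms of a coupling condition
  let W : (ℝ → Matrix (Fin n) (Fin n) ℝ) → (ℝ → Matrix (Fin n) (Fin n) ℝ) → ℝ → Fin n → Fin n → ℝ :=
    fun Mr Ml z i j => (∑ l, ∫ ζ in (0 : ℝ)..1, X true z ζ i l * Mr ζ l j)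
      + ∑ l, ∫ ζ in (0 : ℝ)..1, X false z ζ i l * Ml ζ l j
  have W_cont : ∀ {Mr Ml : ℝ → Matrix (Fin n) (Fin n) ℝ},
      (∀ i j, PiecewiseContinuous fun ζ => Mr ζ i j) → (∀ i j, PiecewiseContinuous fun ζ => Ml ζ i j) →
      ∀ i j, Continuous fun z => W Mr Ml z i j := fun hr hl i j =>
    (continuous_finsetSum _ fun l _ => X_int true i l _ (hr l j)).add
      (continuous_finsetSum _ fun l _ => X_int false i l _ (hl l j))
  have W_row : ∀ (Mr Ml : ℝ → Matrix (Fin n) (Fin n) ℝ) z i (j : {j // i ≤ j}),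
      ∑ e : {j // i ≤ j} × Bool, ∫ ζ in (0 : ℝ)..1, u i e z ζ * cond e.2 (Mr ζ e.1 j) (Ml ζ e.1 j)
        = W Mr Ml z i j := by
    intro Mr Ml z i j
    have hG : ∀ b (M : ℝ → Matrix (Fin n) (Fin n) ℝ), ∑ l, ∫ ζ in (0 : ℝ)..1, X b z ζ i l * M ζ l j
        = ∑ l : {j // i ≤ j}, ∫ ζ in (0 : ℝ)..1, u i (l, b) z ζ * M ζ l j := by
      intro b M
      rw [sum_eq_sum_subtype_le i fun l hl => by
        simp only [X_not' hl, zero_mul, intervalIntegral.integral_zero]]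
      exact Finset.sum_congr rfl fun l _ => by simp only [X_le' l.2]
    simp only [W, hG]
    rw [Fintype.sum_prod_type_right, Fintype.sum_bool]
    rfl
  -- below the diagonal the coupling conditions are solved for the remaining coupling matrices
  let A0r : ℝ → Matrix (Fin n) (Fin n) ℝ := fun z => Matrix.of fun i j =>
    if i ≤ j then 0 else 1 * A0lr z i j + -W A0lr A0l z i j
  let A1r : ℝ → Matrix (Fin n) (Fin n) ℝ := fun z => Matrix.of fun i j =>
    if i ≤ j then 0 else -c * A1lr z i j + c * W A1lr A1l z i j
  refine ⟨X false, X true, A0r, A1r, fun i j => ?_, fun i j => ?_, fun z _ i j h => if_pos h,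
    fun z _ i j h => if_pos h, fun i j => ?_, fun i j => ?_, ?_⟩
  · by_cases h : i ≤ j
    · simp only [X_le' h]; exact (hu i).piecewiseC1On _ _ Subset.rfl
    · simp only [X_not' h]; exact piecewiseC1On_zero _
  · by_cases h : i ≤ j
    · simp only [X_le' h]; exact (hu i).piecewiseC1On _ _ triangle_subset_square
    · simp only [X_not' h]; exact piecewiseC1On_zero _
  · by_cases h : i ≤ j
    · simp only [A0r, Matrix.of_apply, if_pos h]; exact piecewiseContinuous_zero
    · simp only [A0r, Matrix.of_apply, if_neg h]
      exact (hA0lr i j).const_mul_add (W_cont hA0lr hA0l i j).neg 1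
  · by_cases h : i ≤ j
    · simp only [A1r, Matrix.of_apply, if_pos h]; exact piecewiseContinuous_zero
    · simp only [A1r, Matrix.of_apply, if_neg h]
      exact (hA1lr i j).const_mul_add (continuous_const.mul (W_cont hA1lr hA1l i j)) (-c)
  constructor
  · intro i j
    by_cases h : i ≤ j
    · rw [X_le h]; exact (hu i).weakKernelPDE _ _ Subset.rfl _ _ (hlr i) (hll j)
    · rw [X_not h]; exact weakKernelPDE_zero _ _ _
  · choose S hS using fun (i : Fin n) e => (hu i).end_condition e
    refine ⟨Finset.univ.biUnion fun i => Finset.univ.biUnion fun e => S i e, fun z hz => ?_⟩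
    have hzS : ∀ i e, z ∉ S i e := fun i e hm => hz.2 (by
      simp only [Finset.coe_biUnion, mem_iUnion]
      exact ⟨i, Finset.mem_coe.2 (Finset.mem_univ _), e, Finset.mem_coe.2 (Finset.mem_univ _), hm⟩)
    choose D hD1 hD2 using fun i e => hS i e z ⟨hz.1, hzS i e⟩
    refine ⟨ofRows D false, fun i j => ?_, ?_⟩
    · by_cases h : i ≤ j
      · simp only [X_le' h, ofRows_of_le h]; exact (hD1 i _).hasDerivWithinAt
      · simp only [X_not' h, ofRows_of_not_le h]; exact hasDerivWithinAt_const _ _ _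
    · ext i j
      rw [Matrix.add_apply, diagMat, diagMatDeriv, Matrix.mul_diagonal, Matrix.mul_diagonal,
        hll j 1 (right_mem_Icc.2 zero_le_one),
        Coord.derivWithin_eq (hll j) (right_mem_Icc.2 zero_le_one)]
      by_cases h : i ≤ j
      · rw [X_le' h, ofRows_of_le h]; exact hD2 i (⟨j, h⟩, false)
      · rw [X_not' h, ofRows_of_not_le h, zero_mul, zero_mul, add_zero]; rfl
  · intro ζ hζ
    ext i j
    by_cases h : i ≤ j
    · rw [X_le' h]
      refine (hu i).eq_zero _ 0 ζ hζ ?_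
      rw [(Cr i).τ_zero]; exact Coord.τ_nonneg _ hζ.1
    · exact X_not' h 0 ζ
  · refine ⟨∅, fun ζ hζ i j => ?_⟩
    have hζ0 := hζ.1
    refine (HasDerivAt.congr_of_eventuallyEq (hasDerivAt_const (0 : ℝ) (0 : ℝ)) ?_).hasDerivWithinAt
    by_cases h : i ≤ j
    · have hpos : (Cr i).τ 0 < (B i (⟨j, h⟩, false)).τ ζ := by
        rw [(Cr i).τ_zero, ← (B i (⟨j, h⟩, false)).τ_zero]
        exact Coord.strictMono_τ _ hζ0.1
      filter_upwards [(Cr i).continuous_τ.continuousAt.eventually (gt_mem_nhds hpos)] with t ht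
      rw [X_le' h]
      exact (hu i).eq_zero _ t ζ (Ioo_subset_Icc_self hζ0) ht.le
    · exact Eventually.of_forall fun t => X_not' h t ζ
  · intro i j
    by_cases h : i ≤ j
    · rw [X_le h]; exact (hu i).weakKernelPDE _ _ triangle_subset_square _ _ (hlr i) (hlr j)
    · rw [X_not h]; exact weakKernelPDE_zero _ _ _
  · refine ⟨∅, fun z hz' => ?_⟩
    have hz := hz'.1
    have hd : ∀ i j, ∃ D, HasDerivWithinAt (fun t => X true z t i j) (-D) (Icc 0 z) z ∧
        HasDerivWithinAt (fun t => X true t z i j) D (Icc z 1) z ∧ (i ≠ j → D = 0) := by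
      intro i j
      rcases lt_trichotomy i j with hlt | rfl | hgt
      · have hττ := Coord.τ_lt_τ (hr_lt i j hlt) (Ioo_subset_Ioc_self hz)
        refine ⟨0, ?_, ?_, fun _ => rfl⟩
        · refine (HasDerivAt.congr_of_eventuallyEq (hasDerivAt_const z (0 : ℝ)) ?_).hasDerivWithinAt.congr_deriv
            neg_zero.symm
          filter_upwards [(Cr j).continuous_τ.continuousAt.eventually (lt_mem_nhds hττ),
            Ioo_mem_nhds hz.1 hz.2] with t ht htm
          rw [X_le' hlt.le]
          exact (hu i).eq_zero _ z t (Ioo_subset_Icc_self htm) ht.le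
        · refine (HasDerivAt.congr_of_eventuallyEq (hasDerivAt_const z (0 : ℝ)) ?_).hasDerivWithinAt
          filter_upwards [(Cr i).continuous_τ.continuousAt.eventually (gt_mem_nhds hττ)] with t ht
          rw [X_le' hlt.le]
          exact (hu i).eq_zero _ t z (Ioo_subset_Icc_self hz) ht.le
      · obtain ⟨D, h1, h2⟩ := (hu i).front (⟨i, le_rfl⟩, true) rfl z hz
        simp only [X_le' (le_refl i)]
        exact ⟨D, h1, h2, fun hne => absurd rfl hne⟩
      · refine ⟨0, ?_, ?_, fun _ => rfl⟩
        · simp only [X_not' (not_le.2 hgt), neg_zero]; exact hasDerivWithinAt_const _ _ _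
        · simp only [X_not' (not_le.2 hgt)]; exact hasDerivWithinAt_const _ _ _
    choose D hD1 hD2 hD3 using hd
    refine ⟨Matrix.of fun i j => -D i j, 0, Matrix.of fun i j => D i j, hD1, fun i j => ?_, hD2, ?_⟩
    · refine HasDerivAt.congr_of_eventuallyEq (hasDerivAt_const z (0 : ℝ)) ?_
      filter_upwards [Ioo_mem_nhds hz.1 hz.2] with t ht
      rw [Q_diag_zero t (Ioo_subset_Icc_self ht)]; rfl
    · rw [Q_diag_zero z (Ioo_subset_Icc_self hz), zero_mul, mul_zero, add_zero, add_zero]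
      ext i j
      rw [Matrix.add_apply, diagMat, Matrix.mul_diagonal, Matrix.diagonal_mul, Matrix.of_apply,
        Matrix.of_apply, Matrix.zero_apply]
      by_cases h : i = j
      · rw [h]; ring
      · rw [hD3 i j h]; ring
  · intro z hz
    rw [Q_diag_zero z hz, mul_zero, zero_mul, sub_zero]
  · exact Q_diag_zero 0 (left_mem_Icc.2 zero_le_one)
  · intro z hz
    ext i j
    simp only [Matrix.add_apply, Matrix.sub_apply, Matrix.smul_apply, smul_eq_mul, diagMat,
      Matrix.mul_diagonal, int_Q hA1lr z hz, int_P hA1l z]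
    by_cases h : i ≤ j
    · have h1 := (hu i).coupling_value ⟨j, h⟩ z hz
      rw [W_row A1lr A1l z i ⟨j, h⟩, Fintype.sum_bool] at h1
      simp only [v, B, cond_true, cond_false] at h1
      simp only [A1r, Matrix.of_apply, if_pos h, X_le' h z 0, mul_zero, add_zero,
        hll j 0 (left_mem_Icc.2 zero_le_one), hlr j 0 (left_mem_Icc.2 zero_le_one)]
      simp only [W] at h1
      linarith
    · simp only [A1r, Matrix.of_apply, if_neg h, X_not' h z 0, W]
      field_simp
      ring
  · choose S hS using fun i => (hu i).coupling_deriv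
    refine ⟨Finset.univ.biUnion S, fun z hz => ?_⟩
    have hzS : ∀ i, z ∉ S i := fun i hm => hz.2 (by
      simp only [Finset.coe_biUnion, mem_iUnion]
      exact ⟨i, Finset.mem_coe.2 (Finset.mem_univ _), hm⟩)
    choose D hD1 hD2 using fun i => hS i z ⟨hz.1, hzS i⟩
    have hder : ∀ b s, HasPartialZeta (X b) (ofRows D b) s z 0 := by
      intro b s i j
      by_cases h : i ≤ j
      · simp only [X_le' h, ofRows_of_le h]; exact (hD1 i _).hasDerivWithinAt
      · simp only [X_not' h, ofRows_of_not_le h]; exact hasDerivWithinAt_const _ _ _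
    refine ⟨ofRows D true, ofRows D false, hder true _, hder false _, ?_⟩
    ext i j
    simp only [Matrix.add_apply, Matrix.neg_apply, diagMat, diagMatDeriv, Matrix.mul_diagonal,
      int_Q hA0lr z (Ioo_subset_Icc_self hz.1), int_P hA0l z,
      Coord.derivWithin_eq (hll j) (left_mem_Icc.2 zero_le_one),
      Coord.derivWithin_eq (hlr j) (left_mem_Icc.2 zero_le_one),
      hll j 0 (left_mem_Icc.2 zero_le_one), hlr j 0 (left_mem_Icc.2 zero_le_one)]
    by_cases h : i ≤ j
    · have h1 := hD2 i ⟨j, h⟩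
      rw [W_row A0lr A0l z i ⟨j, h⟩, Fintype.sum_bool] at h1
      simp only [B, cond_true, cond_false] at h1
      simp only [A0r, Matrix.of_apply, if_pos h, X_le' h z 0, ofRows_of_le h]
      simp only [W] at h1
      linarith
    · simp only [A0r, Matrix.of_apply, if_neg h, X_not' h z 0, ofRows_of_not_le h, W]
      ring

/-- The folded coefficients inherit the regularity. -/
theorem contDiffOn_fold {lam : ℝ → ℝ} (hlam : ContDiffOn ℝ 2 lam (Icc 0 1)) {a b d : ℝ}
    (hmaps : ∀ z ∈ Icc (0 : ℝ) 1, a + b * z ∈ Icc (0 : ℝ) 1) :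
    ContDiffOn ℝ 2 (fun z => lam (a + b * z) / d ^ 2) (Icc 0 1) :=
  (hlam.comp (by fun_prop : ContDiff ℝ 2 fun z : ℝ => a + b * z).contDiffOn hmaps).div_const _

end Folding

end

theorem mainTheorem3 (n : ℕ) (lam : Fin n → ℝ → ℝ) (z₀ : ℝ) (hz₀ : z₀ ∈ Ioo (0 : ℝ) 1)
    (hlam : ∀ i, ContDiffOn ℝ 2 (lam i) (Icc 0 1))
    (hpos : ∀ i, ∀ x ∈ Icc (0 : ℝ) 1, 0 < lam i x)
    (hsort : ∀ x ∈ Icc (0 : ℝ) 1, ∀ i j, i < j → lam j x < lam i x)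
    (hfold : ∀ z ∈ Icc (0 : ℝ) 1, ∀ i j, Folding.lamR lam z₀ i z < Folding.lamL lam z₀ j z)
    (A0l A1l A0lr A1lr : ℝ → Matrix (Fin n) (Fin n) ℝ)
    (hA0l_lower : ∀ z ∈ Icc (0 : ℝ) 1, Folding.StrictlyLower (A0l z))
    (hA1l_lower : ∀ z ∈ Icc (0 : ℝ) 1, Folding.StrictlyLower (A1l z))
    (hA0l : ∀ i j, Folding.PiecewiseContinuous fun z => A0l z i j)
    (hA1l : ∀ i j, Folding.PiecewiseContinuous fun z => A1l z i j)
    (hA0lr : ∀ i j, Folding.PiecewiseContinuous fun z => A0lr z i j)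
    (hA1lr : ∀ i j, Folding.PiecewiseContinuous fun z => A1lr z i j)
    (hA1lr_C1 : ∀ i j, i ≤ j → Folding.PiecewiseC1 fun z => A1lr z i j)
    (hA1lr_zero : ∀ i j, i ≤ j → A1lr 0 i j = 0) :
    ∃ (P Q : ℝ → ℝ → Matrix (Fin n) (Fin n) ℝ) (A0r A1r : ℝ → Matrix (Fin n) (Fin n) ℝ),
      (∀ i j, Folding.PiecewiseC1On Folding.square fun p => P p.1 p.2 i j) ∧
      (∀ i j, Folding.PiecewiseC1On Folding.triangle fun p => Q p.1 p.2 i j) ∧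
      (∀ z ∈ Icc (0 : ℝ) 1, Folding.StrictlyLower (A0r z)) ∧
      (∀ z ∈ Icc (0 : ℝ) 1, Folding.StrictlyLower (A1r z)) ∧
      (∀ i j, Folding.PiecewiseContinuous fun z => A0r z i j) ∧
      (∀ i j, Folding.PiecewiseContinuous fun z => A1r z i j) ∧
      Folding.IsDecouplingKernel (Folding.lamL lam z₀) (Folding.lamR lam z₀)
        (Folding.foldRatio z₀) A0l A1l A0lr A1lr A0r A1r P Q := by
  obtain ⟨h0, h1⟩ := hz₀
  have h2 : 0 < 1 - z₀ := sub_pos.2 h1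
  have ml : ∀ z ∈ Icc (0 : ℝ) 1, z₀ + -z₀ * z ∈ Icc (0 : ℝ) 1 := fun z hz =>
    ⟨by nlinarith [hz.1, hz.2], by nlinarith [hz.1, hz.2]⟩
  have mr : ∀ z ∈ Icc (0 : ℝ) 1, z₀ + (1 - z₀) * z ∈ Icc (0 : ℝ) 1 := fun z hz =>
    ⟨by nlinarith [hz.1, hz.2], by nlinarith [hz.1, hz.2]⟩
  have el : ∀ i, Folding.lamL lam z₀ i = fun z => lam i (z₀ + -z₀ * z) / z₀ ^ 2 := fun i => by
    ext z
    rw [Folding.lamL, neg_mul, sub_eq_add_neg]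
  choose Cl hCl using fun i => Folding.exists_coord (lam := Folding.lamL lam z₀ i)
    (by rw [el]; exact Folding.contDiffOn_fold (hlam i) ml)
    fun z hz => by rw [el]; exact div_pos (hpos i _ (ml z hz)) (pow_pos h0 2)
  choose Cr hCr using fun i => Folding.exists_coord (lam := Folding.lamR lam z₀ i)
    (Folding.contDiffOn_fold (hlam i) mr) fun z hz => div_pos (hpos i _ (mr z hz)) (pow_pos h2 2)
  exact Folding.exists_isDecouplingKernel hCl hCr
    (fun i j hij z hz => div_lt_div_of_pos_right (hsort _ (mr z hz) i j hij) (pow_pos h2 2))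
    (div_pos h0 h2) hA0l hA1l hA0lr hA1lr hA1lr_C1 hA1lr_zero
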